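/- Let $N\ge 2$ and let $V:\mathbb R\to\mathbb R^{N\times N}$ be symmetric-matrix-valued, $1$-periodic, with $\int_0^1\operatorname{Tr}V(t)^2\,dt<\infty$, normalized so that the lowest point of the spectrum of the self-adjoint operator $-\frac{d^2}{dt^2}+V$ in $L^2(\mathbb R)^N$ is $0$. For $z=x+iy\in\mathbb C$ let $M(z)$ be the $2N\times 2N$ monodromy matrix of $-f''+Vf=z^2f$, i.e. $M(z)=\begin{pmatrix}\vartheta&\varphi\\ \vartheta'&\varphi'\end{pmatrix}(1,z)$, where $\vartheta,\varphi$ are the matrix solutions with $\vartheta(0)=\varphi'(0)=I_N$, $\vartheta'(0)=\varphi(0)=0$. The (multivalued) Lyapunov function is $\Delta=\frac12(\tau+\tau^{-1})$, where $\tau$ runs over the eigenvalues of $M(z)$. Let $\mathcal R$ be its Riemann surface (whose points are the regular and the ramified function elements of $\Delta$) with its projection $\zeta\mapsto z$ to $\mathbb C$, let $\mathcal R_s$ be a connected component of $\mathcal R$, and let $\widetilde\Delta_s$ be the function $\Delta$ on $\mathcal R_s$. Let $\mathcal B$ be the set of the branch points of $\Delta$ in $\mathbb C$, $$\mathcal R_0^\pm=\mathbb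 C_\pm\setminus\bigcup_{\beta\in\mathcal B\cap\mathbb C_\pm}[\beta,\beta\pm i\infty),$$ and let $\Delta_1,\dots,\Delta_N$ be the analytic branches of $\Delta$ on $\mathcal R_0^+$, counted with multiplicity: $\det(M(z)-\tau)=(2\tau)^N\prod_m(\frac{\tau+\tau^{-1}}2-\Delta_m(z))$ for $\tau\ne0$. Let $\omega_s$ be the set of $m$ such that $\Delta_m$ is a branch of $\widetilde\Delta_s$. Let $\eta(w)=w+\sqrt{w^2-1}$ be the conformal map of $\mathbb C\setminus[-1,1]$ onto $\{|w|>1\}$ with $\eta(w)\sim 2w$ at infinity, with $|\eta|=1$ on $[-1,1]$. Let $k_m=p_m+iq_m=\arccos\Delta_m=i\log\eta(\Delta_m)$, $m=1,\dots,N$, be any analytic branches on $\mathcal R_0^+$, so that $e^{-ik_m}=\eta(\Delta_m)$. Then $\widetilde q_s=\log|\eta(\widetilde\Delta_s)|$ is subharmonic on $\mathcal R_s$, and, as $|z|\to\infty$, $\zeta\in\mathcal R_s$, $$\widetilde q_s(\zeta)=y+O(1/|z|)\quad\text{for } y>r|x|,\text{ for any } r>0,\qquad\qquad \widetilde q_s(\zeta)=|y|+O(|z|^{-1/2}).$$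 Moreover, let $j\in\omega_s$, and let $Y=(\alpha,\beta)\subset\mathbb R$ be a bounded non-empty interval such that $\Delta_j$ extends analytically from $\mathcal R_0^+$ to (a neighbourhood of) $\mathcal R_0^+\cup Y$. Put $\mathcal D=\mathcal R_0^+\cup\mathcal R_0^-\cup Y$. i) If $\Delta_j(z)\in\mathbb R\setminus[-1,1]$ for all $z\in Y$, then $k_j$ has an analytic extension from $\mathcal R_0^+$ to $\mathcal D$ such that $\operatorname{Re}k_j$ is constant on $Y$ with value in $\pi\mathbb Z$, and $q_j(z)=q_j(\bar z)>0$ for all $z\in\mathcal D$, where $q_j=\operatorname{Im}k_j$. ii) If $\Delta_j(z)\notin\mathbb R$ for all $z\in Y$, then there is $i\in\omega_s$ such that $\Delta_i$ extends analytically to $\mathcal R_0^+\cup Y$ and $\overline{\Delta_i(z)}=\Delta_j(z)$ for $z\in Y$. The function $\Delta_j$ has an analytic extension from $\mathcal R_0^+$ to $\mathcal D$, equal to $\overline{\Delta_i(\bar z)}$ for $z\in\mathcal R_0^-$. The functions $k_i,k_j$ extend analytically to $\mathcal R_0^+\cup Y$, where on $Y$ the sum $p_j+p_i$ is constant with value in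 $2\pi\mathbb Z$ and $q_j=q_i$. The function $k_i+k_j$ has an analytic extension $K$ from $\mathcal R_0^+$ to $\mathcal D$ that agrees with the sum of these extensions on $Y$, and $\operatorname{Im}K(z)=\operatorname{Im}K(\bar z)>0$ for all $z\in\mathcal D$ (that is, $q_j(z)+q_i(z)=q_j(\bar z)+q_i(\bar z)>0$). -/

import Mathlib

open Set Filter Topology MeasureTheory

noncomputable section

namespace PeriodicMatrixSchrodinger

/-- The potential class: real symmetric `N × N` matrix functions of period one whose entries are
square integrable over a period (equivalently, `∫₀¹ Tr V² < ∞`). -/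
structure IsPotential {N : ℕ} (V : ℝ → Matrix (Fin N) (Fin N) ℝ) : Prop where
  symm : ∀ t, (V t).IsSymm
  periodic : ∀ t, V (t + 1) = V t
  memLp : ∀ a b, MemLp (fun t => V t a b) 2 (volume.restrict (Ioc (0 : ℝ) 1))

/-- The graph of the self-adjoint operator `L f = -f'' + V f` in `L²(ℝ)^N` on its (maximal) domain:
`f, g ∈ L²`, `f` is differentiable, `f'` is locally absolutely continuous, `-f'' + V f = g` a.e.
The last two conditions are written in integrated form. -/
def OperatorGraph {N : ℕ} (V : ℝ → Matrix (Fin N) (Fin N) ℝ) (f g : ℝ → Fin N → ℂ) : Prop :=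
  MemLp f 2 volume ∧ MemLp g 2 volume ∧
  ∃ f' : ℝ → Fin N → ℂ, (∀ t, HasDerivAt f (f' t) t) ∧
    ∀ t, f' t = f' 0 + ∫ s in (0 : ℝ)..t, (((V s).map (fun x : ℝ => (x : ℂ))).mulVec (f s) - g s)

/-- The spectrum of `L = -d²/dt² + V` in `L²(ℝ)^N`: the complex `μ` for which `L - μ` is not a
bijection from the domain of `L` onto `L²(ℝ)^N`. (`L` is closed, so that the inverse of a bijective
`L - μ` is bounded. Elements of the domain are continuous, so they are true functions.) -/
def operatorSpectrum {N : ℕ} (V : ℝ → Matrix (Fin N) (Fin N) ℝ) : Set ℂ :=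
  {μ | ¬ ∀ g : ℝ → Fin N → ℂ, MemLp g 2 volume → ∃! f, OperatorGraph V f (g + μ • f)}

/-- `X(t)` is the fundamental matrix `[[ϑ, φ], [ϑ', φ']]` of `-f'' + V f = z² f`, normalized by
`X(0) = 1`: the entries of `ϑ, φ` are differentiable with derivatives the entries of `ϑ', φ'`, and
these satisfy `f'(t) = f'(0) + ∫₀ᵗ (V - z²) f`. -/
structure IsFundamental {N : ℕ} (V : ℝ → Matrix (Fin N) (Fin N) ℝ) (z : ℂ)
    (X : ℝ → Matrix (Fin N ⊕ Fin N) (Fin N ⊕ Fin N) ℂ) : Prop where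
  initial : X 0 = 1
  deriv_top : ∀ (a : Fin N) (b : Fin N ⊕ Fin N) (t : ℝ),
    HasDerivAt (fun s => X s (Sum.inl a) b) (X t (Sum.inr a) b) t
  integral_bottom : ∀ (a : Fin N) (b : Fin N ⊕ Fin N) (t : ℝ),
    X t (Sum.inr a) b = X 0 (Sum.inr a) b +
      ∫ s in (0 : ℝ)..t, ((∑ c, (V s a c : ℂ) * X s (Sum.inl c) b) - z ^ 2 * X s (Sum.inl a) b)

/-- The fundamental matrix: the solution of the (uniquely solvable) initial value problem. -/
def fundamental {N : ℕ} (V : ℝ → Matrix (Fin N) (Fin N) ℝ) (z : ℂ) :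
    ℝ → Matrix (Fin N ⊕ Fin N) (Fin N ⊕ Fin N) ℂ :=
  Classical.epsilon (IsFundamental V z)

/-- The monodromy matrix `M(z)`, the fundamental matrix at `t = 1`. -/
def monodromy {N : ℕ} (V : ℝ → Matrix (Fin N) (Fin N) ℝ) (z : ℂ) :
    Matrix (Fin N ⊕ Fin N) (Fin N ⊕ Fin N) ℂ :=
  fundamental V z 1

/-- `D(τ, z) = det (M(z) - τ)`. -/
def charDet {N : ℕ} (V : ℝ → Matrix (Fin N) (Fin N) ℝ) (τ z : ℂ) : ℂ :=
  (monodromy V z - τ • (1 : Matrix (Fin N ⊕ Fin N) (Fin N ⊕ Fin N) ℂ)).det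

/-- The values at `z` of the Lyapunov function: `(τ + τ⁻¹) / 2` for the multipliers `τ`, that is,
for the eigenvalues of `M(z)`. -/
def lyapunovValues {N : ℕ} (V : ℝ → Matrix (Fin N) (Fin N) ℝ) (z : ℂ) : Set ℂ :=
  {ν | ∃ τ : ℂ, τ ≠ 0 ∧ charDet V τ z = 0 ∧ ν = (τ + τ⁻¹) / 2}

/-! ### The Riemann surface of the Lyapunov function -/

/-- An (algebraic) function element `z = c + tⁿ`, `ν = f(t)`, `|t| < r`, of the Lyapunov function:
`f` is analytic, `f(t)` is a value of the Lyapunov function at `c + tⁿ`, and `t ↦ (c + tⁿ, f(t))`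
is injective. Thus `t` is a local uniformizing parameter, and the `n` branches
`f((z - c)^{1/n})` form a cycle of period `n`. -/
structure LyapunovElement {N : ℕ} (V : ℝ → Matrix (Fin N) (Fin N) ℝ) where
  center : ℂ
  order : ℕ
  radius : ℝ
  fn : ℂ → ℂ
  order_pos : 0 < order
  radius_pos : 0 < radius
  analytic : AnalyticOnNhd ℂ fn (Metric.ball 0 radius)
  mem_values : ∀ t ∈ Metric.ball (0 : ℂ) radius, fn t ∈ lyapunovValues V (center + t ^ order)
  injOn : InjOn (fun t : ℂ => (center + t ^ order, fn t)) (Metric.ball 0 radius)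

/-- The disjoint union of the parameter discs of all function elements. -/
abbrev LyapunovDiscs {N : ℕ} (V : ℝ → Matrix (Fin N) (Fin N) ℝ) : Type :=
  Σ e : LyapunovElement V, Metric.ball (0 : ℂ) e.radius

/-- Two parameter values define the same point of the surface when a local biholomorphism `h`
between the parameters carries the one function element into the other. -/
def SamePoint {N : ℕ} (V : ℝ → Matrix (Fin N) (Fin N) ℝ) (x y : LyapunovDiscs V) : Prop :=
  ∃ h : ℂ → ℂ, AnalyticAt ℂ h x.2.1 ∧ deriv h x.2.1 ≠ 0 ∧ h x.2.1 = y.2.1 ∧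
    ∀ᶠ t in 𝓝 x.2.1,
      x.1.center + t ^ x.1.order = y.1.center + (h t) ^ y.1.order ∧ x.1.fn t = y.1.fn (h t)

/-- The Riemann surface `R` of the Lyapunov function: the discs of all function elements, glued
along biholomorphic changes of parameter. Its connected components are the surfaces `R_s`. -/
def LyapunovSurface {N : ℕ} (V : ℝ → Matrix (Fin N) (Fin N) ℝ) : Type :=
  Quot (SamePoint V)

instance {N : ℕ} (V : ℝ → Matrix (Fin N) (Fin N) ℝ) : TopologicalSpace (LyapunovSurface V) :=
  inferInstanceAs (TopologicalSpace (Quot (SamePoint V)))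

/-- The point with parameter `t` in the disc of the element `e`. -/
def LyapunovElement.pt {N : ℕ} {V : ℝ → Matrix (Fin N) (Fin N) ℝ} (e : LyapunovElement V)
    (t : Metric.ball (0 : ℂ) e.radius) : LyapunovSurface V :=
  Quot.mk _ ⟨e, t⟩

/-- The natural projection of the surface to the `z`-plane. -/
def proj {N : ℕ} {V : ℝ → Matrix (Fin N) (Fin N) ℝ} : LyapunovSurface V → ℂ :=
  Quot.lift (fun x => x.1.center + (x.2.1 : ℂ) ^ x.1.order) (by
    rintro x y ⟨h, -, -, h0, h1⟩
    have := h1.self_of_nhds.1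
    rw [h0] at this
    exact this)

/-- The Lyapunov function as a function on its Riemann surface; its restriction to the component
`R_s` is `Δ̃_s`. -/
def lyapunov {N : ℕ} {V : ℝ → Matrix (Fin N) (Fin N) ℝ} : LyapunovSurface V → ℂ :=
  Quot.lift (fun x => x.1.fn (x.2.1 : ℂ)) (by
    rintro x y ⟨h, -, -, h0, h1⟩
    have := h1.self_of_nhds.2
    rw [h0] at this
    exact this)

/-- `η(z) = z + √(z² - 1)`, the conformal map of `ℂ \ [-1,1]` onto `{|w| > 1}` with
`η(z) ~ 2z` at infinity. The product of the principal square roots of `z - 1` and `z + 1` is the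
branch of `√(z² - 1)` that is analytic off `[-1,1]`. On `[-1,1]`, where this is a boundary value
from above, `|η| = 1`. -/
def eta (z : ℂ) : ℂ := z + (z - 1) ^ (1 / 2 : ℂ) * (z + 1) ^ (1 / 2 : ℂ)

/-- `q̃ = log |η(Δ̃)|` on the surface; it is zero where `Δ̃ ∈ [-1,1]`. -/
def lyapunovQ {N : ℕ} {V : ℝ → Matrix (Fin N) (Fin N) ℝ} (ζ : LyapunovSurface V) : ℝ :=
  Real.log ‖eta (lyapunov ζ)‖

/-- Subharmonicity of a (finite) real function on a plane domain: upper semicontinuity and the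
sub-mean value inequality on all closed discs in the domain. -/
def SubharmonicOn (u : ℂ → ℝ) (U : Set ℂ) : Prop :=
  UpperSemicontinuousOn u U ∧
  ∀ (c : ℂ) (r : ℝ), 0 < r → Metric.closedBall c r ⊆ U →
    CircleIntegrable u c r ∧ u c ≤ Real.circleAverage u c r

open Classical in
/-- A function on the surface in the local parameter of an element (zero off the disc). -/
def localRep {N : ℕ} {V : ℝ → Matrix (Fin N) (Fin N) ℝ} (u : LyapunovSurface V → ℝ)
    (e : LyapunovElement V) (t : ℂ) : ℝ :=
  if h : t ∈ Metric.ball (0 : ℂ) e.radius then u (e.pt ⟨t, h⟩) else 0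

/-- Subharmonicity on an open part `S` of the surface: subharmonicity in every local uniformizing
parameter (on every parameter disc lying in `S`). -/
def SubharmonicOnSurface {N : ℕ} {V : ℝ → Matrix (Fin N) (Fin N) ℝ} (u : LyapunovSurface V → ℝ)
    (S : Set (LyapunovSurface V)) : Prop :=
  ∀ e : LyapunovElement V, (∀ t, e.pt t ∈ S) →
    SubharmonicOn (localRep u e) (Metric.ball 0 e.radius)

/-! ### Branches on the cut half planes -/

/-- The branch points of the Lyapunov function: projections of the ramification points. -/
def branchPoints {N : ℕ} (V : ℝ → Matrix (Fin N) (Fin N) ℝ) : Set ℂ :=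
  {z | ∃ e : LyapunovElement V, e.center = z ∧ 2 ≤ e.order}

/-- `R₀⁺`: the upper half plane cut along `[β, β + i∞)` for all its branch points `β`. -/
def cutUpper {N : ℕ} (V : ℝ → Matrix (Fin N) (Fin N) ℝ) : Set ℂ :=
  {z | 0 < z.im} \ {z | ∃ b ∈ branchPoints V, 0 < b.im ∧ z.re = b.re ∧ b.im ≤ z.im}

/-- `R₀⁻`: the lower half plane cut along `[β, β - i∞)` for all its branch points `β`. -/
def cutLower {N : ℕ} (V : ℝ → Matrix (Fin N) (Fin N) ℝ) : Set ℂ :=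
  {z | z.im < 0} \ {z | ∃ b ∈ branchPoints V, b.im < 0 ∧ z.re = b.re ∧ z.im ≤ b.im}

/-- The open interval `(α, β)` of the real line, as a subset of `ℂ`. -/
def realInterval (α β : ℝ) : Set ℂ := (fun x : ℝ => (x : ℂ)) '' Ioo α β

/-- `Δ 0, …, Δ (N-1)` are the single-valued analytic branches on `R₀⁺` of the Lyapunov function
(counted with multiplicity): `D(τ, z) / (2τ)^N = ∏ (ν - Δ_m(z))`, `ν = (τ + τ⁻¹)/2`, `τ ≠ 0`. -/
structure IsLyapunovBranches {N : ℕ} (V : ℝ → Matrix (Fin N) (Fin N) ℝ) (Δ : Fin N → ℂ → ℂ) :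
    Prop where
  analytic : ∀ m, AnalyticOnNhd ℂ (Δ m) (cutUpper V)
  factor : ∀ z ∈ cutUpper V, ∀ τ : ℂ, τ ≠ 0 →
    charDet V τ z / (2 * τ) ^ N = ∏ m, ((τ + τ⁻¹) / 2 - Δ m z)

/-- The function `f` on `R₀⁺` is a branch of the Lyapunov function on the part `S` of the surface:
each germ of `f` (as an unramified function element) lies on `S`. For a component `S = R_s` and
`f = Δ_j` this says that `j ∈ ω_s`. -/
def IsBranchOn {N : ℕ} {V : ℝ → Matrix (Fin N) (Fin N) ℝ} (S : Set (LyapunovSurface V))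
    (f : ℂ → ℂ) : Prop :=
  ∀ z ∈ cutUpper V, ∃ e : LyapunovElement V, (∀ t, e.pt t ∈ S) ∧ e.center = z ∧ e.order = 1 ∧
    ∀ᶠ t in 𝓝 (0 : ℂ), e.fn t = f (z + t)

/-- `k` is a single-valued analytic branch on `R₀⁺` of the quasimomentum
`arccos Δ = i log η(Δ)`, that is, `exp (-i k) = η(Δ)`. -/
def IsQuasimomentum {N : ℕ} (V : ℝ → Matrix (Fin N) (Fin N) ℝ) (Δ k : ℂ → ℂ) : Prop :=
  AnalyticOnNhd ℂ k (cutUpper V) ∧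
    ∀ z ∈ cutUpper V, Complex.exp (-Complex.I * k z) = eta (Δ z)

/-- `F` is an analytic extension to `B` of the function `f` on `A`. -/
def IsAnalyticExtension (f : ℂ → ℂ) (A : Set ℂ) (F : ℂ → ℂ) (B : Set ℂ) : Prop :=
  AnalyticOnNhd ℂ F B ∧ EqOn F f A

end PeriodicMatrixSchrodinger

end

open Set Filter Topology MeasureTheory

noncomputable section

namespace PeriodicMatrixSchrodinger

variable {N : ℕ} {V : ℝ → Matrix (Fin N) (Fin N) ℝ}

section

/-! ### Products of indefinite integrals -/

/-! The monodromy matrix M is entire in z, symplectic, and compatible with complex conjugation.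
Hence L = (M + M⁻¹)/2 is entire and its eigenvalues are exactly the values of Δ
(`mem_lyapunovValues_iff`). If ν = (τ + τ⁻¹)/2, then log|η(ν)| = |log|τ||, so statements about q̃
are statements about moduli of multipliers.

Asymptotics. A Bloch solution splits into parts along e^{-izt} and e^{izt}, which V couples with
strength O(1/|z|) only. For Im z ≥ 0 the larger part forces τ or, after time reversal, τ⁻¹ to be
e^{-iz} up to a relative error O(1/|z|). So |log|τ|| = |y| + O(1/|z|) on the whole surface, which
contains both asserted estimates.

Subharmonicity. The Chebyshev polynomials satisfy T_n = (ηⁿ + η⁻ⁿ)/2, so log|η| is the limit of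
(1/n) log|T_n|, and Jensen's formula for T_n ∘ f passes to the limit for every analytic f.

Positivity. A multiplier of modulus one gives a bounded Bloch solution and puts z² in the spectrum
(`bloch_mem_spectrum`); the spectrum begins at 0, so z is real. Thus Δ avoids [-1,1] off the real
axis (`not_inBand`), and e^{Im k} = |η(Δ)| > 1 there.

Reflection. Near Y the function conj Δ_j(conj z) is again a branch of Δ on the upper side, say Δ_i,
the same along all of Y. Since η commutes with conjugation off the band, k_j(z) + conj k_i(conj z)
lies in 2πℤ near Y and is constant; this relation continues the quasimomenta across Y
(`exists_reflectGlue_analytic`). In case i) the reflected function is Δ_j itself; in case ii) the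
imaginary part of the sum k_i + k_j is symmetric.

The delicate claim is i ∈ ω_s, that is, each component is its own mirror image. It suffices to find
one self-conjugate germ at a real point, and a germ with value in [-1,1] is one. If a component had
none, log|η(Δ)| would be harmonic at its unramified points while close to |y| at infinity. A
strictly subharmonic quadratic function, well below |y| on a large circle but far above log|η| at a
fixed point, then contradicts the minimum principle (`exists_germIn_inBand`). Possible ramification
is confined to the zeros of an entire function δ (`exists_isRegularizer`) and is kept away from the
minimum by a penalty -ε log|δ|. The same δ shows that branch points are isolated, so that the cut
half plane is open and connected. -/

theorem integral_mul_add_mul_real {f g F G : ℝ → ℝ} {a b : ℝ}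
    (hf : IntervalIntegrable f volume a b) (hg : IntervalIntegrable g volume a b)
    (hF : ∀ t ∈ uIcc a b, F t = F a + ∫ s in a..t, f s)
    (hG : ∀ t ∈ uIcc a b, G t = G a + ∫ s in a..t, g s) :
    ∫ s in a..b, (f s * G s + F s * g s) = F b * G b - F a * G a := by
  set F' : ℝ → ℝ := fun t => F a + ∫ s in a..t, f s with hF'
  set G' : ℝ → ℝ := fun t => G a + ∫ s in a..t, g s with hG'
  -- Absolute continuity is what integration by parts needs here, f and g being merely integrable.
  have hFac : AbsolutelyContinuousOnInterval F' a b :=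
    ((LipschitzWith.const (F a)).lipschitzOnWith (s := uIcc a b)).absolutelyContinuousOnInterval.fun_add
      (hf.absolutelyContinuousOnInterval_intervalIntegral left_mem_uIcc)
  have hGac : AbsolutelyContinuousOnInterval G' a b :=
    ((LipschitzWith.const (G a)).lipschitzOnWith (s := uIcc a b)).absolutelyContinuousOnInterval.fun_add
      (hg.absolutelyContinuousOnInterval_intervalIntegral left_mem_uIcc)
  have key := hFac.integral_deriv_mul_eq_sub hGac
  have e1 : F' b = F b := (hF b right_mem_uIcc).symm
  have e2 : G' b = G b := (hG b right_mem_uIcc).symm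
  have e3 : F' a = F a := by simp [hF']
  have e4 : G' a = G a := by simp [hG']
  rw [e1, e2, e3, e4] at key
  rw [← key]
  apply intervalIntegral.integral_congr_ae
  filter_upwards [hf.ae_hasDerivAt_integral, hg.ae_hasDerivAt_integral] with x h1 h2 hx
  have hx' := uIoc_subset_uIcc hx
  have d1 : deriv F' x = f x := ((h1 hx' a left_mem_uIcc).const_add (F a)).deriv
  have d2 : deriv G' x = g x := ((h2 hx' a left_mem_uIcc).const_add (G a)).deriv
  rw [d1, d2, hF x hx', hG x hx']

theorem _root_.IntervalIntegrable.re {f : ℝ → ℂ} {a b : ℝ}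
    (hf : IntervalIntegrable f volume a b) :
    IntervalIntegrable (fun s => (f s).re) volume a b :=
  ⟨hf.1.re, hf.2.re⟩

theorem _root_.IntervalIntegrable.im {f : ℝ → ℂ} {a b : ℝ}
    (hf : IntervalIntegrable f volume a b) :
    IntervalIntegrable (fun s => (f s).im) volume a b :=
  ⟨hf.1.im, hf.2.im⟩

theorem intervalIntegral_re {f : ℝ → ℂ} {a b : ℝ} (hf : IntervalIntegrable f volume a b) :
    (∫ s in a..b, f s).re = ∫ s in a..b, (f s).re :=
  (Complex.reCLM.intervalIntegral_comp_comm hf).symm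

theorem intervalIntegral_im {f : ℝ → ℂ} {a b : ℝ} (hf : IntervalIntegrable f volume a b) :
    (∫ s in a..b, f s).im = ∫ s in a..b, (f s).im :=
  (Complex.imCLM.intervalIntegral_comp_comm hf).symm

theorem continuousOn_of_eq_integral {E : Type*} [NormedAddCommGroup E] [NormedSpace ℝ E]
    {f F : ℝ → E} {a b : ℝ} (hf : IntervalIntegrable f volume a b)
    (hF : ∀ t ∈ uIcc a b, F t = F a + ∫ s in a..t, f s) : ContinuousOn F (uIcc a b) := by
  have := intervalIntegral.continuousOn_primitive_interval' hf (left_mem_uIcc (a := a) (b := b))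
  exact (continuousOn_const.add this).congr hF

/-- The product rule for indefinite integrals of integrable functions. -/
theorem integral_mul_add_mul {f g F G : ℝ → ℂ} {a b : ℝ}
    (hf : IntervalIntegrable f volume a b) (hg : IntervalIntegrable g volume a b)
    (hF : ∀ t ∈ uIcc a b, F t = F a + ∫ s in a..t, f s)
    (hG : ∀ t ∈ uIcc a b, G t = G a + ∫ s in a..t, g s) :
    ∫ s in a..b, (f s * G s + F s * g s) = F b * G b - F a * G a := by
  have sub : ∀ t ∈ uIcc a b, uIcc a t ⊆ uIcc a b := fun t ht =>
    uIcc_subset_uIcc left_mem_uIcc ht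
  have hFc := continuousOn_of_eq_integral hf hF
  have hGc := continuousOn_of_eq_integral hg hG
  have hi : IntervalIntegrable (fun s => f s * G s + F s * g s) volume a b :=
    (hf.mul_continuousOn hGc).add (hg.continuousOn_mul hFc)
  have re1 : ∀ t ∈ uIcc a b, (F t).re = (F a).re + ∫ s in a..t, (f s).re := fun t ht => by
    rw [hF t ht, Complex.add_re, intervalIntegral_re (hf.mono_set (sub t ht))]
  have im1 : ∀ t ∈ uIcc a b, (F t).im = (F a).im + ∫ s in a..t, (f s).im := fun t ht => by
    rw [hF t ht, Complex.add_im, intervalIntegral_im (hf.mono_set (sub t ht))]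
  have re2 : ∀ t ∈ uIcc a b, (G t).re = (G a).re + ∫ s in a..t, (g s).re := fun t ht => by
    rw [hG t ht, Complex.add_re, intervalIntegral_re (hg.mono_set (sub t ht))]
  have im2 : ∀ t ∈ uIcc a b, (G t).im = (G a).im + ∫ s in a..t, (g s).im := fun t ht => by
    rw [hG t ht, Complex.add_im, intervalIntegral_im (hg.mono_set (sub t ht))]
  have i1 := integral_mul_add_mul_real hf.re hg.re re1 re2
  have i2 := integral_mul_add_mul_real hf.im hg.im im1 im2
  have i3 := integral_mul_add_mul_real hf.re hg.im re1 im2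
  have i4 := integral_mul_add_mul_real hf.im hg.re im1 re2
  have cre : ∀ {H : ℝ → ℂ}, ContinuousOn H (uIcc a b) →
      ContinuousOn (fun s => (H s).re) (uIcc a b) :=
    fun h => Complex.continuous_re.comp_continuousOn h
  have cim : ∀ {H : ℝ → ℂ}, ContinuousOn H (uIcc a b) →
      ContinuousOn (fun s => (H s).im) (uIcc a b) :=
    fun h => Complex.continuous_im.comp_continuousOn h
  apply Complex.ext
  · rw [intervalIntegral_re hi, Complex.sub_re, Complex.mul_re, Complex.mul_re]
    have : (F b).re * (G b).re - (F b).im * (G b).im - ((F a).re * (G a).re - (F a).im * (G a).im)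
      = ((F b).re * (G b).re - (F a).re * (G a).re) -
        ((F b).im * (G b).im - (F a).im * (G a).im) := by ring
    rw [this, ← i1, ← i2, ← intervalIntegral.integral_sub]
    · congr 1; ext s; simp; ring
    · exact (hf.re.mul_continuousOn (cre hGc)).add (hg.re.continuousOn_mul (cre hFc))
    · exact (hf.im.mul_continuousOn (cim hGc)).add (hg.im.continuousOn_mul (cim hFc))
  · rw [intervalIntegral_im hi, Complex.sub_im, Complex.mul_im, Complex.mul_im]
    have : (F b).re * (G b).im + (F b).im * (G b).re - ((F a).re * (G a).im + (F a).im * (G a).re)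
      = ((F b).re * (G b).im - (F a).re * (G a).im) +
        ((F b).im * (G b).re - (F a).im * (G a).re) := by ring
    rw [this, ← i3, ← i4, ← intervalIntegral.integral_add]
    · congr 1; ext s; simp; ring
    · exact (hf.re.mul_continuousOn (cim hGc)).add (hg.im.continuousOn_mul (cre hFc))
    · exact (hf.im.mul_continuousOn (cre hGc)).add (hg.re.continuousOn_mul (cim hFc))

end

section

/-! ### Linear differential equations with integrable coefficients -/

section LinearODE

set_option linter.unusedSectionVars false

variable {E : Type*} [NormedAddCommGroup E] [NormedSpace ℂ E] [CompleteSpace E]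

theorem abs_integral_norm_le {A : ℝ → E →L[ℂ] E}
    (hA : ∀ a b, IntervalIntegrable A volume a b) {R t : ℝ} (ht : t ∈ Icc (-R) R) :
    |∫ s in (0 : ℝ)..t, ‖A s‖| ≤ ∫ s in (-R)..R, ‖A s‖ := by
  have hR : -R ≤ R := ht.1.trans ht.2
  rw [← abs_of_nonneg (intervalIntegral.integral_nonneg hR fun s _ => norm_nonneg (A s))]
  refine intervalIntegral.abs_integral_mono_interval ?_
    (Eventually.of_forall fun s => norm_nonneg _) (hA _ _).norm
  rw [uIoc_of_le hR]
  intro s hs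
  rcases le_total 0 t with h | h
  · rw [uIoc_of_le h] at hs
    exact ⟨by linarith [ht.1, hs.1, ht.2], hs.2.trans ht.2⟩
  · rw [uIoc_of_ge h] at hs
    exact ⟨by linarith [ht.1, hs.1], by linarith [ht.1, hs.2]⟩

theorem intervalIntegrable_clm_apply {A : ℝ → E →L[ℂ] E}
    (hA : ∀ a b, IntervalIntegrable A volume a b) {y : ℝ → E} (hy : Continuous y) (a b : ℝ) :
    IntervalIntegrable (fun s => A s (y s)) volume a b := by
  have h1 : IntervalIntegrable (fun s => ‖A s‖ * ‖y s‖) volume a b :=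
    (hA a b).norm.mul_continuousOn hy.norm.continuousOn
  have hm : ∀ c d : ℝ, AEStronglyMeasurable (fun s => A s (y s))
      (volume.restrict (Ioc c d)) := fun c d => by
    by_cases hcd : c ≤ d
    · have m1 : AEStronglyMeasurable A (volume.restrict (Ioc c d)) :=
        ((intervalIntegrable_iff_integrableOn_Ioc_of_le hcd).1 (hA c d)).aestronglyMeasurable
      exact (ContinuousLinearMap.id ℂ (E →L[ℂ] E)).aestronglyMeasurable_comp₂ m1
        hy.aestronglyMeasurable
    · simp [Ioc_eq_empty (fun h => hcd h.le)]
  refine h1.mono_fun (hm _ _) (Eventually.of_forall fun s => ?_)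
  simpa using (A s).le_opNorm (y s)

/-- The Volterra operator `x ↦ ∫₀ᵗ A x` on the continuous functions on `[-R, R]`. -/
def volterra (A : ℝ → E →L[ℂ] E) (hA : ∀ a b, IntervalIntegrable A volume a b) {R : ℝ}
    (hR : -R ≤ R) : C(Icc (-R) R, E) →L[ℂ] C(Icc (-R) R, E) :=
  LinearMap.mkContinuous
    { toFun := fun x => ⟨fun t => ∫ s in (0 : ℝ)..t, A s (IccExtend hR x s),
        (intervalIntegral.continuous_primitive (intervalIntegrable_clm_apply hA
          x.continuous.Icc_extend') 0).comp continuous_subtype_val⟩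
      map_add' := fun x y => by
        ext t
        simp only [ContinuousMap.coe_mk, ContinuousMap.add_apply]
        rw [← intervalIntegral.integral_add
          (intervalIntegrable_clm_apply hA x.continuous.Icc_extend' _ _)
          (intervalIntegrable_clm_apply hA y.continuous.Icc_extend' _ _)]
        congr 1; ext s; simp [IccExtend]
      map_smul' := fun c x => by
        ext t
        simp only [ContinuousMap.coe_mk, ContinuousMap.smul_apply, RingHom.id_apply]
        rw [← intervalIntegral.integral_smul]
        congr 1; ext s; simp [IccExtend] }
    (∫ s in (-R)..R, ‖A s‖) (by
      intro x
      have h0 : 0 ≤ ∫ s in (-R)..R, ‖A s‖ :=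
        intervalIntegral.integral_nonneg hR fun s _ => norm_nonneg _
      refine (ContinuousMap.norm_le _ (by positivity)).2 fun t => ?_
      simp only [LinearMap.coe_mk, AddHom.coe_mk, ContinuousMap.coe_mk]
      have hint : IntervalIntegrable (fun s => ‖A s‖ * ‖x‖) volume 0 t :=
        (hA _ _).norm.mul_const _
      calc ‖∫ s in (0 : ℝ)..t, A s (IccExtend hR x s)‖
          ≤ |∫ s in (0 : ℝ)..t, ‖A s‖ * ‖x‖| := by
            refine intervalIntegral.norm_integral_le_abs_of_norm_le ?_ hint
            exact Eventually.of_forall fun s => ((A s).le_opNorm _).trans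
              (mul_le_mul_of_nonneg_left (x.norm_coe_le_norm _) (norm_nonneg _))
        _ = |∫ s in (0 : ℝ)..t, ‖A s‖| * ‖x‖ := by
            rw [intervalIntegral.integral_mul_const, abs_mul, abs_of_nonneg (norm_nonneg x)]
        _ ≤ (∫ s in (-R)..R, ‖A s‖) * ‖x‖ := by
            refine mul_le_mul_of_nonneg_right ?_ (norm_nonneg _)
            exact abs_integral_norm_le hA t.2)

theorem volterra_apply (A : ℝ → E →L[ℂ] E) (hA : ∀ a b, IntervalIntegrable A volume a b) {R : ℝ}
    (hR : -R ≤ R) (x : C(Icc (-R) R, E)) (t : Icc (-R) R) :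
    volterra A hA hR x t = ∫ s in (0 : ℝ)..t, A s (IccExtend hR x s) := rfl

/-- With K the primitive of κ, the integrand is K' Kⁿ. The induction uses the product rule for
indefinite integrals because κ is only integrable. This is the source of the factorial in the bound
for iterated Volterra operators. -/
theorem integral_mul_primitive_pow {κ : ℝ → ℝ} (hκ : ∀ a b, IntervalIntegrable κ volume a b)
    (n : ℕ) (t : ℝ) :
    ∫ s in (0 : ℝ)..t, κ s * (∫ r in (0 : ℝ)..s, κ r) ^ n
      = (∫ r in (0 : ℝ)..t, κ r) ^ (n + 1) / (n + 1) := by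
  set K : ℝ → ℝ := fun s => ∫ r in (0 : ℝ)..s, κ r with hK
  have hKc : Continuous K := intervalIntegral.continuous_primitive hκ 0
  have hK0 : K 0 = 0 := by simp [hK]
  have key : ∀ n : ℕ, ∀ t, K t ^ (n + 1) = ∫ s in (0 : ℝ)..t, (n + 1) * (κ s * K s ^ n) := by
    intro n
    induction n with
    | zero => intro t; simp [hK]
    | succ n ih =>
      intro t
      have h1 : IntervalIntegrable (fun s => ((n : ℝ) + 1) * (κ s * K s ^ n)) volume 0 t :=
        ((hκ 0 t).mul_continuousOn (hKc.pow n).continuousOn).const_mul _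
      have := integral_mul_add_mul_real (F := fun s => K s ^ (n + 1)) (G := K) h1 (hκ 0 t)
        (fun s _ => by rw [ih s, hK0]; simp) (fun s _ => by simp [hK])
      rw [hK0] at this
      rw [pow_succ, ← sub_zero (K t ^ (n + 1) * K t)]
      rw [mul_zero] at this
      rw [← this]
      congr 1; ext s; push_cast; ring
  have := key n t
  rw [intervalIntegral.integral_const_mul] at this
  change _ = K t ^ (n + 1) / (n + 1)
  rw [this]
  field_simp
  rfl

theorem norm_volterra_pow_apply_le (A : ℝ → E →L[ℂ] E)
    (hA : ∀ a b, IntervalIntegrable A volume a b) {R : ℝ} (hR : -R ≤ R) (n : ℕ)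
    (x : C(Icc (-R) R, E)) (t : Icc (-R) R) :
    ‖((volterra A hA hR) ^ n) x t‖ ≤ |∫ s in (0 : ℝ)..t, ‖A s‖| ^ n / n.factorial * ‖x‖ := by
  induction n generalizing t with
  | zero => simpa using x.norm_coe_le_norm t
  | succ n ih =>
    rw [pow_succ']
    change ‖volterra A hA hR ((volterra A hA hR ^ n) x) t‖ ≤ _
    rw [volterra_apply]
    set K : ℝ → ℝ := fun s => ∫ r in (0 : ℝ)..s, ‖A r‖ with hK
    have hκ : ∀ a b, IntervalIntegrable (fun s => ‖A s‖) volume a b := fun a b => (hA a b).norm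
    have hKc : Continuous K := intervalIntegral.continuous_primitive hκ 0
    -- ε is the sign of t: it makes |K| a signed multiple of K, so that the integral of κ Kⁿ also
    -- serves for negative t.
    obtain ⟨ε, hε, hs⟩ : ∃ ε : ℝ, |ε| = 1 ∧ ∀ s ∈ uIcc 0 (t : ℝ), |K s| = ε * K s := by
      rcases le_total 0 (t : ℝ) with h | h
      · refine ⟨1, by simp, fun s hs => ?_⟩
        rw [uIcc_of_le h] at hs
        rw [one_mul, abs_of_nonneg (intervalIntegral.integral_nonneg hs.1 fun _ _ => norm_nonneg _)]
      · refine ⟨-1, by simp, fun s hs => ?_⟩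
        rw [uIcc_of_ge h] at hs
        rw [neg_one_mul, abs_of_nonpos]
        rw [hK]
        simp only
        rw [intervalIntegral.integral_symm, neg_nonpos]
        exact intervalIntegral.integral_nonneg hs.2 fun _ _ => norm_nonneg _
    have hint : IntervalIntegrable (fun s => ‖A s‖ * (|K s| ^ n / n.factorial * ‖x‖)) volume 0 t :=
      (hκ 0 t).mul_continuousOn (by fun_prop)
    calc ‖∫ s in (0 : ℝ)..t, A s (IccExtend hR (((volterra A hA hR) ^ n) x) s)‖
        ≤ |∫ s in (0 : ℝ)..t, ‖A s‖ * (|K s| ^ n / n.factorial * ‖x‖)| := by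
          refine intervalIntegral.norm_integral_le_abs_of_norm_le ?_ hint
          refine (ae_restrict_iff' measurableSet_uIoc).2 (Eventually.of_forall fun s hs' => ?_)
          refine ((A s).le_opNorm _).trans (mul_le_mul_of_nonneg_left ?_ (norm_nonneg _))
          have hsI : s ∈ Icc (-R) R := by
            have ht := t.2
            have h0 : (0 : ℝ) ∈ Icc (-R) R := ⟨by linarith, by linarith⟩
            exact (uIcc_subset_Icc h0 ht) (uIoc_subset_uIcc hs')
          rw [IccExtend_of_mem hR _ hsI]
          exact ih ⟨s, hsI⟩
      _ = |∫ s in (0 : ℝ)..t, (ε ^ n / n.factorial * ‖x‖) * (‖A s‖ * K s ^ n)| := by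
          congr 1
          refine intervalIntegral.integral_congr fun s hs' => ?_
          rw [hs s hs', mul_pow]; ring
      _ = |K t| ^ (n + 1) / (n + 1).factorial * ‖x‖ := by
          rw [intervalIntegral.integral_const_mul, integral_mul_primitive_pow hκ, abs_mul, abs_mul,
            abs_div, abs_div, abs_pow, abs_pow, hε, one_pow, abs_of_nonneg (norm_nonneg x),
            Nat.factorial_succ]
          have : |((n : ℝ) + 1)| = n + 1 := abs_of_nonneg (by positivity)
          rw [this, Nat.abs_cast]
          push_cast
          field_simp
          rfl

/-- The factorial bound gives some power with ‖Tⁿ‖ < 1, so 1 - Tⁿ is invertible. It is the product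
of 1 - T with a commuting geometric sum, and commuting factors of a unit are units. No smallness of
A is needed. -/
theorem isUnit_one_sub_volterra (A : ℝ → E →L[ℂ] E)
    (hA : ∀ a b, IntervalIntegrable A volume a b) {R : ℝ} (hR : -R ≤ R) :
    IsUnit (1 - volterra A hA hR) := by
  set T := volterra A hA hR
  set C : ℝ := ∫ s in (-R)..R, ‖A s‖ with hC
  have hC0 : 0 ≤ C := intervalIntegral.integral_nonneg hR fun s _ => norm_nonneg _
  have hle : ∀ t : Icc (-R) R, |∫ s in (0 : ℝ)..t, ‖A s‖| ≤ C := fun t =>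
    abs_integral_norm_le hA t.2
  obtain ⟨n, hn⟩ := ((FloorSemiring.tendsto_pow_div_factorial_atTop C).eventually
    (gt_mem_nhds (by norm_num : (0 : ℝ) < 1 / 2))).exists
  have hTn : ‖T ^ n‖ < 1 := by
    refine (ContinuousLinearMap.opNorm_le_bound _ (by positivity : 0 ≤ C ^ n / n.factorial)
      fun x => ?_).trans_lt (hn.trans (by norm_num))
    refine (ContinuousMap.norm_le _ (by positivity)).2 fun t => ?_
    refine (norm_volterra_pow_apply_le A hA hR n x t).trans ?_
    gcongr
    exact hle t
  have hu : IsUnit (1 - T ^ n) := by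
    exact isUnit_one_sub_of_norm_lt_one (x := T ^ n) hTn
  have e : (1 - T) * ∑ i ∈ Finset.range n, T ^ i = 1 - T ^ n := mul_neg_geom_sum T n
  have hc : Commute (1 - T) (∑ i ∈ Finset.range n, T ^ i) :=
    (Commute.sum_right _ _ _ fun i _ => ((Commute.one_left _).sub_left (Commute.self_pow T i)))
  rw [← e] at hu
  exact (hc.isUnit_mul_iff.1 hu).1

theorem one_sub_volterra_restrict_eq (A : ℝ → E →L[ℂ] E)
    (hA : ∀ a b, IntervalIntegrable A volume a b) {R : ℝ} (hR : -R ≤ R) {y : ℝ → E}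
    (hy : Continuous y) (x₀ : E)
    (h : ∀ t ∈ Icc (-R) R, y t = x₀ + ∫ s in (0 : ℝ)..t, A s (y s)) :
    (1 - volterra A hA hR) ⟨fun t : Icc (-R) R => y t, hy.comp continuous_subtype_val⟩
      = ContinuousMap.const _ x₀ := by
  ext t
  change y t - volterra A hA hR ⟨fun t : Icc (-R) R => y t, _⟩ t = x₀
  rw [volterra_apply, h t t.2, sub_eq_iff_eq_add, add_right_inj]
  refine intervalIntegral.integral_congr fun s hs => ?_
  have h0 : (0 : ℝ) ∈ Icc (-R) R := ⟨by linarith, by linarith⟩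
  rw [IccExtend_of_mem hR _ (uIcc_subset_Icc h0 t.2 hs)]
  rfl

theorem linearODE_eqOn (A : ℝ → E →L[ℂ] E)
    (hA : ∀ a b, IntervalIntegrable A volume a b) {R : ℝ} {y₁ y₂ : ℝ → E}
    (hy₁ : Continuous y₁) (hy₂ : Continuous y₂) (x₀ : E)
    (h₁ : ∀ t ∈ Icc (-R) R, y₁ t = x₀ + ∫ s in (0 : ℝ)..t, A s (y₁ s))
    (h₂ : ∀ t ∈ Icc (-R) R, y₂ t = x₀ + ∫ s in (0 : ℝ)..t, A s (y₂ s)) :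
    EqOn y₁ y₂ (Icc (-R) R) := by
  intro t ht
  have hR : -R ≤ R := ht.1.trans ht.2
  have e := (one_sub_volterra_restrict_eq A hA hR hy₁ x₀ h₁).trans
    (one_sub_volterra_restrict_eq A hA hR hy₂ x₀ h₂).symm
  obtain ⟨u, hu⟩ := isUnit_one_sub_volterra A hA hR
  rw [← hu] at e
  have := congrArg (fun x => (↑u⁻¹ : C(Icc (-R) R, E) →L[ℂ] C(Icc (-R) R, E)) x) e
  have inv : ∀ x, (↑u⁻¹ : C(Icc (-R) R, E) →L[ℂ] C(Icc (-R) R, E)) ((↑u : _ →L[ℂ] _) x) = x :=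
    fun x => congrArg (fun S : C(Icc (-R) R, E) →L[ℂ] C(Icc (-R) R, E) => S x) u.inv_mul
  simp only [inv] at this
  exact congrArg (fun x : C(Icc (-R) R, E) => x ⟨t, ht⟩) this

theorem linearODE_unique (A : ℝ → E →L[ℂ] E)
    (hA : ∀ a b, IntervalIntegrable A volume a b) {y₁ y₂ : ℝ → E}
    (hy₁ : Continuous y₁) (hy₂ : Continuous y₂) (x₀ : E)
    (h₁ : ∀ t, y₁ t = x₀ + ∫ s in (0 : ℝ)..t, A s (y₁ s))
    (h₂ : ∀ t, y₂ t = x₀ + ∫ s in (0 : ℝ)..t, A s (y₂ s)) : y₁ = y₂ :=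
  funext fun t => linearODE_eqOn A hA (R := |t|) hy₁ hy₂ x₀ (fun t _ => h₁ t) (fun t _ => h₂ t)
    ⟨neg_abs_le t, le_abs_self t⟩

theorem exists_linearODE_on (A : ℝ → E →L[ℂ] E)
    (hA : ∀ a b, IntervalIntegrable A volume a b) {R : ℝ} (hR : -R ≤ R) (x₀ : E) :
    ∃ y : ℝ → E, Continuous y ∧
      ∀ t ∈ Icc (-R) R, y t = x₀ + ∫ s in (0 : ℝ)..t, A s (y s) := by
  obtain ⟨u, hu⟩ := isUnit_one_sub_volterra A hA hR
  set x : C(Icc (-R) R, E) := (↑u⁻¹ : C(Icc (-R) R, E) →L[ℂ] C(Icc (-R) R, E))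
    (ContinuousMap.const _ x₀) with hx
  have e : (1 - volterra A hA hR) x = ContinuousMap.const _ x₀ := by
    rw [← hu]
    exact congrArg (fun S : C(Icc (-R) R, E) →L[ℂ] C(Icc (-R) R, E) =>
      S (ContinuousMap.const _ x₀)) u.mul_inv
  refine ⟨IccExtend hR x, x.continuous.Icc_extend', fun t ht => ?_⟩
  have := congrArg (fun x : C(Icc (-R) R, E) => x ⟨t, ht⟩) e
  change x ⟨t, ht⟩ - volterra A hA hR x ⟨t, ht⟩ = x₀ at this
  rw [volterra_apply] at this
  rw [IccExtend_of_mem hR _ ht]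
  exact sub_eq_iff_eq_add.1 this

theorem exists_linearODE (A : ℝ → E →L[ℂ] E)
    (hA : ∀ a b, IntervalIntegrable A volume a b) (x₀ : E) :
    ∃ y : ℝ → E, Continuous y ∧ ∀ t, y t = x₀ + ∫ s in (0 : ℝ)..t, A s (y s) := by
  have hR : ∀ t : ℝ, -(|t| + 1) ≤ |t| + 1 := fun t => by linarith [abs_nonneg t]
  choose Y hYc hY using fun t : ℝ => exists_linearODE_on A hA (hR t) x₀
  -- By uniqueness two of the local solutions agree on the smaller of their intervals. The extra 1
  -- in the radius makes t an interior point, whence the diagonal s ↦ Y s s is continuous at t.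
  have hcons : ∀ t s : ℝ, |t| ≤ |s| + 1 → Y t t = Y s t := fun t s hts => by
    rcases le_total (|t| + 1) (|s| + 1) with h | h
    · exact linearODE_eqOn A hA (R := |t| + 1) (hYc t) (hYc s) x₀ (hY t)
        (fun r hr => hY s r ⟨by linarith [hr.1], by linarith [hr.2]⟩)
        ⟨by linarith [neg_abs_le t], by linarith [le_abs_self t]⟩
    · exact linearODE_eqOn A hA (R := |s| + 1) (hYc t) (hYc s) x₀
        (fun r hr => hY t r ⟨by linarith [hr.1], by linarith [hr.2]⟩) (hY s)
        ⟨by linarith [neg_abs_le t], by linarith [le_abs_self t]⟩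
  refine ⟨fun t => Y t t, continuous_iff_continuousAt.2 fun t => ?_, fun t => ?_⟩
  · refine (hYc t).continuousAt.congr ?_
    have : ∀ᶠ s in 𝓝 t, |s| < |t| + 1 :=
      (continuous_abs.tendsto t).eventually (gt_mem_nhds (by linarith))
    filter_upwards [this] with s hs using (hcons s t hs.le).symm
  · beta_reduce
    rw [hY t t ⟨by linarith [neg_abs_le t], by linarith [le_abs_self t]⟩]
    congr 1
    refine intervalIntegral.integral_congr fun s hs => ?_
    rw [hcons s t]
    have h1 : s ∈ Icc (-|t|) |t| := uIcc_subset_Icc ⟨by simp, by simp⟩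
      ⟨neg_abs_le t, le_abs_self t⟩ hs
    linarith [abs_le.2 h1]

theorem differentiableAt_inverse_one_sub {𝔸 : Type*} [NormedRing 𝔸] [NormedAlgebra ℂ 𝔸]
    [HasSummableGeomSeries 𝔸] {a b : 𝔸} {c : ℂ} (h : IsUnit (1 - (a + c • b))) :
    DifferentiableAt ℂ (fun c : ℂ => Ring.inverse (1 - (a + c • b))) c := by
  have h1 : DifferentiableAt ℂ (fun c : ℂ => 1 - (a + c • b)) c := by fun_prop
  exact DifferentiableAt.comp (g := Ring.inverse) c (differentiableAt_inverse (𝕜 := ℂ) h) h1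

/-- Solutions depend analytically on a linear parameter. -/
theorem linearODE_differentiable {A B : ℝ → E →L[ℂ] E}
    (hA : ∀ a b, IntervalIntegrable A volume a b) (hB : ∀ a b, IntervalIntegrable B volume a b)
    (x₀ : E) {Y : ℂ → ℝ → E} (hYc : ∀ c, Continuous (Y c))
    (hY : ∀ c t, Y c t = x₀ + ∫ s in (0 : ℝ)..t, (A s + c • B s) (Y c s)) (t : ℝ) :
    Differentiable ℂ fun c => Y c t := by
  have hR : -|t| ≤ |t| := by linarith [abs_nonneg t]
  have hAB : ∀ (c : ℂ) a b, IntervalIntegrable (fun s => A s + c • B s) volume a b :=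
    fun c a b => (hA a b).add ((hB a b).smul c)
  -- The Volterra operator is affine in c, so the solution, (1 - T)⁻¹ applied to a constant, is
  -- holomorphic wherever 1 - T is invertible, that is, for all c.
  have hT : ∀ c : ℂ, volterra (fun s => A s + c • B s) (hAB c) hR
      = volterra A hA hR + c • volterra B hB hR := fun c => by
    ext x r
    change ∫ s in (0 : ℝ)..r, (A s (IccExtend hR x s) + c • B s (IccExtend hR x s))
      = (∫ s in (0 : ℝ)..r, A s (IccExtend hR x s)) + c • ∫ s in (0 : ℝ)..r, B s (IccExtend hR x s)
    have hB' : IntervalIntegrable (fun s => c • B s (IccExtend hR x s)) volume 0 r :=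
      (intervalIntegrable_clm_apply hB x.continuous.Icc_extend' _ _).smul c
    rw [intervalIntegral.integral_add
      (intervalIntegrable_clm_apply hA x.continuous.Icc_extend' _ _) hB',
      intervalIntegral.integral_smul]
  have hu : ∀ c : ℂ, IsUnit (1 - (volterra A hA hR + c • volterra B hB hR)) := fun c => by
    rw [← hT c]; exact isUnit_one_sub_volterra _ _ _
  have hsol : ∀ c : ℂ, Y c t = (Ring.inverse (1 - (volterra A hA hR + c • volterra B hB hR)))
      (ContinuousMap.const _ x₀) ⟨t, neg_abs_le t, le_abs_self t⟩ := fun c => by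
    have e := one_sub_volterra_restrict_eq (fun s => A s + c • B s) (hAB c) hR (hYc c) x₀
      (fun r _ => hY c r)
    rw [hT c] at e
    rw [← e]
    exact (congrArg (fun S : C(Icc (-|t|) |t|, E) →L[ℂ] C(Icc (-|t|) |t|, E) =>
      S ⟨fun r : Icc (-|t|) |t| => Y c r, (hYc c).comp continuous_subtype_val⟩
        ⟨t, neg_abs_le t, le_abs_self t⟩) (Ring.inverse_mul_cancel _ (hu c))).symm
  have hd : Differentiable ℂ fun c : ℂ =>
      Ring.inverse (1 - (volterra A hA hR + c • volterra B hB hR)) := fun c => by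
    exact differentiableAt_inverse_one_sub (𝔸 := C(Icc (-|t|) |t|, E) →L[ℂ] C(Icc (-|t|) |t|, E))
      (hu c)
  have hev : Differentiable ℂ fun c : ℂ =>
      (Ring.inverse (1 - (volterra A hA hR + c • volterra B hB hR))) (ContinuousMap.const _ x₀) :=
    fun c => (hd c).clm_apply (differentiableAt_const _)
  have : (fun c => Y c t) = fun c => (ContinuousMap.evalCLM ℂ
      (⟨t, neg_abs_le t, le_abs_self t⟩ : Icc (-|t|) |t|))
      ((Ring.inverse (1 - (volterra A hA hR + c • volterra B hB hR)))
        (ContinuousMap.const _ x₀)) := funext hsol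
  rw [this]
  exact (ContinuousLinearMap.differentiable _).comp hev

end LinearODE

end

section

/-! ### Solutions of the Schrödinger equation -/

theorem IsPotential.intervalIntegrable (hV : IsPotential V) (a b : Fin N) (c d : ℝ) :
    IntervalIntegrable (fun t => (V t a b : ℂ)) volume c d := by
  have h1 : IntervalIntegrable (fun t => V t a b) volume 0 (0 + 1) := by
    rw [zero_add, intervalIntegrable_iff_integrableOn_Ioc_of_le zero_le_one]
    exact (hV.memLp a b).integrable (by norm_num)
  have hp : Function.Periodic (fun t => V t a b) 1 := fun t => by simp [hV.periodic t]
  have h2 := hp.intervalIntegrable (by norm_num) h1 c d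
  exact ⟨h2.1.ofReal, h2.2.ofReal⟩

/-- `-u'' + V u = h`, with `u''` understood in the integrated sense. -/
structure IsSolution (V : ℝ → Matrix (Fin N) (Fin N) ℝ) (h u u' : ℝ → Fin N → ℂ) : Prop where
  deriv : ∀ a t, HasDerivAt (fun s => u s a) (u' t a) t
  integral : ∀ a t, u' t a = u' 0 a + ∫ s in (0 : ℝ)..t, ((∑ c, (V s a c : ℂ) * u s c) - h s a)

namespace IsSolution

variable {h u u' k w w' : ℝ → Fin N → ℂ}

theorem continuous (hu : IsSolution V h u u') (a : Fin N) : Continuous fun s => u s a :=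
  continuous_iff_continuousAt.2 fun t => (hu.deriv a t).continuousAt

theorem integrand (hV : IsPotential V) (hu : IsSolution V h u u')
    (hh : ∀ a c d, IntervalIntegrable (fun s => h s a) volume c d) (a : Fin N) (c d : ℝ) :
    IntervalIntegrable (fun s => (∑ c, (V s a c : ℂ) * u s c) - h s a) volume c d := by
  refine IntervalIntegrable.sub ?_ (hh a c d)
  have := IntervalIntegrable.sum Finset.univ fun b _ =>
    (hV.intervalIntegrable a b c d).mul_continuousOn (hu.continuous b).continuousOn
  rwa [show (fun s => ∑ c, (V s a c : ℂ) * u s c) = ∑ c, fun s => (V s a c : ℂ) * u s c from by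
    ext s; simp]

theorem integral_from (hV : IsPotential V) (hu : IsSolution V h u u')
    (hh : ∀ a c d, IntervalIntegrable (fun s => h s a) volume c d) (a : Fin N) (c t : ℝ) :
    u' t a = u' c a + ∫ s in c..t, ((∑ c, (V s a c : ℂ) * u s c) - h s a) := by
  have := intervalIntegral.integral_add_adjacent_intervals (hu.integrand hV hh a 0 c)
    (hu.integrand hV hh a c t)
  rw [hu.integral a t, hu.integral a c, ← this]; ring

theorem continuous' (hV : IsPotential V) (hu : IsSolution V h u u')
    (hh : ∀ a c d, IntervalIntegrable (fun s => h s a) volume c d) (a : Fin N) :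
    Continuous fun s => u' s a := by
  rw [show (fun s => u' s a) = _ from funext (hu.integral a)]
  exact continuous_const.add
    (intervalIntegral.continuous_primitive (hu.integrand hV hh a) 0)

theorem integral_deriv (hV : IsPotential V) (hu : IsSolution V h u u')
    (hh : ∀ a c d, IntervalIntegrable (fun s => h s a) volume c d) (a : Fin N) (c t : ℝ) :
    u t a = u c a + ∫ s in c..t, u' s a := by
  rw [intervalIntegral.integral_eq_sub_of_hasDerivAt (fun s _ => hu.deriv a s)
    ((hu.continuous' hV hh a).intervalIntegrable _ _)]
  ring

/-- Lagrange's identity. -/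
theorem lagrange (hV : IsPotential V) (hu : IsSolution V h u u') (hw : IsSolution V k w w')
    (hh : ∀ a c d, IntervalIntegrable (fun s => h s a) volume c d)
    (hk : ∀ a c d, IntervalIntegrable (fun s => k s a) volume c d) (c d : ℝ) :
    (∑ a, (u' d a * w d a - u d a * w' d a)) - (∑ a, (u' c a * w c a - u c a * w' c a))
      = ∫ s in c..d, ∑ a, (u s a * k s a - h s a * w s a) := by
  have e1 : ∀ a, ∫ s in c..d, (((∑ c, (V s a c : ℂ) * u s c) - h s a) * w s a + u' s a * w' s a)
      = u' d a * w d a - u' c a * w c a := fun a =>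
    integral_mul_add_mul (hu.integrand hV hh a c d)
      ((hw.continuous' hV hk a).intervalIntegrable _ _)
      (fun t _ => hu.integral_from hV hh a c t) (fun t _ => hw.integral_deriv hV hk a c t)
  have e2 : ∀ a, ∫ s in c..d, (u' s a * w' s a + u s a * ((∑ c, (V s a c : ℂ) * w s c) - k s a))
      = u d a * w' d a - u c a * w' c a := fun a =>
    integral_mul_add_mul ((hu.continuous' hV hh a).intervalIntegrable _ _)
      (hw.integrand hV hk a c d)
      (fun t _ => hu.integral_deriv hV hh a c t) (fun t _ => hw.integral_from hV hk a c t)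
  have i1 : ∀ a, IntervalIntegrable (fun s => ((∑ c, (V s a c : ℂ) * u s c) - h s a) * w s a
      + u' s a * w' s a) volume c d := fun a =>
    ((hu.integrand hV hh a c d).mul_continuousOn (hw.continuous a).continuousOn).add
      (((hu.continuous' hV hh a).mul (hw.continuous' hV hk a)).intervalIntegrable _ _)
  have i2 : ∀ a, IntervalIntegrable (fun s => u' s a * w' s a +
      u s a * ((∑ c, (V s a c : ℂ) * w s c) - k s a)) volume c d := fun a =>
    (((hu.continuous' hV hh a).mul (hw.continuous' hV hk a)).intervalIntegrable _ _).add
      ((hw.integrand hV hk a c d).continuousOn_mul (hu.continuous a).continuousOn)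
  have : (∑ a, (u' d a * w d a - u d a * w' d a)) - (∑ a, (u' c a * w c a - u c a * w' c a))
      = ∑ a, ((u' d a * w d a - u' c a * w c a) - (u d a * w' d a - u c a * w' c a)) := by
    rw [← Finset.sum_sub_distrib]
    exact Finset.sum_congr rfl fun a _ => by ring
  rw [this]
  simp_rw [← e1, ← e2]
  simp_rw [← fun a => intervalIntegral.integral_sub (i1 a) (i2 a)]
  rw [← intervalIntegral.integral_finsetSum fun a _ => (i1 a).sub (i2 a)]
  refine intervalIntegral.integral_congr fun s _ => ?_
  -- Symmetry of V makes the potential terms of the two solutions cancel.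
  have sw : ∑ a, (∑ b, (V s a b : ℂ) * u s b) * w s a
      = ∑ a, u s a * ∑ b, (V s a b : ℂ) * w s b := by
    simp_rw [Finset.sum_mul, Finset.mul_sum]
    rw [Finset.sum_comm]
    refine Finset.sum_congr rfl fun a _ => Finset.sum_congr rfl fun b _ => ?_
    rw [(hV.symm s).apply a b]; ring
  have : ∀ a, ((∑ b, (V s a b : ℂ) * u s b) - h s a) * w s a + u' s a * w' s a -
      (u' s a * w' s a + u s a * ((∑ b, (V s a b : ℂ) * w s b) - k s a))
      = (∑ b, (V s a b : ℂ) * u s b) * w s a - u s a * (∑ b, (V s a b : ℂ) * w s b)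
        + (u s a * k s a - h s a * w s a) := fun a => by ring
  simp_rw [this, Finset.sum_add_distrib, Finset.sum_sub_distrib, sw]
  ring

end IsSolution

/-- Homogeneous solutions of `-u'' + V u = μ u`. -/
abbrev IsEigen (V : ℝ → Matrix (Fin N) (Fin N) ℝ) (μ : ℂ) (u u' : ℝ → Fin N → ℂ) : Prop :=
  IsSolution V (fun s => μ • u s) u u'

theorem IsEigen.rhs {μ : ℂ} {u u' : ℝ → Fin N → ℂ} (hu : IsEigen V μ u u') (a : Fin N) (c d : ℝ) :
    IntervalIntegrable (fun s => (μ • u s) a) volume c d :=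
  ((hu.continuous a).const_smul μ).intervalIntegrable _ _

/-! #### The first order system -/

/-- The elementary endomorphism with a single nonzero entry. -/
def elemOp {ι : Type*} [Fintype ι] [DecidableEq ι] (i j : ι) : (ι → ℂ) →L[ℂ] (ι → ℂ) :=
  (ContinuousLinearMap.proj (R := ℂ) (φ := fun _ : ι => ℂ) j).smulRight
    (Pi.single i (1 : ℂ) : ι → ℂ)

theorem elemOp_apply {ι : Type*} [Fintype ι] [DecidableEq ι] (i j k : ι) (y : ι → ℂ) :
    elemOp i j y k = if k = i then y j else 0 := by
  simp [elemOp, Pi.single_apply]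

/-- The coefficient of the first order system of `-u'' + V u = 0`. -/
def systemOp (V : ℝ → Matrix (Fin N) (Fin N) ℝ) (s : ℝ) :
    (Fin N ⊕ Fin N → ℂ) →L[ℂ] (Fin N ⊕ Fin N → ℂ) :=
  (∑ a : Fin N, elemOp (Sum.inl a) (Sum.inr a)) +
    ∑ a : Fin N, ∑ c : Fin N, (V s a c : ℂ) • elemOp (Sum.inr a) (Sum.inl c)

/-- The coefficient of the spectral parameter in the first order system. -/
def spectralOp (N : ℕ) : (Fin N ⊕ Fin N → ℂ) →L[ℂ] (Fin N ⊕ Fin N → ℂ) :=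
  -∑ a : Fin N, elemOp (Sum.inr a) (Sum.inl a)

theorem systemOp_inl (s : ℝ) (μ : ℂ) (y : Fin N ⊕ Fin N → ℂ) (a : Fin N) :
    (systemOp V s + μ • spectralOp N) y (Sum.inl a) = y (Sum.inr a) := by
  simp [systemOp, spectralOp, elemOp_apply]

theorem systemOp_inr (s : ℝ) (μ : ℂ) (y : Fin N ⊕ Fin N → ℂ) (a : Fin N) :
    (systemOp V s + μ • spectralOp N) y (Sum.inr a)
      = (∑ c, (V s a c : ℂ) * y (Sum.inl c)) - μ * y (Sum.inl a) := by
  simp [systemOp, spectralOp, elemOp_apply, sub_eq_add_neg]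

theorem integrable_const_add_sum_smul {ι G : Type*} [Fintype ι] [NormedAddCommGroup G]
    [NormedSpace ℂ G] {μ : Measure ℝ} [IsFiniteMeasure μ] (g : G) (e : ι → ι → G)
    {f : ι → ι → ℝ → ℂ} (hf : ∀ a b, Integrable (f a b) μ) :
    Integrable (fun s => g + ∑ a, ∑ b, f a b s • e a b) μ :=
  (integrable_const g).add (integrable_finsetSum _ fun a _ => integrable_finsetSum _ fun b _ =>
    (hf a b).smul_const _)

theorem systemOp_intervalIntegrable (hV : IsPotential V) (c d : ℝ) :
    IntervalIntegrable (systemOp V) volume c d := by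
  have h : ∀ c d, IntegrableOn (systemOp V) (Ioc c d) volume := fun c d =>
    integrable_const_add_sum_smul _ _ fun a b => (hV.intervalIntegrable a b c d).1
  exact ⟨h c d, h d c⟩

theorem systemOp_add_intervalIntegrable (hV : IsPotential V) (μ : ℂ) (c d : ℝ) :
    IntervalIntegrable (fun s => systemOp V s + μ • spectralOp N) volume c d :=
  (systemOp_intervalIntegrable hV c d).add intervalIntegrable_const

theorem intervalIntegral_apply {ι : Type*} [Fintype ι] {F : ℝ → ι → ℂ} {c d : ℝ}
    (hF : IntervalIntegrable F volume c d) (i : ι) :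
    (∫ s in c..d, F s) i = ∫ s in c..d, F s i :=
  ((ContinuousLinearMap.proj (R := ℂ) (φ := fun _ : ι => ℂ) i).intervalIntegral_comp_comm hF).symm

theorem intervalIntegrable_pi {ι : Type*} [Fintype ι] {F : ℝ → ι → ℂ} {c d : ℝ}
    (hF : ∀ i, IntervalIntegrable (fun s => F s i) volume c d) :
    IntervalIntegrable F volume c d :=
  ⟨Integrable.of_eval fun i => (hF i).1, Integrable.of_eval fun i => (hF i).2⟩

theorem IsEigen.system (hV : IsPotential V) {μ : ℂ} {u u' : ℝ → Fin N → ℂ}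
    (hu : IsEigen V μ u u') :
    Continuous (fun t => (Sum.elim (u t) (u' t) : Fin N ⊕ Fin N → ℂ)) ∧
    ∀ t, (Sum.elim (u t) (u' t) : Fin N ⊕ Fin N → ℂ) = Sum.elim (u 0) (u' 0) +
      ∫ s in (0 : ℝ)..t, (systemOp V s + μ • spectralOp N) (Sum.elim (u s) (u' s)) := by
  have hc : Continuous (fun t => (Sum.elim (u t) (u' t) : Fin N ⊕ Fin N → ℂ)) := by
    refine continuous_pi fun i => ?_
    rcases i with a | a
    · exact hu.continuous a
    · exact hu.continuous' hV hu.rhs a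
  refine ⟨hc, fun t => ?_⟩
  ext i
  rw [Pi.add_apply, intervalIntegral_apply
    (intervalIntegrable_clm_apply (systemOp_add_intervalIntegrable hV μ) hc _ _)]
  rcases i with a | a
  · simp only [systemOp_inl, Sum.elim_inl, Sum.elim_inr]
    exact hu.integral_deriv hV hu.rhs a 0 t
  · simp only [systemOp_inr, Sum.elim_inl, Sum.elim_inr]
    exact hu.integral a t

theorem isEigen_of_system (hV : IsPotential V) {μ : ℂ} {y : ℝ → Fin N ⊕ Fin N → ℂ}
    (hc : Continuous y) {x₀ : Fin N ⊕ Fin N → ℂ}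
    (hy : ∀ t, y t = x₀ + ∫ s in (0 : ℝ)..t, (systemOp V s + μ • spectralOp N) (y s)) :
    IsEigen V μ (fun t a => y t (Sum.inl a)) (fun t a => y t (Sum.inr a)) := by
  have h0 : y 0 = x₀ := by rw [hy 0]; simp
  have hi := intervalIntegrable_clm_apply (systemOp_add_intervalIntegrable hV μ) hc
  have hl : ∀ a t, y t (Sum.inl a) = x₀ (Sum.inl a) + ∫ s in (0 : ℝ)..t, y s (Sum.inr a) :=
    fun a t => by
      have := congrFun (hy t) (Sum.inl a)
      rw [Pi.add_apply, intervalIntegral_apply (hi _ _)] at this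
      simpa only [systemOp_inl] using this
  refine ⟨fun a t => ?_, fun a t => ?_⟩
  · rw [show (fun s => y s (Sum.inl a)) = _ from funext (hl a)]
    have hc' : Continuous fun s => y s (Sum.inr a) := (continuous_apply _).comp hc
    exact (intervalIntegral.integral_hasDerivAt_right (hc'.intervalIntegrable _ _)
      (hc'.stronglyMeasurableAtFilter _ _) hc'.continuousAt).const_add _
  · have := congrFun (hy t) (Sum.inr a)
    rw [Pi.add_apply, intervalIntegral_apply (hi _ _)] at this
    simp only [systemOp_inr] at this
    rw [h0]
    exact this

theorem IsEigen.unique (hV : IsPotential V) {μ : ℂ} {u u' w w' : ℝ → Fin N → ℂ}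
    (hu : IsEigen V μ u u') (hw : IsEigen V μ w w') (h0 : u 0 = w 0) (h1 : u' 0 = w' 0) :
    u = w ∧ u' = w' := by
  obtain ⟨c1, e1⟩ := hu.system hV
  obtain ⟨c2, e2⟩ := hw.system hV
  rw [← h0, ← h1] at e2
  have := linearODE_unique _ (systemOp_add_intervalIntegrable hV μ) c1 c2 _ e1 e2
  constructor <;> ext t a
  · exact congrFun (congrFun this t) (Sum.inl a)
  · exact congrFun (congrFun this t) (Sum.inr a)

/-! #### The fundamental matrix -/

theorem IsFundamental.column {z : ℂ} {X : ℝ → Matrix (Fin N ⊕ Fin N) (Fin N ⊕ Fin N) ℂ}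
    (hX : IsFundamental V z X) (b : Fin N ⊕ Fin N) :
    IsEigen V (z ^ 2) (fun t a => X t (Sum.inl a) b) (fun t a => X t (Sum.inr a) b) :=
  ⟨fun a t => hX.deriv_top a b t, fun a t => hX.integral_bottom a b t⟩

theorem exists_isFundamental (hV : IsPotential V) (z : ℂ) : ∃ X, IsFundamental V z X := by
  choose y hc hy using fun b : Fin N ⊕ Fin N =>
    exists_linearODE _ (systemOp_add_intervalIntegrable hV (z ^ 2))
      (Pi.single b 1 : Fin N ⊕ Fin N → ℂ)
  have hs := fun b => isEigen_of_system hV (hc b) (hy b)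
  refine ⟨fun t => Matrix.of fun i b => y b t i, ?_, fun a b t => (hs b).deriv a t,
    fun a b t => (hs b).integral a t⟩
  ext i b
  have : y b 0 = Pi.single b 1 := by rw [hy b 0]; simp
  simp [this, Matrix.one_apply, Pi.single_apply]

theorem isFundamental_fundamental (hV : IsPotential V) (z : ℂ) :
    IsFundamental V z (fundamental V z) :=
  Classical.epsilon_spec (exists_isFundamental hV z)

/-- The linear combinations of the columns of the fundamental matrix are solutions. -/
theorem isEigen_mulVec (hV : IsPotential V) (z : ℂ) (x : Fin N ⊕ Fin N → ℂ) :
    IsEigen V (z ^ 2) (fun t a => (fundamental V z t).mulVec x (Sum.inl a))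
      (fun t a => (fundamental V z t).mulVec x (Sum.inr a)) := by
  have hX := isFundamental_fundamental hV z
  refine ⟨fun a t => ?_, fun a t => ?_⟩
  · simp only [Matrix.mulVec, dotProduct]
    exact HasDerivAt.fun_sum fun b _ => (hX.deriv_top a b t).mul_const _
  · simp only [Matrix.mulVec, dotProduct, Pi.smul_apply, smul_eq_mul]
    have hi : ∀ b, IntervalIntegrable (fun s => ((∑ c, (V s a c : ℂ) *
        fundamental V z s (Sum.inl c) b) - z ^ 2 * fundamental V z s (Sum.inl a) b))
        volume 0 t := fun b => (hX.column b).integrand hV (hX.column b).rhs a 0 t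
    simp_rw [fun b => hX.integral_bottom a b t, add_mul, Finset.sum_add_distrib]
    simp_rw [← intervalIntegral.integral_mul_const]
    rw [add_right_inj, ← intervalIntegral.integral_finsetSum fun b _ => (hi b).mul_const _]
    refine intervalIntegral.integral_congr fun s _ => ?_
    simp only [sub_mul, Finset.sum_sub_distrib, Finset.mul_sum, Finset.sum_mul]
    rw [Finset.sum_comm]
    simp only [mul_assoc]

theorem mulVec_fundamental_zero (hV : IsPotential V) (z : ℂ) (x : Fin N ⊕ Fin N → ℂ) :
    (fundamental V z 0).mulVec x = x := by
  rw [(isFundamental_fundamental hV z).initial, Matrix.one_mulVec]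

theorem IsEigen.eq_mulVec (hV : IsPotential V) {z : ℂ} {u u' : ℝ → Fin N → ℂ}
    (hu : IsEigen V (z ^ 2) u u') (t : ℝ) :
    Sum.elim (u t) (u' t) = (fundamental V z t).mulVec (Sum.elim (u 0) (u' 0)) := by
  have h := isEigen_mulVec hV z (Sum.elim (u 0) (u' 0))
  obtain ⟨e1, e2⟩ := hu.unique hV h
    (by ext a; simp [mulVec_fundamental_zero hV]) (by ext a; simp [mulVec_fundamental_zero hV])
  ext i
  rcases i with a | a
  · exact congrFun (congrFun e1 t) a
  · exact congrFun (congrFun e2 t) a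

theorem IsEigen.shift (hV : IsPotential V) {μ : ℂ} {u u' : ℝ → Fin N → ℂ}
    (hu : IsEigen V μ u u') : IsEigen V μ (fun t => u (t + 1)) (fun t => u' (t + 1)) := by
  refine ⟨fun a t => ?_, fun a t => ?_⟩
  · exact (hu.deriv a (t + 1)).comp_add_const t 1
  · have := hu.integral_from hV hu.rhs a (0 + 1) (t + 1)
    rw [← intervalIntegral.integral_comp_add_right] at this
    simpa only [hV.periodic] using this

/-- A Bloch solution. -/
theorem IsEigen.bloch (hV : IsPotential V) {μ τ : ℂ} {u u' : ℝ → Fin N → ℂ}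
    (hu : IsEigen V μ u u') (h0 : u 1 = τ • u 0) (h1 : u' 1 = τ • u' 0) (t : ℝ) :
    u (t + 1) = τ • u t ∧ u' (t + 1) = τ • u' t := by
  have hs : IsEigen V μ (fun t => τ • u t) (fun t => τ • u' t) := by
    refine ⟨fun a t => (hu.deriv a t).const_smul τ, fun a t => ?_⟩
    have := congrArg (fun x => τ * x) (hu.integral a t)
    simp only [mul_add, ← intervalIntegral.integral_const_mul] at this
    simp only [Pi.smul_apply, smul_eq_mul] at this ⊢
    rw [this]
    congr 2; ext s
    rw [mul_sub, Finset.mul_sum]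
    congr 1
    · exact Finset.sum_congr rfl fun c _ => by ring
    · ring
  obtain ⟨e1, e2⟩ := (hu.shift hV).unique hV hs (by simpa using h0) (by simpa using h1)
  exact ⟨congrFun e1 t, congrFun e2 t⟩

theorem IsEigen.conj {μ : ℂ} {u u' : ℝ → Fin N → ℂ} (hu : IsEigen V μ u u') :
    IsEigen V (starRingEnd ℂ μ) (fun t a => starRingEnd ℂ (u t a))
      (fun t a => starRingEnd ℂ (u' t a)) := by
  refine ⟨fun a t => ?_, fun a t => ?_⟩
  · exact (Complex.conjCLE.toContinuousLinearMap.hasFDerivAt.comp_hasDerivAt t (hu.deriv a t))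
  · rw [hu.integral a t, map_add, ← intervalIntegral.intervalIntegral_conj]
    congr 2; ext s
    simp

theorem fundamental_conj (hV : IsPotential V) (z : ℂ) (t : ℝ) :
    fundamental V (starRingEnd ℂ z) t = (fundamental V z t).map (starRingEnd ℂ) := by
  have hX := isFundamental_fundamental hV z
  have hY := isFundamental_fundamental hV (starRingEnd ℂ z)
  have key : ∀ b, _ := fun b => (hY.column b).unique hV
    (show IsEigen V (starRingEnd ℂ z ^ 2) _ _ from by
      rw [← map_pow]; exact (hX.column b).conj)
    (by ext a; simp [hX.initial, hY.initial, Matrix.one_apply])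
    (by ext a; simp [hX.initial, hY.initial, Matrix.one_apply])
  ext i b
  rcases i with a | a
  · exact congrFun (congrFun (key b).1 t) a
  · exact congrFun (congrFun (key b).2 t) a

theorem monodromy_conj (hV : IsPotential V) (z : ℂ) :
    monodromy V (starRingEnd ℂ z) = (monodromy V z).map (starRingEnd ℂ) :=
  fundamental_conj hV z 1

theorem monodromy_neg (z : ℂ) : monodromy V (-z) = monodromy V z := by
  have : IsFundamental V (-z) = IsFundamental V z := by
    ext X
    constructor <;> rintro ⟨h1, h2, h3⟩ <;> exact ⟨h1, h2, by simpa only [neg_sq] using h3⟩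
  unfold monodromy fundamental
  rw [this]

/-- The parameter μ = z² enters the first order system linearly, so solutions are entire in μ; then
compose with squaring. -/
theorem monodromy_differentiable (hV : IsPotential V) (i b : Fin N ⊕ Fin N) :
    Differentiable ℂ fun z => monodromy V z i b := by
  choose y hc hy using fun μ : ℂ =>
    exists_linearODE _ (systemOp_add_intervalIntegrable hV μ)
      (Pi.single b 1 : Fin N ⊕ Fin N → ℂ)
  have hd := linearODE_differentiable (systemOp_intervalIntegrable hV)
    (B := fun _ => spectralOp N) (fun _ _ => intervalIntegrable_const) _ hc hy 1
  have e : ∀ z, monodromy V z i b = y (z ^ 2) 1 i := fun z => by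
    have h0 : y (z ^ 2) 0 = Pi.single b 1 := by rw [hy]; simp
    have := (isEigen_of_system hV (hc (z ^ 2)) (hy (z ^ 2))).eq_mulVec hV 1
    have h2 : (Sum.elim (fun a => y (z ^ 2) 0 (Sum.inl a)) (fun a => y (z ^ 2) 0 (Sum.inr a)) :
        Fin N ⊕ Fin N → ℂ) = Pi.single b 1 := by
      rw [← h0]; ext i; rcases i with a | a <;> rfl
    rw [h2] at this
    have h3 := congrFun this i
    rw [Matrix.mulVec_single_one] at h3
    unfold monodromy
    rw [show (fundamental V z 1).col b i = fundamental V z 1 i b from rfl] at h3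
    rw [← h3]
    rcases i with a | a <;> rfl
  rw [show (fun z => monodromy V z i b) = _ from funext e]
  have h4 : Differentiable ℂ fun μ : ℂ => y μ 1 i := fun μ =>
    (differentiableAt_pi.1 (hd μ)) i
  exact h4.comp (differentiable_pow 2)

/-! #### Symplecticity and the Lyapunov matrix -/

/-- The entries of Xᵀ J X are the Wronskians of pairs of columns of the fundamental matrix. Both
columns belong to the same z², so Lagrange's identity makes them constant in t. -/
theorem monodromy_symplectic (hV : IsPotential V) (z : ℂ) :
    (monodromy V z).transpose * Matrix.J (Fin N) ℂ * monodromy V z = Matrix.J (Fin N) ℂ := by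
  have hX := isFundamental_fundamental hV z
  have key : ∀ t b c, ((fundamental V z t).transpose * Matrix.J (Fin N) ℂ * fundamental V z t) b c
      = ∑ a, (fundamental V z t (Sum.inr a) b * fundamental V z t (Sum.inl a) c -
        fundamental V z t (Sum.inl a) b * fundamental V z t (Sum.inr a) c) := by
    intro t b c
    simp [Matrix.mul_apply, Matrix.J, Matrix.one_apply, Finset.sum_add_distrib, sub_eq_add_neg]
  ext b c
  have := (hX.column b).lagrange hV (hX.column c) (hX.column b).rhs (hX.column c).rhs 0 1
  have z0 : ∫ s in (0 : ℝ)..1, ∑ a, (fundamental V z s (Sum.inl a) b *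
      (z ^ 2 • fun a => fundamental V z s (Sum.inl a) c) a -
      (z ^ 2 • fun a => fundamental V z s (Sum.inl a) b) a * fundamental V z s (Sum.inl a) c)
      = 0 := by
    rw [show (fun s => _) = fun _ : ℝ => (0 : ℂ) from ?_]
    · simp
    · ext s
      refine Finset.sum_eq_zero fun a _ => ?_
      simp only [Pi.smul_apply, smul_eq_mul]; ring
  rw [z0, sub_eq_zero, ← key, ← key, hX.initial] at this
  simpa [monodromy] using this

end

section

/-! ### The Lyapunov matrix -/

/-- The inverse of the monodromy matrix. -/
def monodromyInv (V : ℝ → Matrix (Fin N) (Fin N) ℝ) (z : ℂ) :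
    Matrix (Fin N ⊕ Fin N) (Fin N ⊕ Fin N) ℂ :=
  -(Matrix.J (Fin N) ℂ * (monodromy V z).transpose * Matrix.J (Fin N) ℂ)

theorem monodromyInv_mul (hV : IsPotential V) (z : ℂ) :
    monodromyInv V z * monodromy V z = 1 := by
  have h := monodromy_symplectic hV z
  rw [monodromyInv, Matrix.neg_mul, Matrix.mul_assoc, Matrix.mul_assoc,
    ← Matrix.mul_assoc (monodromy V z).transpose, h, Matrix.J_squared, neg_neg]

theorem monodromy_mul_inv (hV : IsPotential V) (z : ℂ) :
    monodromy V z * monodromyInv V z = 1 :=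
  mul_eq_one_comm.1 (monodromyInv_mul hV z)

/-- Half the sum of the monodromy matrix and its inverse. -/
def lyapunovMatrix (V : ℝ → Matrix (Fin N) (Fin N) ℝ) (z : ℂ) :
    Matrix (Fin N ⊕ Fin N) (Fin N ⊕ Fin N) ℂ :=
  (2⁻¹ : ℂ) • (monodromy V z + monodromyInv V z)

theorem lyapunovMatrix_differentiable (hV : IsPotential V) (i b : Fin N ⊕ Fin N) :
    Differentiable ℂ fun z => lyapunovMatrix V z i b := by
  have h := monodromy_differentiable hV
  simp only [lyapunovMatrix, monodromyInv, Matrix.smul_apply, Matrix.add_apply, Matrix.neg_apply,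
    Matrix.mul_apply, Matrix.transpose_apply, smul_eq_mul]
  fun_prop

theorem exists_eigenvector {ι : Type*} [Fintype ι] [DecidableEq ι] {A : Matrix ι ι ℂ} {τ : ℂ}
    (h : (A - τ • (1 : Matrix ι ι ℂ)).det = 0) : ∃ x ≠ 0, A.mulVec x = τ • x := by
  obtain ⟨x, hx, h⟩ := Matrix.exists_mulVec_eq_zero_iff.2 h
  refine ⟨x, hx, ?_⟩
  rwa [Matrix.sub_mulVec, Matrix.smul_mulVec, Matrix.one_mulVec, sub_eq_zero] at h

theorem det_sub_eq_zero {ι : Type*} [Fintype ι] [DecidableEq ι] {A : Matrix ι ι ℂ} {τ : ℂ}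
    {x : ι → ℂ} (hx : x ≠ 0) (h : A.mulVec x = τ • x) :
    (A - τ • (1 : Matrix ι ι ℂ)).det = 0 := by
  refine Matrix.exists_mulVec_eq_zero_iff.1 ⟨x, hx, ?_⟩
  rw [Matrix.sub_mulVec, Matrix.smul_mulVec, Matrix.one_mulVec, h, sub_self]

theorem exists_joukowski (ν : ℂ) : ∃ τ : ℂ, τ ≠ 0 ∧ ν = (τ + τ⁻¹) / 2 := by
  obtain ⟨s, hs⟩ := IsAlgClosed.exists_pow_nat_eq (ν ^ 2 - 1) (n := 2) (by norm_num)
  have h0 : (ν + s) * (ν - s) = 1 := by linear_combination -hs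
  have h1 : ν + s ≠ 0 := left_ne_zero_of_mul_eq_one h0
  refine ⟨ν + s, h1, ?_⟩
  rw [inv_eq_of_mul_eq_one_right h0]; ring

/-- For ν = (τ + τ⁻¹)/2 one has (M - τ)(M - τ⁻¹) = 2M(L - ν). With Δ described by the eigenvalues of
an entire matrix, closedness and local analyticity of its values can be studied without choosing τ.
-/
theorem mem_lyapunovValues_iff (hV : IsPotential V) (z ν : ℂ) :
    ν ∈ lyapunovValues V z ↔
      (lyapunovMatrix V z - ν • (1 : Matrix (Fin N ⊕ Fin N) (Fin N ⊕ Fin N) ℂ)).det = 0 := by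
  constructor
  · rintro ⟨τ, hτ, hd, rfl⟩
    obtain ⟨x, hx, h⟩ := exists_eigenvector hd
    refine det_sub_eq_zero hx ?_
    have hi : (monodromyInv V z).mulVec x = τ⁻¹ • x := by
      have := congrArg (fun y => (monodromyInv V z).mulVec y) h
      simp only [Matrix.mulVec_mulVec, monodromyInv_mul hV, Matrix.one_mulVec,
        Matrix.mulVec_smul] at this
      rw [eq_inv_smul_iff₀ hτ, ← this]
    rw [lyapunovMatrix, Matrix.smul_mulVec, Matrix.add_mulVec, h, hi, ← add_smul, smul_smul]
    congr 1; ring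
  · intro hd
    obtain ⟨τ, hτ, hν⟩ := exists_joukowski ν
    have e : (monodromy V z - τ • 1) * (monodromy V z - τ⁻¹ • 1)
        = (2 : ℂ) • (monodromy V z * (lyapunovMatrix V z - ν • 1)) := by
      have h1 := monodromy_mul_inv hV z
      rw [lyapunovMatrix, hν]
      simp only [sub_mul, mul_sub, mul_add, smul_mul_assoc, mul_smul_comm, one_mul, mul_one,
        smul_sub, smul_smul, smul_add, h1]
      match_scalars <;> field_simp
      ring
    have hz := congrArg Matrix.det e
    rw [Matrix.det_mul, Matrix.det_smul, Matrix.det_mul, hd, mul_zero, mul_zero,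
      mul_eq_zero] at hz
    rcases hz with h | h
    · exact ⟨τ, hτ, h, hν⟩
    · exact ⟨τ⁻¹, inv_ne_zero hτ, h, by rw [hν, inv_inv, add_comm]⟩

theorem charDet_conj (hV : IsPotential V) (τ z : ℂ) :
    charDet V (starRingEnd ℂ τ) (starRingEnd ℂ z) = starRingEnd ℂ (charDet V τ z) := by
  unfold charDet
  rw [monodromy_conj hV, RingHom.map_det]
  congr 1
  ext i j
  by_cases hij : i = j <;> simp [hij]

theorem conj_mem_lyapunovValues (hV : IsPotential V) {z ν : ℂ} (h : ν ∈ lyapunovValues V z) :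
    starRingEnd ℂ ν ∈ lyapunovValues V (starRingEnd ℂ z) := by
  obtain ⟨τ, hτ, hd, rfl⟩ := h
  refine ⟨starRingEnd ℂ τ, by simpa using hτ, ?_, by simp [Complex.conj_ofNat]⟩
  rw [charDet_conj hV, hd, map_zero]

theorem exists_bloch (hV : IsPotential V) {z τ : ℂ} (h : charDet V τ z = 0) :
    ∃ u u' : ℝ → Fin N → ℂ, IsEigen V (z ^ 2) u u' ∧ (u 0 ≠ 0 ∨ u' 0 ≠ 0) ∧
      ∀ t, u (t + 1) = τ • u t ∧ u' (t + 1) = τ • u' t := by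
  obtain ⟨x, hx, h⟩ := exists_eigenvector h
  have hs := isEigen_mulVec hV z x
  refine ⟨_, _, hs, ?_, fun t => hs.bloch hV ?_ ?_ t⟩
  · by_contra! hc
    refine hx ?_
    ext i
    rcases i with a | a
    · simpa [mulVec_fundamental_zero hV] using congrFun hc.1 a
    · simpa [mulVec_fundamental_zero hV] using congrFun hc.2 a
  · ext a
    simp only [mulVec_fundamental_zero hV, Pi.smul_apply]
    exact congrFun h (Sum.inl a)
  · ext a
    simp only [mulVec_fundamental_zero hV, Pi.smul_apply]
    exact congrFun h (Sum.inr a)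

theorem eigenvalue_ne_zero (hV : IsPotential V) {z τ : ℂ} (h : charDet V τ z = 0) : τ ≠ 0 := by
  rintro rfl
  have h1 : (monodromy V z).det = 0 := by simpa [charDet] using h
  have h2 := congrArg Matrix.det (monodromyInv_mul hV z)
  rw [Matrix.det_mul, h1, mul_zero, Matrix.det_one] at h2
  exact zero_ne_one h2

end

section

/-! ### Asymptotics of the multipliers -/

/-- The components of a solution along the free exponentials: `halfPart z` is the coefficient of
`e^{-izt}` and `halfPart (-z)` that of `e^{izt}`. -/
def halfPart (z : ℂ) (u u' : ℝ → Fin N → ℂ) (t : ℝ) (a : Fin N) : ℂ :=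
  (u t a + Complex.I / z * u' t a) / 2

/-- The entrywise `ℓ¹` norm of the potential. -/
def potentialSize (V : ℝ → Matrix (Fin N) (Fin N) ℝ) (s : ℝ) : ℝ := ∑ a, ∑ c, |V s a c|

theorem potentialSize_nonneg (s : ℝ) : 0 ≤ potentialSize V s :=
  Finset.sum_nonneg fun _ _ => Finset.sum_nonneg fun _ _ => abs_nonneg _

theorem potentialSize_intervalIntegrable (hV : IsPotential V) (c d : ℝ) :
    IntervalIntegrable (potentialSize V) volume c d := by
  have h : ∀ c d, IntegrableOn (potentialSize V) (Ioc c d) volume := fun c d =>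
    integrable_finsetSum _ fun a _ => integrable_finsetSum _ fun b _ => by
      simpa using (hV.intervalIntegrable a b c d).1.norm
  exact ⟨h c d, h d c⟩

theorem norm_potential_mul_le (s : ℝ) (x : Fin N → ℂ) (a : Fin N) :
    ‖∑ c, (V s a c : ℂ) * x c‖ ≤ potentialSize V s * ‖x‖ := by
  calc ‖∑ c, (V s a c : ℂ) * x c‖ ≤ ∑ c, ‖(V s a c : ℂ) * x c‖ := norm_sum_le _ _
    _ ≤ ∑ c, |V s a c| * ‖x‖ := by
        refine Finset.sum_le_sum fun c _ => ?_
        rw [norm_mul, Complex.norm_real, Real.norm_eq_abs]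
        exact mul_le_mul_of_nonneg_left (norm_le_pi_norm x c) (abs_nonneg _)
    _ = (∑ c, |V s a c|) * ‖x‖ := by rw [Finset.sum_mul]
    _ ≤ potentialSize V s * ‖x‖ := by
        refine mul_le_mul_of_nonneg_right ?_ (norm_nonneg _)
        exact Finset.single_le_sum (f := fun a => ∑ c, |V s a c|)
          (fun a _ => Finset.sum_nonneg fun _ _ => abs_nonneg _) (Finset.mem_univ a)

theorem halfPart_continuous (hV : IsPotential V) {z μ : ℂ} {u u' : ℝ → Fin N → ℂ}
    (hu : IsEigen V μ u u') : Continuous (halfPart z u u') :=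
  continuous_pi fun a => ((hu.continuous a).add
    (continuous_const.mul (hu.continuous' hV hu.rhs a))).div_const _

/-- Duhamel's formula: after multiplication by e^{izt} the free terms of the derivative cancel and
only the potential term remains. Its factor 1/z is the origin of the O(1/|z|) error. -/
theorem halfPart_eq (hV : IsPotential V) {z : ℂ} (hz : z ≠ 0) {u u' : ℝ → Fin N → ℂ}
    (hu : IsEigen V (z ^ 2) u u') (a : Fin N) (t : ℝ) :
    Complex.exp (Complex.I * z * t) * halfPart z u u' t a = halfPart z u u' 0 a +
      ∫ s in (0 : ℝ)..t, Complex.exp (Complex.I * z * s) *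
        (Complex.I / (2 * z) * ∑ c, (V s a c : ℂ) * u s c) := by
  have hd : ∀ s : ℝ, HasDerivAt (fun s : ℝ => Complex.exp (Complex.I * z * s))
      (Complex.I * z * Complex.exp (Complex.I * z * s)) s := fun s => by
    have h1 : HasDerivAt (fun s : ℝ => Complex.I * z * (s : ℂ)) (Complex.I * z) s := by
      simpa using (Complex.ofRealCLM.hasDerivAt (x := s)).const_mul (Complex.I * z)
    simpa [mul_comm] using h1.cexp
  have hi1 := (hu.continuous' hV hu.rhs a).intervalIntegrable (μ := volume) 0 t
  have hi2 := hu.integrand hV hu.rhs a 0 t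
  have hf : IntervalIntegrable (fun s => (u' s a + Complex.I / z *
      ((∑ c, (V s a c : ℂ) * u s c) - (z ^ 2 • u s) a)) / 2) volume 0 t :=
    (hi1.add (hi2.const_mul _)).div_const _
  have hg : Continuous fun s : ℝ => Complex.I * z * Complex.exp (Complex.I * z * s) := by
    fun_prop
  have key := integral_mul_add_mul (F := fun s => halfPart z u u' s a)
    (G := fun s : ℝ => Complex.exp (Complex.I * z * s)) hf (hg.intervalIntegrable 0 t)
    (fun s hs => by
      have h1 := hu.integral_deriv hV hu.rhs a 0 s
      have h2 := hu.integral a s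
      unfold halfPart
      rw [intervalIntegral.integral_div, intervalIntegral.integral_add, 
        intervalIntegral.integral_const_mul, h1, h2]
      · ring
      · exact (hu.continuous' hV hu.rhs a).intervalIntegrable (μ := volume) 0 s
      · exact (hu.integrand hV hu.rhs a 0 s).const_mul _)
    (fun s _ => by
      rw [intervalIntegral.integral_eq_sub_of_hasDerivAt (fun r _ => hd r)
        (hg.intervalIntegrable _ _)]
      ring)
  have e : ∫ s in (0 : ℝ)..t, Complex.exp (Complex.I * z * s) *
        (Complex.I / (2 * z) * ∑ c, (V s a c : ℂ) * u s c) = _ :=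
    Eq.trans (intervalIntegral.integral_congr fun s _ => ?_) key
  · rw [e]; simp; ring
  · simp only [halfPart, Pi.smul_apply, smul_eq_mul]
    field_simp
    ring_nf
    simp only [Complex.I_sq]
    ring

theorem halfPart_add (z : ℂ) (u u' : ℝ → Fin N → ℂ) (t : ℝ) :
    halfPart z u u' t + halfPart (-z) u u' t = u t := by
  ext a
  simp [halfPart, div_neg]
  ring

theorem norm_exp_I_mul (z : ℂ) (t : ℝ) :
    ‖Complex.exp (Complex.I * z * t)‖ = Real.exp (-(z.im * t)) := by
  rw [Complex.norm_exp]
  congr 1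
  simp

/-- Let m be the sum of the norms of both parts, weighted by e^{-yt}, and t₀ its maximum point. For
|z| ≥ 2K each Duhamel integral costs at most m(t₀)/4, so m(t₀) ≤ 2 m(0), and Duhamel's formula at t
= 1 gives the estimate. The other part is not estimated at t = 1: its multiplier e^{iz} may be lost
in an error of order e^{Im z}/|z|. -/
theorem halfPart_estimate (hV : IsPotential V) {z : ℂ} (hz : z ≠ 0) (him : 0 ≤ z.im)
    (hK : 2 * ∫ s in (0 : ℝ)..1, potentialSize V s ≤ ‖z‖)
    {u u' : ℝ → Fin N → ℂ} (hu : IsEigen V (z ^ 2) u u') (a : Fin N) :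
    ‖halfPart z u u' 1 a - Complex.exp (-(Complex.I * z)) * halfPart z u u' 0 a‖ ≤
      Real.exp z.im * (∫ s in (0 : ℝ)..1, potentialSize V s) / ‖z‖ *
        (‖halfPart z u u' 0‖ + ‖halfPart (-z) u u' 0‖) := by
  set K := ∫ s in (0 : ℝ)..1, potentialSize V s with hKdef
  have hz0 : 0 < ‖z‖ := norm_pos_iff.2 hz
  have hK0 : 0 ≤ K := intervalIntegral.integral_nonneg zero_le_one fun s _ =>
    potentialSize_nonneg s
  set y := z.im
  set m : ℝ → ℝ := fun t => Real.exp (-(y * t)) *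
    (‖halfPart z u u' t‖ + ‖halfPart (-z) u u' t‖) with hm
  have hmc : Continuous m := by
    have h1 := (halfPart_continuous hV hu (z := z)).norm
    have h2 := (halfPart_continuous hV hu (z := -z)).norm
    fun_prop
  obtain ⟨t₀, ht₀, hmax⟩ := isCompact_Icc.exists_isMaxOn (nonempty_Icc.2 zero_le_one)
    (hmc.continuousOn (s := Icc (0 : ℝ) 1))
  have hmax' : ∀ t ∈ Icc (0 : ℝ) 1, m t ≤ m t₀ := fun t ht => hmax ht
  have hm0 : 0 ≤ m t₀ := by positivity
  have hunorm : ∀ t ∈ Icc (0 : ℝ) 1, ‖u t‖ ≤ Real.exp (y * t) * m t₀ := fun t ht => by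
    have h1 : ‖u t‖ ≤ ‖halfPart z u u' t‖ + ‖halfPart (-z) u u' t‖ := by
      rw [← halfPart_add z u u' t]; exact norm_add_le _ _
    have h2 : Real.exp (y * t) * m t = ‖halfPart z u u' t‖ + ‖halfPart (-z) u u' t‖ := by
      rw [hm]; simp only; rw [← mul_assoc, ← Real.exp_add]; simp
    rw [← h2] at h1
    exact h1.trans (mul_le_mul_of_nonneg_left (hmax' t ht) (Real.exp_pos _).le)
  have hκt : ∀ t ∈ Icc (0 : ℝ) 1, ∫ s in (0 : ℝ)..t, potentialSize V s ≤ K := fun t ht =>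
    intervalIntegral.integral_mono_interval le_rfl ht.1 ht.2
      (Eventually.of_forall fun s => potentialSize_nonneg s)
      (potentialSize_intervalIntegrable hV 0 1)
  -- Used for ζ = z and ζ = -z. B bounds the exponential weight under the integral: 1 in the first
  -- case, e^{2yt} in the second.
  have bound : ∀ (ζ : ℂ) (t : ℝ), t ∈ Icc (0 : ℝ) 1 → ζ ≠ 0 → ‖ζ‖ = ‖z‖ → ζ ^ 2 = z ^ 2 →
      ∀ B : ℝ, (∀ s ∈ Icc 0 t, Real.exp (-(ζ.im * s)) * Real.exp (y * s) ≤ B) → ∀ a,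
      ‖Complex.exp (Complex.I * ζ * t) * halfPart ζ u u' t a - halfPart ζ u u' 0 a‖
        ≤ B * (K * m t₀ / (2 * ‖z‖)) := by
    intro ζ t ht hζ hnorm hsq B hB a
    have hB0 : 0 ≤ B := le_trans (by positivity) (hB 0 ⟨le_rfl, ht.1⟩)
    rw [halfPart_eq hV hζ (by rw [hsq]; exact hu), add_sub_cancel_left]
    have hint : IntervalIntegrable (fun s => potentialSize V s * (B * m t₀ / (2 * ‖z‖)))
        volume 0 t := (potentialSize_intervalIntegrable hV 0 t).mul_const _
    calc _ ≤ ∫ s in (0 : ℝ)..t, potentialSize V s * (B * m t₀ / (2 * ‖z‖)) := by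
          refine intervalIntegral.norm_integral_le_of_norm_le ht.1
            (Eventually.of_forall fun s hs => ?_) hint
          rw [norm_mul, norm_exp_I_mul, norm_mul, norm_div, norm_mul, Complex.norm_I, hnorm]
          have hs' : s ∈ Icc (0 : ℝ) 1 := ⟨hs.1.le, hs.2.trans ht.2⟩
          have h1 := (norm_potential_mul_le (V := V) s (u s) a).trans
            (mul_le_mul_of_nonneg_left (hunorm s hs') (potentialSize_nonneg s))
          have h2 := hB s ⟨hs.1.le, hs.2⟩
          calc Real.exp (-(ζ.im * s)) * (1 / (‖(2 : ℂ)‖ * ‖z‖) * ‖∑ c, (V s a c : ℂ) * u s c‖)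
              ≤ Real.exp (-(ζ.im * s)) * (1 / (‖(2 : ℂ)‖ * ‖z‖) *
                (potentialSize V s * (Real.exp (y * s) * m t₀))) := by gcongr
            _ = (Real.exp (-(ζ.im * s)) * Real.exp (y * s)) *
                (potentialSize V s * (m t₀ / (2 * ‖z‖))) := by
                rw [Complex.norm_ofNat]; field_simp
            _ ≤ B * (potentialSize V s * (m t₀ / (2 * ‖z‖))) := by
                refine mul_le_mul_of_nonneg_right h2 ?_
                have := potentialSize_nonneg (V := V) s
                positivity
            _ = _ := by ring
      _ = (∫ s in (0 : ℝ)..t, potentialSize V s) * (B * m t₀ / (2 * ‖z‖)) :=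
          intervalIntegral.integral_mul_const _ _
      _ ≤ K * (B * m t₀ / (2 * ‖z‖)) := by gcongr; exact hκt t ht
      _ = _ := by ring
  have bv : ∀ t ∈ Icc (0 : ℝ) 1, ∀ a,
      ‖Complex.exp (Complex.I * z * t) * halfPart z u u' t a - halfPart z u u' 0 a‖
        ≤ K * m t₀ / (2 * ‖z‖) := fun t ht a => by
    have := bound z t ht hz rfl rfl 1 (fun s _ => by rw [← Real.exp_add]; simp [y]) a
    rwa [one_mul] at this
  have bw : ∀ t ∈ Icc (0 : ℝ) 1, ∀ a,
      ‖Complex.exp (Complex.I * (-z) * t) * halfPart (-z) u u' t a - halfPart (-z) u u' 0 a‖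
        ≤ Real.exp (2 * (y * t)) * (K * m t₀ / (2 * ‖z‖)) := fun t ht a =>
    bound (-z) t ht (neg_ne_zero.2 hz) (norm_neg z) (neg_sq z) _ (fun s hs => by
      rw [← Real.exp_add, Real.exp_le_exp]
      have := mul_le_mul_of_nonneg_left hs.2 him
      simp only [Complex.neg_im]
      change -(-y * s) + y * s ≤ _
      nlinarith) a
  have hdelta : K * m t₀ / (2 * ‖z‖) ≤ m t₀ / 4 := by
    rw [div_le_div_iff₀ (by positivity) (by norm_num)]
    nlinarith
  have nv : ∀ t ∈ Icc (0 : ℝ) 1, Real.exp (-(y * t)) * ‖halfPart z u u' t‖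
      ≤ ‖halfPart z u u' 0‖ + m t₀ / 4 := fun t ht => by
    rw [← le_div_iff₀' (Real.exp_pos _)]
    refine (pi_norm_le_iff_of_nonneg (by positivity)).2 fun a => ?_
    rw [le_div_iff₀' (Real.exp_pos _)]
    have h1 := (bv t ht a).trans hdelta
    have h2 := norm_le_insert' (Complex.exp (Complex.I * z * t) * halfPart z u u' t a)
      (halfPart z u u' 0 a)
    rw [norm_mul, norm_exp_I_mul] at h2
    have h3 := norm_le_pi_norm (halfPart z u u' 0) a
    change Real.exp (-(y * t)) * _ ≤ _ at h2
    linarith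
  have nw : ∀ t ∈ Icc (0 : ℝ) 1, Real.exp (-(y * t)) * ‖halfPart (-z) u u' t‖
      ≤ ‖halfPart (-z) u u' 0‖ + m t₀ / 4 := fun t ht => by
    rw [← le_div_iff₀' (Real.exp_pos _)]
    refine (pi_norm_le_iff_of_nonneg (by positivity)).2 fun a => ?_
    rw [le_div_iff₀' (Real.exp_pos _)]
    have h1 := bw t ht a
    have h2 := norm_le_insert' (Complex.exp (Complex.I * (-z) * t) * halfPart (-z) u u' t a)
      (halfPart (-z) u u' 0 a)
    rw [norm_mul, norm_exp_I_mul] at h2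
    have h3 := norm_le_pi_norm (halfPart (-z) u u' 0) a
    have h4 : Real.exp (-((-z).im * t)) = Real.exp (y * t) := by simp [y]
    rw [h4] at h2
    have h5 : Real.exp (-(2 * (y * t))) * (Real.exp (y * t) * ‖halfPart (-z) u u' t a‖)
        ≤ Real.exp (-(2 * (y * t))) * (‖halfPart (-z) u u' 0‖ +
          Real.exp (2 * (y * t)) * (m t₀ / 4)) :=
      mul_le_mul_of_nonneg_left (by
        have := mul_le_mul_of_nonneg_left hdelta (Real.exp_pos (2 * (y * t))).le
        linarith) (Real.exp_pos _).le
    have h6 : Real.exp (-(2 * (y * t))) * (Real.exp (y * t) * ‖halfPart (-z) u u' t a‖)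
        = Real.exp (-(y * t)) * ‖halfPart (-z) u u' t a‖ := by
      rw [← mul_assoc, ← Real.exp_add]; congr 2; ring
    have h7 : Real.exp (-(2 * (y * t))) * (‖halfPart (-z) u u' 0‖ +
          Real.exp (2 * (y * t)) * (m t₀ / 4)) = Real.exp (-(2 * (y * t))) *
          ‖halfPart (-z) u u' 0‖ + m t₀ / 4 := by
      rw [mul_add, ← mul_assoc _ _ (m t₀ / 4), ← Real.exp_add]; simp
    have h8 : Real.exp (-(2 * (y * t))) ≤ 1 := by
      rw [Real.exp_le_one_iff]
      have := mul_nonneg him ht.1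
      change 0 ≤ y * t at this
      linarith
    rw [h6, h7] at h5
    nlinarith [norm_nonneg (halfPart (-z) u u' 0)]
  have hmt : m t₀ ≤ 2 * (‖halfPart z u u' 0‖ + ‖halfPart (-z) u u' 0‖) := by
    have h1 := nv t₀ ht₀
    have h2 := nw t₀ ht₀
    have h3 : m t₀ = Real.exp (-(y * t₀)) * ‖halfPart z u u' t₀‖ +
      Real.exp (-(y * t₀)) * ‖halfPart (-z) u u' t₀‖ := by rw [hm]; ring
    linarith
  have h1 := bv 1 ⟨zero_le_one, le_rfl⟩ a
  have h2 : halfPart z u u' 1 a - Complex.exp (-(Complex.I * z)) * halfPart z u u' 0 a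
      = Complex.exp (-(Complex.I * z)) *
        (Complex.exp (Complex.I * z * (1 : ℝ)) * halfPart z u u' 1 a - halfPart z u u' 0 a) := by
    rw [mul_sub, ← mul_assoc, ← Complex.exp_add]; simp
  have h3 : ‖Complex.exp (-(Complex.I * z))‖ = Real.exp y := by
    rw [Complex.norm_exp]; simp [y]
  rw [h2, norm_mul, h3]
  calc Real.exp y * _ ≤ Real.exp y * (K * (2 * (‖halfPart z u u' 0‖ + ‖halfPart (-z) u u' 0‖))
        / (2 * ‖z‖)) := by
        refine mul_le_mul_of_nonneg_left (h1.trans ?_) (Real.exp_pos _).le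
        gcongr
    _ = _ := by field_simp

end

/-! ### Time reversal and the moduli of the multipliers -/

section

theorem IsPotential.reverse (hV : IsPotential V) : IsPotential fun t => V (1 - t) where
  symm t := hV.symm _
  periodic t := by
    rw [← hV.periodic (1 - (t + 1))]
    congr 1; ring
  memLp a b := by
    have h1 := (hV.memLp a b)
    rw [← Measure.restrict_congr_set Ico_ae_eq_Ioc] at h1
    have hm : MeasurePreserving (fun t : ℝ => 1 - t) (volume.restrict (Ioc (0 : ℝ) 1))
        (volume.restrict (Ico (0 : ℝ) 1)) := by
      have := (Measure.measurePreserving_sub_left (volume : Measure ℝ) 1).restrict_preimage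
        (measurableSet_Ico (a := (0 : ℝ)) (b := 1))
      have e : (fun t : ℝ => 1 - t) ⁻¹' Ico 0 1 = Ioc 0 1 := by
        ext t; simp
      rwa [e] at this
    exact h1.comp_measurePreserving hm

/-- Reversing time exchanges τ with τ⁻¹ and the two half parts, which brings a dominant e^{izt} part
back to the estimate for the e^{-izt} part. -/
theorem IsEigen.reverse (hV : IsPotential V) {μ : ℂ} {u u' : ℝ → Fin N → ℂ}
    (hu : IsEigen V μ u u') :
    IsEigen (fun t => V (1 - t)) μ (fun t => u (1 - t)) (fun t => -u' (1 - t)) := by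
  refine ⟨fun a t => ?_, fun a t => ?_⟩
  · simpa using (hu.deriv a (1 - t)).comp_const_sub 1 t
  · have := hu.integral_from hV hu.rhs a (1 - 0) (1 - t)
    simp only [Pi.neg_apply]
    rw [this, intervalIntegral.integral_symm, 
      ← intervalIntegral.integral_comp_sub_left (fun s => (∑ c, (V s a c : ℂ) * u s c) - (μ • u s) a)]
    ring

theorem potentialSize_reverse :
    ∫ s in (0 : ℝ)..1, potentialSize (fun t => V (1 - t)) s
      = ∫ s in (0 : ℝ)..1, potentialSize V s := by
  have := intervalIntegral.integral_comp_sub_left (a := 0) (b := 1) (potentialSize V) 1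
  simpa [potentialSize] using this

theorem abs_log_sub_le {τ w : ℂ} {y δ : ℝ} (hw : ‖w‖ = Real.exp y) (hδ0 : 0 ≤ δ) (hδ : δ ≤ 1 / 2)
    (h : ‖τ - w‖ ≤ Real.exp y * δ) : |Real.log ‖τ‖ - y| ≤ 2 * δ := by
  have h1 : |‖τ‖ - Real.exp y| ≤ Real.exp y * δ := by
    rw [← hw] at h ⊢
    exact (abs_norm_sub_norm_le τ w).trans h
  obtain ⟨h2, h3⟩ := abs_le.1 h1
  have hy := Real.exp_pos y
  have hτ : 0 < ‖τ‖ := by nlinarith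
  have e : Real.log ‖τ‖ - y = Real.log (‖τ‖ / Real.exp y) := by
    rw [Real.log_div hτ.ne' hy.ne', Real.log_exp]
  have r1 : 1 - δ ≤ ‖τ‖ / Real.exp y := by rw [le_div_iff₀ hy]; linarith
  have r2 : ‖τ‖ / Real.exp y ≤ 1 + δ := by rw [div_le_iff₀ hy]; linarith
  have hr : 0 < ‖τ‖ / Real.exp y := by positivity
  rw [e, abs_le]
  constructor
  · have h4 := Real.one_sub_inv_le_log_of_pos hr
    have h5 : (‖τ‖ / Real.exp y)⁻¹ ≤ 1 + 2 * δ := by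
      rw [inv_le_comm₀ hr (by linarith)]
      refine le_trans ?_ r1
      rw [inv_le_iff_one_le_mul₀ (by linarith)]
      nlinarith
    linarith
  · have h4 := Real.log_le_sub_one_of_pos hr
    linarith

theorem halfPart_ne_zero {z : ℂ} (hz : z ≠ 0) {u u' : ℝ → Fin N → ℂ} (h : u 0 ≠ 0 ∨ u' 0 ≠ 0) :
    0 < max ‖halfPart z u u' 0‖ ‖halfPart (-z) u u' 0‖ := by
  by_contra hc
  rw [not_lt, max_le_iff] at hc
  have h1 : halfPart z u u' 0 = 0 := norm_le_zero_iff.1 hc.1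
  have h2 : halfPart (-z) u u' 0 = 0 := norm_le_zero_iff.1 hc.2
  have hu : u 0 = 0 := by rw [← halfPart_add z u u' 0, h1, h2, add_zero]
  refine h.elim (fun h => h hu) fun h => h ?_
  ext a
  have := congrFun h1 a
  simpa [halfPart, hu, hz] using this

/-- The half part with the larger initial norm is evaluated in a coordinate where its sup norm is
attained. If it is the e^{-izt} part, τ is close to e^{-iz}; otherwise time reversal gives this for
τ⁻¹, and |log|τ|| does not see the difference. The sum of the two norms is at most twice the larger
one, hence the relative error 2K/|z|; passing to logarithms doubles it and needs it to be at most
1/2. -/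
theorem multiplier_bound_upper (hV : IsPotential V) {z : ℂ} (hz : z ≠ 0) (him : 0 ≤ z.im)
    (hK : 4 * ∫ s in (0 : ℝ)..1, potentialSize V s ≤ ‖z‖) {τ : ℂ} (hτ : charDet V τ z = 0) :
    |(|Real.log ‖τ‖|) - z.im| ≤ 4 * (∫ s in (0 : ℝ)..1, potentialSize V s) / ‖z‖ := by
  obtain ⟨u, u', hu, hne, hb⟩ := exists_bloch hV hτ
  have hτ0 := eigenvalue_ne_zero hV hτ
  set K := ∫ s in (0 : ℝ)..1, potentialSize V s with hKdef
  have hz0 : 0 < ‖z‖ := norm_pos_iff.2 hz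
  have hK0 : 0 ≤ K := intervalIntegral.integral_nonneg zero_le_one fun s _ =>
    potentialSize_nonneg s
  have hδ : 2 * K / ‖z‖ ≤ 1 / 2 := by rw [div_le_iff₀ hz0]; linarith
  have hδ0 : 0 ≤ 2 * K / ‖z‖ := by positivity
  have hw : ‖Complex.exp (-(Complex.I * z))‖ = Real.exp z.im := by
    rw [Complex.norm_exp]; simp
  have hb0 := hb 0
  rw [zero_add] at hb0
  have hp : ∀ (ζ : ℂ) a, halfPart ζ u u' 1 a = τ * halfPart ζ u u' 0 a := fun ζ a => by
    simp only [halfPart, hb0.1, hb0.2, Pi.smul_apply, smul_eq_mul]; ring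
  have hpos := halfPart_ne_zero hz hne
  have attained : ∀ x : Fin N → ℂ, 0 < ‖x‖ → ∃ a, ‖x a‖ = ‖x‖ := fun x hx => by
    have : Nonempty (Fin N) := by
      by_contra hN
      rw [not_nonempty_iff] at hN
      simp [Subsingleton.elim x 0] at hx
    obtain ⟨a, ha⟩ := Finite.exists_max fun a => ‖x a‖
    exact ⟨a, le_antisymm (norm_le_pi_norm x a) ((pi_norm_le_iff_of_nonneg (norm_nonneg _)).2 ha)⟩
  have finish : ∀ σ : ℂ, |Real.log ‖σ‖| = |Real.log ‖τ‖| →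
      ‖σ - Complex.exp (-(Complex.I * z))‖ ≤ Real.exp z.im * (2 * K / ‖z‖) →
      |(|Real.log ‖τ‖|) - z.im| ≤ 4 * K / ‖z‖ := fun σ hσ h => by
    have h1 := abs_log_sub_le hw hδ0 hδ h
    have h2 := abs_abs_sub_abs_le (Real.log ‖σ‖) z.im
    rw [hσ, abs_of_nonneg him] at h2
    calc _ ≤ _ := h2
      _ ≤ _ := h1
      _ = _ := by ring
  rcases le_total ‖halfPart (-z) u u' 0‖ ‖halfPart z u u' 0‖ with hle | hle
  · rw [max_eq_left hle] at hpos
    obtain ⟨a, ha⟩ := attained _ hpos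
    have h1 := halfPart_estimate hV hz him (by linarith) hu a
    rw [hp, ← sub_mul, norm_mul, ha, ← hKdef] at h1
    refine finish τ rfl (le_of_mul_le_mul_right (h1.trans ?_) hpos)
    calc _ ≤ Real.exp z.im * K / ‖z‖ * (‖halfPart z u u' 0‖ + ‖halfPart z u u' 0‖) := by gcongr
      _ = _ := by ring
  · rw [max_eq_right hle] at hpos
    obtain ⟨a, ha⟩ := attained _ hpos
    have h1 := halfPart_estimate hV.reverse hz him (by rw [potentialSize_reverse]; linarith)
      (hu.reverse hV) a
    have hr : ∀ (ζ : ℂ) (t : ℝ), halfPart ζ (fun t => u (1 - t)) (fun t => -u' (1 - t)) t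
        = halfPart (-ζ) u u' (1 - t) := fun ζ t => by
      ext a; simp [halfPart, div_neg]
    have hp' : ∀ ζ : ℂ, halfPart ζ u u' 1 = τ • halfPart ζ u u' 0 := fun ζ => by
      ext a; simp [hp]
    rw [potentialSize_reverse, hr, hr, hr, sub_self, sub_zero, neg_neg, hp, hp', hp',
      norm_smul, norm_smul, ← hKdef] at h1
    refine finish τ⁻¹ (by rw [norm_inv, Real.log_inv, abs_neg])
      (le_of_mul_le_mul_right (le_of_mul_le_mul_right (le_trans (le_of_eq ?_) (h1.trans ?_))
        (norm_pos_iff.2 hτ0)) hpos)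
    · rw [← ha]
      simp only [← norm_mul]
      congr 1
      field_simp
    · calc _ ≤ Real.exp z.im * K / ‖z‖ * (‖τ‖ * ‖halfPart (-z) u u' 0‖ +
            ‖τ‖ * ‖halfPart (-z) u u' 0‖) := by gcongr
        _ = _ := by ring

/-- The multipliers satisfy `|log |τ|| = |Im z| + O(1/|z|)`. -/
theorem exists_multiplier_bound (hV : IsPotential V) : ∃ C ρ : ℝ, 0 ≤ C ∧ 1 ≤ ρ ∧
    ∀ z τ : ℂ, ρ ≤ ‖z‖ → charDet V τ z = 0 → abs (|Real.log ‖τ‖| - |z.im|) ≤ C / ‖z‖ := by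
  set K := ∫ s in (0 : ℝ)..1, potentialSize V s with hKdef
  have hK0 : 0 ≤ K := intervalIntegral.integral_nonneg zero_le_one fun s _ =>
    potentialSize_nonneg s
  refine ⟨4 * K, 4 * K + 1, by positivity, by linarith, fun z τ hz hτ => ?_⟩
  have hz0 : z ≠ 0 := norm_pos_iff.1 (by linarith)
  rcases le_total 0 z.im with h | h
  · rw [abs_of_nonneg h]
    exact multiplier_bound_upper hV hz0 h (by linarith) hτ
  -- M depends on z² only, so the lower half plane reduces to the upper one.
  · rw [abs_of_nonpos h, ← Complex.neg_im, ← norm_neg z]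
    refine multiplier_bound_upper hV (neg_ne_zero.2 hz0) (by simpa using h)
      (by rw [norm_neg]; linarith) ?_
    rw [charDet, monodromy_neg]; exact hτ

end

section

/-! ### The function `η` -/

theorem cpow_half_sq (w : ℂ) : (w ^ (1 / 2 : ℂ)) ^ 2 = w := by
  rw [← Complex.cpow_nat_mul]; simp

theorem cpow_half_re_nonneg (w : ℂ) : 0 ≤ (w ^ (1 / 2 : ℂ)).re := by
  rcases eq_or_ne w 0 with rfl | hw
  · simp
  rw [Complex.cpow_def_of_ne_zero hw, Complex.exp_re]
  refine mul_nonneg (Real.exp_pos _).le (Real.cos_nonneg_of_mem_Icc ?_)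
  have h1 := Complex.neg_pi_lt_arg w
  have h2 := Complex.arg_le_pi w
  have : (Complex.log w * (1 / 2 : ℂ)).im = w.arg / 2 := by
    rw [show (1 / 2 : ℂ) = ((1 / 2 : ℝ) : ℂ) by simp, Complex.im_mul_ofReal, Complex.log_im]; ring
  rw [this]
  constructor <;> linarith

theorem two_mul_sq_half_re_im {w b : ℂ} (h : b ^ 2 = w) : 2 * (b.re * b.im) = w.im := by
  rw [← h, sq, Complex.mul_im]; ring

theorem cpow_half_im_nonneg {w : ℂ} (h : 0 ≤ w.im) : 0 ≤ (w ^ (1 / 2 : ℂ)).im := by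
  rcases eq_or_ne w 0 with rfl | hw
  · simp
  rw [Complex.cpow_def_of_ne_zero hw, Complex.exp_im]
  refine mul_nonneg (Real.exp_pos _).le (Real.sin_nonneg_of_mem_Icc ?_)
  have h1 := Complex.arg_nonneg_iff.2 h
  have h2 := Complex.arg_le_pi w
  have : (Complex.log w * (1 / 2 : ℂ)).im = w.arg / 2 := by
    rw [show (1 / 2 : ℂ) = ((1 / 2 : ℝ) : ℂ) by simp, Complex.im_mul_ofReal, Complex.log_im]; ring
  rw [this]
  constructor <;> linarith

theorem cpow_half_im_nonpos {w : ℂ} (h : w.im < 0) : (w ^ (1 / 2 : ℂ)).im ≤ 0 := by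
  have h1 := two_mul_sq_half_re_im (cpow_half_sq w)
  have h2 := cpow_half_re_nonneg w
  by_contra hc
  push Not at hc
  nlinarith [mul_nonneg h2 hc.le]

theorem eta_mul (w : ℂ) :
    eta w * (w - (w - 1) ^ (1 / 2 : ℂ) * (w + 1) ^ (1 / 2 : ℂ)) = 1 := by
  have h1 := cpow_half_sq (w - 1)
  have h2 := cpow_half_sq (w + 1)
  unfold eta
  linear_combination (-(w + 1)) * h1 - ((w - 1) ^ (1 / 2 : ℂ)) ^ 2 * h2

theorem eta_ne_zero (w : ℂ) : eta w ≠ 0 := left_ne_zero_of_mul_eq_one (eta_mul w)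

theorem eta_inv (w : ℂ) :
    (eta w)⁻¹ = w - (w - 1) ^ (1 / 2 : ℂ) * (w + 1) ^ (1 / 2 : ℂ) :=
  inv_eq_of_mul_eq_one_right (eta_mul w)

theorem eta_add_inv (w : ℂ) : eta w + (eta w)⁻¹ = 2 * w := by
  rw [eta_inv, eta]; ring

theorem normSq_eta_aux (a b : ℂ) : ‖a + b‖ ^ 2 / 2 + ‖a - b‖ ^ 2 / 2 = ‖a‖ ^ 2 + ‖b‖ ^ 2 := by
  simp only [← Complex.normSq_eq_norm_sq, Complex.normSq_apply, Complex.add_re, Complex.add_im,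
    Complex.sub_re, Complex.sub_im]
  ring

/-- With a, b the principal roots of w - 1 and w + 1, η = (a + b)²/2 and η⁻¹ = (a - b)²/2. Thus |η|
≥ 1 becomes a comparison of |a + b| with |a - b|, and |η| + |η|⁻¹ comes from the parallelogram law.
-/
theorem norm_eta_eq (w : ℂ) :
    ‖eta w‖ = ‖(w - 1) ^ (1 / 2 : ℂ) + (w + 1) ^ (1 / 2 : ℂ)‖ ^ 2 / 2 := by
  have h1 := cpow_half_sq (w - 1)
  have h2 := cpow_half_sq (w + 1)
  have : eta w = ((w - 1) ^ (1 / 2 : ℂ) + (w + 1) ^ (1 / 2 : ℂ)) ^ 2 / 2 := by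
    unfold eta; linear_combination -h1 / 2 - h2 / 2
  rw [this, norm_div, norm_pow, Complex.norm_ofNat]

theorem norm_eta_inv_eq (w : ℂ) :
    ‖eta w‖⁻¹ = ‖(w - 1) ^ (1 / 2 : ℂ) - (w + 1) ^ (1 / 2 : ℂ)‖ ^ 2 / 2 := by
  have h1 := cpow_half_sq (w - 1)
  have h2 := cpow_half_sq (w + 1)
  have : (eta w)⁻¹ = ((w - 1) ^ (1 / 2 : ℂ) - (w + 1) ^ (1 / 2 : ℂ)) ^ 2 / 2 := by
    rw [eta_inv]; linear_combination -h1 / 2 - h2 / 2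
  rw [← norm_inv, this, norm_div, norm_pow, Complex.norm_ofNat]

/-- The level curves of |η| are ellipses with foci ±1. The formula shows that |η| is continuous on
the whole plane, even across [-1,1], where η itself jumps. -/
theorem norm_eta_add_inv (w : ℂ) : ‖eta w‖ + ‖eta w‖⁻¹ = ‖w - 1‖ + ‖w + 1‖ := by
  rw [norm_eta_inv_eq, norm_eta_eq, normSq_eta_aux, ← norm_pow, ← norm_pow, cpow_half_sq,
    cpow_half_sq]

/-- The principal roots of w - 1 and w + 1 lie in a common closed quadrant, so their real inner
product is nonnegative. -/
theorem one_le_norm_eta (w : ℂ) : 1 ≤ ‖eta w‖ := by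
  set a := (w - 1) ^ (1 / 2 : ℂ) with ha
  set b := (w + 1) ^ (1 / 2 : ℂ) with hb
  have hre : 0 ≤ a.re * b.re := mul_nonneg (cpow_half_re_nonneg _) (cpow_half_re_nonneg _)
  have him : 0 ≤ a.im * b.im := by
    rcases le_or_gt 0 w.im with h | h
    · exact mul_nonneg (cpow_half_im_nonneg (by simpa using h))
        (cpow_half_im_nonneg (by simpa using h))
    · exact mul_nonneg_of_nonpos_of_nonpos (cpow_half_im_nonpos (by simpa using h))
        (cpow_half_im_nonpos (by simpa using h))
  have h : ‖eta w‖⁻¹ ≤ ‖eta w‖ := by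
    rw [norm_eta_inv_eq, norm_eta_eq, ← ha, ← hb]
    simp only [← Complex.normSq_eq_norm_sq, Complex.normSq_apply, Complex.add_re, Complex.add_im,
      Complex.sub_re, Complex.sub_im]
    linarith
  have hp : 0 < ‖eta w‖ := norm_pos_iff.2 (eta_ne_zero w)
  by_contra hc
  push Not at hc
  have := (one_lt_inv₀ hp).2 hc
  linarith

theorem log_norm_eta_nonneg (w : ℂ) : 0 ≤ Real.log ‖eta w‖ := Real.log_nonneg (one_le_norm_eta w)

theorem eq_or_eq_inv_of_add_inv {x y : ℂ} (hx : x ≠ 0) (hy : y ≠ 0)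
    (h : x + x⁻¹ = y + y⁻¹) : x = y ∨ x = y⁻¹ := by
  have : (x - y) * (x - y⁻¹) = 0 := by
    have h2 : x * (x + x⁻¹) = x * (y + y⁻¹) := by rw [h]
    rw [mul_add, mul_inv_cancel₀ hx] at h2
    have h3 := mul_inv_cancel₀ hy
    linear_combination h2 + h3
  rcases mul_eq_zero.1 this with h | h
  · exact Or.inl (sub_eq_zero.1 h)
  · exact Or.inr (sub_eq_zero.1 h)

theorem log_norm_eta_joukowski {τ : ℂ} (hτ : τ ≠ 0) :
    Real.log ‖eta ((τ + τ⁻¹) / 2)‖ = |Real.log ‖τ‖| := by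
  have h := eta_add_inv ((τ + τ⁻¹) / 2)
  have h0 := log_norm_eta_nonneg ((τ + τ⁻¹) / 2)
  rw [mul_div_cancel₀ _ (two_ne_zero)] at h
  rcases eq_or_eq_inv_of_add_inv (eta_ne_zero _) hτ h with h | h
  · rw [h] at h0 ⊢
    rw [abs_of_nonneg h0]
  · rw [h, norm_inv, Real.log_inv] at h0 ⊢
    rw [abs_of_nonpos (by linarith)]

theorem eta_eq_of_one_lt {w σ : ℂ} (h : σ + σ⁻¹ = 2 * w) (hσ : 1 < ‖σ‖) : eta w = σ := by
  have hσ0 : σ ≠ 0 := norm_pos_iff.1 (by linarith)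
  rcases eq_or_eq_inv_of_add_inv (eta_ne_zero w) hσ0 ((eta_add_inv w).trans h.symm) with h | h
  · exact h
  · have h1 := one_le_norm_eta w
    rw [h, norm_inv] at h1
    have := inv_lt_one_of_one_lt₀ hσ
    linarith

/-- The complex numbers of the real interval `[-1, 1]`. -/
def InBand (w : ℂ) : Prop := w.im = 0 ∧ w.re ∈ Icc (-1 : ℝ) 1

theorem norm_eta_eq_one_iff (w : ℂ) : ‖eta w‖ = 1 ↔ InBand w := by
  constructor
  · intro h
    have h1 : (eta w)⁻¹ = starRingEnd ℂ (eta w) := by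
      rw [Complex.inv_def, Complex.normSq_eq_norm_sq, h]; simp
    have h2 := eta_add_inv w
    rw [h1, Complex.add_conj] at h2
    have h3 : w = ((eta w).re : ℂ) := by
      have : (2 : ℂ) * ((eta w).re : ℂ) = 2 * w := by rw [← h2]; push_cast; ring
      exact (mul_left_cancel₀ two_ne_zero this).symm
    have h4 := Complex.abs_re_le_norm (eta w)
    rw [h] at h4
    constructor
    · rw [h3]; simp
    · rw [h3, Complex.ofReal_re]; exact abs_le.1 h4
  · rintro ⟨h1, h2, h3⟩
    have e := norm_eta_add_inv w
    have e1 : ‖w - 1‖ = 1 - w.re := by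
      rw [show w - 1 = ((w.re - 1 : ℝ) : ℂ) from Complex.ext (by simp) (by simp [h1]),
        Complex.norm_real, Real.norm_eq_abs, abs_of_nonpos (by linarith), neg_sub]
    have e2 : ‖w + 1‖ = w.re + 1 := by
      rw [show w + 1 = ((w.re + 1 : ℝ) : ℂ) from Complex.ext (by simp) (by simp [h1]),
        Complex.norm_real, Real.norm_eq_abs, abs_of_nonneg (by linarith)]
    rw [e1, e2] at e
    have hp : 0 < ‖eta w‖ := norm_pos_iff.2 (eta_ne_zero w)
    field_simp at e
    nlinarith [sq_nonneg (‖eta w‖ - 1)]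

theorem one_lt_norm_eta {w : ℂ} (h : ¬ InBand w) : 1 < ‖eta w‖ :=
  lt_of_le_of_ne (one_le_norm_eta w) fun h' => h ((norm_eta_eq_one_iff w).1 h'.symm)

theorem continuous_norm_eta : Continuous fun w => ‖eta w‖ := by
  have h : ∀ w, ‖eta w‖ = (‖w - 1‖ + ‖w + 1‖) / 2 + √(((‖w - 1‖ + ‖w + 1‖) / 2) ^ 2 - 1) := by
    intro w
    rw [← norm_eta_add_inv]
    have hp : 0 < ‖eta w‖ := norm_pos_iff.2 (eta_ne_zero w)
    have h1 := one_le_norm_eta w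
    have h2 : ‖eta w‖⁻¹ ≤ 1 := inv_le_one_of_one_le₀ h1
    have : ((‖eta w‖ + ‖eta w‖⁻¹) / 2) ^ 2 - 1 = ((‖eta w‖ - ‖eta w‖⁻¹) / 2) ^ 2 := by
      field_simp; ring
    rw [this, Real.sqrt_sq (by linarith)]
    ring
  rw [show (fun w => ‖eta w‖) = _ from funext h]
  fun_prop

theorem continuous_log_norm_eta : Continuous fun w => Real.log ‖eta w‖ :=
  continuous_norm_eta.log fun w => norm_ne_zero_iff.2 (eta_ne_zero w)

theorem eta_conj {w : ℂ} (h : ¬ InBand w) : eta (starRingEnd ℂ w) = starRingEnd ℂ (eta w) := by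
  refine eta_eq_of_one_lt ?_ (by rw [RCLike.norm_conj]; exact one_lt_norm_eta h)
  rw [← map_inv₀, ← map_add, eta_add_inv, map_mul, Complex.conj_ofNat]

/-- A local branch of the square root is normalized to agree with η at w. Its modulus stays above 1
nearby, and the solution of σ + σ⁻¹ = 2x outside the unit circle is η(x). This includes the half
line (-∞, -1), where both principal powers in the definition are on their cut. -/
theorem eta_analyticAt {w : ℂ} (h : ¬ InBand w) : AnalyticAt ℂ eta w := by
  have hw : w ^ 2 - 1 ≠ 0 := fun h0 => by
    have : (w - 1) * (w + 1) = 0 := by linear_combination h0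
    rcases mul_eq_zero.1 this with h1 | h1
    · rw [sub_eq_zero.1 h1] at h; exact h ⟨by simp, by simp⟩
    · rw [eq_neg_of_add_eq_zero_left h1] at h; exact h ⟨by simp, by simp⟩
  set s₀ := eta w - w with hs
  have hs2 : s₀ ^ 2 = w ^ 2 - 1 := by
    have h1 := eta_add_inv w
    have h2 := mul_inv_cancel₀ (eta_ne_zero w)
    rw [hs]; linear_combination eta w * h1 - h2
  set g : ℂ → ℂ := fun x => x + s₀ * ((x ^ 2 - 1) / (w ^ 2 - 1)) ^ (1 / 2 : ℂ) with hg
  have hga : AnalyticAt ℂ g w := by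
    have h1 : AnalyticAt ℂ (fun x : ℂ => (x ^ 2 - 1) / (w ^ 2 - 1)) w := by fun_prop
    have : AnalyticAt ℂ (fun x : ℂ => ((x ^ 2 - 1) / (w ^ 2 - 1)) ^ (1 / 2 : ℂ)) w :=
      h1.cpow analyticAt_const (by rw [div_self hw]; exact Complex.one_mem_slitPlane)
    rw [hg]; fun_prop
  have hgw : g w = eta w := by simp [hg, div_self hw, hs]
  have hev : ∀ᶠ x in 𝓝 w, 1 < ‖g x‖ := by
    refine hga.continuousAt.norm.eventually (lt_mem_nhds ?_)
    simpa only [hgw] using one_lt_norm_eta h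
  refine hga.congr ?_
  filter_upwards [hev] with x hx
  refine (eta_eq_of_one_lt ?_ hx).symm
  have hg0 : g x ≠ 0 := norm_pos_iff.1 (by linarith)
  have e : (g x - x) ^ 2 = x ^ 2 - 1 := by
    rw [hg]; simp only [add_sub_cancel_left]
    rw [mul_pow, cpow_half_sq, hs2]; field_simp
  field_simp
  linear_combination e

end

section

/-! ### Subharmonicity -/

theorem chebyshev_joukowski {x : ℂ} (hx : x ≠ 0) (n : ℕ) :
    (Polynomial.Chebyshev.T ℂ n).eval ((x + x⁻¹) / 2) = (x ^ n + x⁻¹ ^ n) / 2 := by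
  induction n using Nat.twoStepInduction with
  | zero => simp
  | one => simp
  | more n ih1 ih2 =>
    have h1 : ((n + 2 : ℕ) : ℤ) = (n : ℤ) + 2 := by push_cast; ring
    have h2 : ((n + 1 : ℕ) : ℤ) = (n : ℤ) + 1 := by push_cast; ring
    rw [h1, Polynomial.Chebyshev.T_add_two]
    rw [h2] at ih2
    simp only [Polynomial.eval_sub, Polynomial.eval_mul, Polynomial.eval_ofNat,
      Polynomial.eval_X, ih1, ih2]
    have hxi := mul_inv_cancel₀ hx
    linear_combination ((x ^ n + x⁻¹ ^ n) / 2) * hxi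

theorem chebyshev_eta (w : ℂ) (n : ℕ) :
    (Polynomial.Chebyshev.T ℂ n).eval w = (eta w ^ n + (eta w)⁻¹ ^ n) / 2 := by
  rw [← chebyshev_joukowski (eta_ne_zero w), eta_add_inv, mul_div_cancel_left₀ _ two_ne_zero]

theorem norm_chebyshev_le (w : ℂ) (n : ℕ) :
    ‖(Polynomial.Chebyshev.T ℂ n).eval w‖ ≤ ‖eta w‖ ^ n := by
  rw [chebyshev_eta, norm_div, Complex.norm_ofNat]
  have h1 := one_le_norm_eta w
  have h2 : ‖eta w‖⁻¹ ^ n ≤ ‖eta w‖ ^ n :=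
    pow_le_pow_left₀ (by positivity) ((inv_le_one_of_one_le₀ h1).trans h1) n
  have h3 := norm_add_le (eta w ^ n) ((eta w)⁻¹ ^ n)
  simp only [norm_pow, norm_inv] at h3
  linarith

theorem le_norm_chebyshev (w : ℂ) (n : ℕ) :
    (‖eta w‖ ^ n - 1) / 2 ≤ ‖(Polynomial.Chebyshev.T ℂ n).eval w‖ := by
  rw [chebyshev_eta, norm_div, Complex.norm_ofNat]
  have h1 := one_le_norm_eta w
  have h2 : ‖eta w‖⁻¹ ^ n ≤ 1 := pow_le_one₀ (by positivity) (inv_le_one_of_one_le₀ h1)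
  have h3 := norm_sub_le (eta w ^ n + (eta w)⁻¹ ^ n) ((eta w)⁻¹ ^ n)
  simp only [add_sub_cancel_right, norm_pow, norm_inv] at h3
  linarith

theorem log_norm_le_circleAverage {c : ℂ} {r : ℝ} (hr : 0 < r) {f : ℂ → ℂ}
    (hf : AnalyticOnNhd ℂ f (Metric.closedBall c r)) (h0 : f c ≠ 0) :
    Real.log ‖f c‖ ≤ Real.circleAverage (fun z => Real.log ‖f z‖) c r := by
  have hf' : AnalyticOnNhd ℂ f (Metric.closedBall c |r|) := by rwa [abs_of_pos hr]
  rw [hf'.circleAverage_log_norm hr.ne' h0]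
  refine le_add_of_nonneg_left (finsum_nonneg fun u => ?_)
  by_cases hu : u ∈ Metric.closedBall c |r|
  · refine mul_nonneg (by exact_mod_cast (MeromorphicOn.AnalyticOnNhd.divisor_nonneg hf') u) ?_
    -- At u = c the summand vanishes by the conventions 0⁻¹ = 0 and log 0 = 0.
    rcases eq_or_ne u c with rfl | hne
    · simp
    · refine Real.log_nonneg ?_
      have h1 : 0 < ‖c - u‖ := norm_pos_iff.2 (sub_ne_zero.2 hne.symm)
      rw [← div_eq_mul_inv, one_le_div h1]
      rw [Metric.mem_closedBall', dist_eq_norm, abs_of_pos hr] at hu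
      exact hu
  · rw [Function.locallyFinsuppWithin.apply_eq_zero_of_notMem _ hu]; simp

/-- `log |η(f)|` satisfies the sub-mean value inequality for analytic `f`. -/
theorem log_norm_eta_le_circleAverage {c : ℂ} {r : ℝ} (hr : 0 < r) {f : ℂ → ℂ}
    (hf : AnalyticOnNhd ℂ f (Metric.closedBall c r)) :
    CircleIntegrable (fun z => Real.log ‖eta (f z)‖) c r ∧
    Real.log ‖eta (f c)‖ ≤ Real.circleAverage (fun z => Real.log ‖eta (f z)‖) c r := by
  have hci : CircleIntegrable (fun z => Real.log ‖eta (f z)‖) c r :=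
    (continuous_log_norm_eta.comp_continuousOn
      (hf.continuousOn.mono Metric.sphere_subset_closedBall)).circleIntegrable hr.le
  refine ⟨hci, ?_⟩
  set A := Real.circleAverage (fun z => Real.log ‖eta (f z)‖) c r with hA
  have hA0 : 0 ≤ A := Real.circleAverage_nonneg_of_nonneg fun z _ => log_norm_eta_nonneg _
  rcases (one_le_norm_eta (f c)).eq_or_lt with h1 | h1
  · rw [← h1]; simpa using hA0
  have hlog : 0 < Real.log ‖eta (f c)‖ := Real.log_pos h1
  -- The bound |T_n| ≥ |η|ⁿ/4 is used at the centre and |T_n| ≤ |η|ⁿ on the circle. Division by n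
  -- makes the loss log 4 disappear as n → ∞.
  have key : ∀ n : ℕ, 2 ≤ ‖eta (f c)‖ ^ n → n * Real.log ‖eta (f c)‖ ≤ n * A + Real.log 4 := by
    intro n hn
    have hT := le_norm_chebyshev (f c) n
    have hTpos : 0 < ‖(Polynomial.Chebyshev.T ℂ n).eval (f c)‖ := by linarith
    have hg : AnalyticOnNhd ℂ (fun z => (Polynomial.Chebyshev.T ℂ n).eval (f z))
        (Metric.closedBall c r) := fun z hz => by
      have := (hf z hz).aeval_polynomial (Polynomial.Chebyshev.T ℂ n)
      simpa [Polynomial.coe_aeval_eq_eval] using this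
    have h2 := log_norm_le_circleAverage hr hg (norm_pos_iff.1 hTpos)
    have h3 : Real.circleAverage (fun z => Real.log ‖(Polynomial.Chebyshev.T ℂ n).eval (f z)‖) c r
        ≤ Real.circleAverage (fun z => (n : ℝ) • Real.log ‖eta (f z)‖) c r := by
      refine Real.circleAverage_mono ?_ (hci.const_fun_smul) fun z _ => ?_
      · refine MeromorphicOn.circleIntegrable_log_norm ?_
        rw [abs_of_pos hr]
        exact (hg.mono Metric.sphere_subset_closedBall).meromorphicOn
      · rw [smul_eq_mul, ← Real.log_pow]
        -- A zero of T_n ∘ f on the circle counts with log 0 = 0, which is still at most n log|η|,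
        -- as |η| ≥ 1.
        rcases (norm_nonneg ((Polynomial.Chebyshev.T ℂ n).eval (f z))).eq_or_lt with h0 | h0
        · rw [← h0, Real.log_zero]
          exact Real.log_nonneg (one_le_pow₀ (one_le_norm_eta _))
        · exact Real.log_le_log h0 (norm_chebyshev_le _ _)
    rw [Real.circleAverage_fun_smul, smul_eq_mul] at h3
    have h4 : Real.log (‖eta (f c)‖ ^ n / 4) ≤
        Real.log ‖(Polynomial.Chebyshev.T ℂ n).eval (f c)‖ :=
      Real.log_le_log (by positivity) (by linarith)
    rw [Real.log_div (by positivity) (by norm_num), Real.log_pow] at h4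
    linarith
  by_contra hc
  push Not at hc
  have hev : ∀ᶠ n : ℕ in atTop, 2 ≤ ‖eta (f c)‖ ^ n :=
    (tendsto_pow_atTop_atTop_of_one_lt h1).eventually_ge_atTop 2
  have hev2 : ∀ᶠ n : ℕ in atTop, Real.log 4 + 1 ≤ n * (Real.log ‖eta (f c)‖ - A) :=
    (tendsto_natCast_atTop_atTop.atTop_mul_const (sub_pos.2 hc)).eventually_ge_atTop _
  obtain ⟨n, h2, h3⟩ := (hev.and hev2).exists
  have := key n h2
  linarith

theorem subharmonicOnSurface_lyapunovQ (S : Set (LyapunovSurface V)) :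
    SubharmonicOnSurface (lyapunovQ (V := V)) S := by
  intro e _
  have heq : EqOn (localRep lyapunovQ e) (fun t => Real.log ‖eta (e.fn t)‖)
      (Metric.ball 0 e.radius) := fun t ht => by
    simp only [localRep, dif_pos ht]; rfl
  constructor
  · have : ContinuousOn (localRep lyapunovQ e) (Metric.ball 0 e.radius) :=
      (continuous_log_norm_eta.comp_continuousOn e.analytic.continuousOn).congr heq
    exact this.upperSemicontinuousOn
  · intro c r hr hsub
    obtain ⟨h1, h2⟩ := log_norm_eta_le_circleAverage hr (e.analytic.mono hsub)
    have hsph : EqOn (localRep lyapunovQ e) (fun t => Real.log ‖eta (e.fn t)‖)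
        (Metric.sphere c |r|) := by
      rw [abs_of_pos hr]
      exact heq.mono (Metric.sphere_subset_closedBall.trans hsub)
    refine ⟨(circleIntegrable_congr hsph).2 h1, ?_⟩
    rw [heq (hsub (Metric.mem_closedBall_self hr.le)), Real.circleAverage_congr_sphere hsph]
    exact h2

theorem lyapunov_mem_values (ζ : LyapunovSurface V) : lyapunov ζ ∈ lyapunovValues V (proj ζ) := by
  induction ζ using Quot.ind with
  | mk x => exact x.1.mem_values x.2.1 x.2.2

theorem exists_lyapunovQ_bound (hV : IsPotential V) : ∃ C ρ : ℝ, 0 ≤ C ∧ 1 ≤ ρ ∧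
    ∀ z ν : ℂ, ρ ≤ ‖z‖ → ν ∈ lyapunovValues V z →
      abs (Real.log ‖eta ν‖ - |z.im|) ≤ C / ‖z‖ := by
  obtain ⟨C, ρ, hC, hρ, h⟩ := exists_multiplier_bound hV
  refine ⟨C, ρ, hC, hρ, fun z ν hz ⟨τ, hτ, hd, hν⟩ => ?_⟩
  rw [hν, log_norm_eta_joukowski hτ]
  exact h z τ hz hd

end

section

/-! ### Multipliers of modulus one and the spectrum -/

theorem tendsto_integral_unit_right {F : ℝ → ℝ} (hF : Integrable F) :
    Tendsto (fun n : ℕ => ∫ s in (n : ℝ)..(n + 1), F s) atTop (𝓝 0) := by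
  have h := intervalIntegral_tendsto_integral_Ioi 0 hF.integrableOn tendsto_natCast_atTop_atTop
  have h' := (h.comp (tendsto_add_atTop_nat 1)).sub h
  rw [sub_self] at h'
  refine h'.congr fun n => ?_
  simp only [Function.comp_apply, Nat.cast_add, Nat.cast_one]
  rw [intervalIntegral.integral_interval_sub_left hF.intervalIntegrable hF.intervalIntegrable]

theorem tendsto_integral_unit_left {F : ℝ → ℝ} (hF : Integrable F) :
    Tendsto (fun n : ℕ => ∫ s in (-(n + 1 : ℝ))..(-(n + 1 : ℝ) + 1), F s) atTop (𝓝 0) := by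
  refine (tendsto_integral_unit_right hF.comp_neg).congr fun n => ?_
  rw [intervalIntegral.integral_comp_neg]
  congr 1; ring

/-- Pointwise |f| ≤ ε/2 + |f|²/(2ε). This turns square integrability into the decay of means over
unit intervals that the Wronskian argument uses. -/
theorem tendsto_integral_norm_of_sq {f : ℝ → ℂ} (hc : Continuous f) {b : ℕ → ℝ}
    (h : Tendsto (fun n => ∫ s in b n..(b n + 1), ‖f s‖ ^ 2) atTop (𝓝 0)) :
    Tendsto (fun n => ∫ s in b n..(b n + 1), ‖f s‖) atTop (𝓝 0) := by
  have hle : ∀ n, b n ≤ b n + 1 := fun n => by linarith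
  rw [Metric.tendsto_atTop]
  intro ε hε
  have h1 := h.eventually (gt_mem_nhds (show (0 : ℝ) < ε ^ 2 / 2 by positivity))
  obtain ⟨n₀, hn₀⟩ := eventually_atTop.1 h1
  refine ⟨n₀, fun n hn => ?_⟩
  have h0 : 0 ≤ ∫ s in b n..(b n + 1), ‖f s‖ :=
    intervalIntegral.integral_nonneg (hle n) fun s _ => norm_nonneg _
  have h2 : ∫ s in b n..(b n + 1), ‖f s‖ ≤
      ∫ s in b n..(b n + 1), (ε / 2 + (2 * ε)⁻¹ * ‖f s‖ ^ 2) := by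
    refine intervalIntegral.integral_mono_on (hle n) (hc.norm.intervalIntegrable _ _)
      (Continuous.intervalIntegrable (by fun_prop) _ _) fun s _ => ?_
    have : ε / 2 + (2 * ε)⁻¹ * ‖f s‖ ^ 2 - ‖f s‖ = (2 * ε)⁻¹ * (ε - ‖f s‖) ^ 2 := by
      field_simp; ring
    have h4 : 0 ≤ (2 * ε)⁻¹ * (ε - ‖f s‖) ^ 2 := by positivity
    linarith
  rw [intervalIntegral.integral_add (by simp) (Continuous.intervalIntegrable (by fun_prop) _ _),
    intervalIntegral.integral_const, intervalIntegral.integral_const_mul] at h2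
  rw [Real.dist_eq, sub_zero, abs_of_nonneg h0]
  have h3 : (2 * ε)⁻¹ * ∫ s in b n..(b n + 1), ‖f s‖ ^ 2 < (2 * ε)⁻¹ * (ε ^ 2 / 2) :=
    mul_lt_mul_of_pos_left (hn₀ n hn) (by positivity)
  have h5 : (2 * ε)⁻¹ * (ε ^ 2 / 2) = ε / 4 := by field_simp; ring
  simp only [add_sub_cancel_left, one_smul] at h2
  linarith

/-- A Wronskian that is constant on `[b, b + 1]` is controlled by the mean of one of its
arguments. -/
theorem norm_wronskian_le {f f' w w' : ℝ → Fin N → ℂ} {b B : ℝ} {c : ℂ}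
    (hf : ∀ a t, HasDerivAt (fun s => f s a) (f' t a) t) (hf' : ∀ a, Continuous fun s => f' s a)
    (hw : ∀ a t, HasDerivAt (fun s => w s a) (w' t a) t) (hw' : ∀ a, Continuous fun s => w' s a)
    (hB : ∀ t a, ‖w t a‖ ≤ B) (hB' : ∀ t a, ‖w' t a‖ ≤ B)
    (hc : ∀ t ∈ Icc b (b + 1), ∑ a, (f' t a * w t a - f t a * w' t a) = c) :
    ‖c‖ / 6 ≤ 2 * B * ∑ a, ∫ s in b..(b + 1), ‖f s a‖ := by
  have hfc : ∀ a, Continuous fun s => f s a := fun a =>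
    continuous_iff_continuousAt.2 fun t => (hf a t).continuousAt
  have hwc : ∀ a, Continuous fun s => w s a := fun a =>
    continuous_iff_continuousAt.2 fun t => (hw a t).continuousAt
  -- The weight vanishes at both ends and has integral 1/6. Integrating by parts against it removes
  -- the derivative of f, which unlike f need not be controlled at infinity.
  set φ : ℝ → ℂ := fun t => ((t - b : ℝ) : ℂ) * ((b + 1 - t : ℝ) : ℂ) with hφ
  set φ' : ℝ → ℂ := fun t => ((b + 1 - t : ℝ) : ℂ) - ((t - b : ℝ) : ℂ) with hφ'
  have hφd : ∀ t, HasDerivAt φ (φ' t) t := fun t => by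
    have h1 : HasDerivAt (fun t : ℝ => ((t - b : ℝ) : ℂ)) 1 t := by
      simpa using ((hasDerivAt_id t).sub_const b).ofReal_comp
    have h2 : HasDerivAt (fun t : ℝ => ((b + 1 - t : ℝ) : ℂ)) (-1) t := by
      simpa using ((hasDerivAt_id t).const_sub (b + 1)).ofReal_comp
    have := h1.mul h2
    convert! this using 1
    simp [hφ']; ring
  have hφc : Continuous φ := by fun_prop
  have hφc' : Continuous φ' := by fun_prop
  have e1 : ∫ s in b..(b + 1), φ s * c = c / 6 := by
    rw [intervalIntegral.integral_mul_const]
    have : ∫ s in b..(b + 1), φ s = ((1 / 6 : ℝ) : ℂ) := by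
      have h1 : ∀ s, φ s = (((s - b) * (b + 1 - s) : ℝ) : ℂ) := fun s => by simp [hφ]
      simp_rw [h1]
      rw [intervalIntegral.integral_ofReal]
      congr 1
      have hd : ∀ s ∈ uIcc b (b + 1), HasDerivAt (fun s => (s - b) ^ 2 / 2 - (s - b) ^ 3 / 3)
          ((s - b) * (b + 1 - s)) s := fun s _ => by
        have h0 := (hasDerivAt_id s).sub_const b
        have := ((h0.pow 2).div_const 2).sub ((h0.pow 3).div_const 3)
        convert! this using 1
        simp; ring
      rw [intervalIntegral.integral_eq_sub_of_hasDerivAt hd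
        (Continuous.intervalIntegrable (by fun_prop) _ _)]
      norm_num
    rw [this]; push_cast; ring
  have e2 : ∀ a, ∫ s in b..(b + 1), (φ' s * (f s a * w s a) +
      φ s * (f' s a * w s a + f s a * w' s a)) = 0 := fun a => by
    have hd : ∀ s ∈ uIcc b (b + 1), HasDerivAt (fun s => φ s * (f s a * w s a))
        (φ' s * (f s a * w s a) + φ s * (f' s a * w s a + f s a * w' s a)) s := fun s _ =>
      (hφd s).mul ((hf a s).mul (hw a s))
    have := hfc a; have := hwc a; have := hf' a; have := hw' a
    rw [intervalIntegral.integral_eq_sub_of_hasDerivAt hd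
      (Continuous.intervalIntegrable (by fun_prop) _ _)]
    simp [hφ]
  have e3 : c / 6 = -∫ s in b..(b + 1), ∑ a, f s a * (φ' s * w s a + 2 * φ s * w' s a) := by
    have hi1 : ∀ a, IntervalIntegrable (fun s => φ' s * (f s a * w s a) +
        φ s * (f' s a * w s a + f s a * w' s a)) volume b (b + 1) := fun a => by
      have := hfc a; have := hwc a; have := hf' a; have := hw' a
      exact Continuous.intervalIntegrable (by fun_prop) _ _
    have hi2 : IntervalIntegrable (fun s => ∑ a, f s a * (φ' s * w s a + 2 * φ s * w' s a))
        volume b (b + 1) := by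
      refine Continuous.intervalIntegrable (continuous_finsetSum _ fun a _ => ?_) _ _
      have := hfc a; have := hwc a; have := hw' a
      fun_prop
    have e4 : ∫ s in b..(b + 1), ∑ a, (φ' s * (f s a * w s a) +
        φ s * (f' s a * w s a + f s a * w' s a)) = 0 := by
      rw [intervalIntegral.integral_finsetSum fun a _ => hi1 a]
      exact Finset.sum_eq_zero fun a _ => e2 a
    have hi3 : IntervalIntegrable (fun s => ∑ a, (φ' s * (f s a * w s a) +
        φ s * (f' s a * w s a + f s a * w' s a))) volume b (b + 1) := by
      refine Continuous.intervalIntegrable (continuous_finsetSum _ fun a _ => ?_) _ _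
      have := hfc a; have := hwc a; have := hf' a; have := hw' a
      fun_prop
    rw [← e1, ← zero_sub, ← e4, ← intervalIntegral.integral_sub hi3 hi2]
    refine intervalIntegral.integral_congr fun s hs => ?_
    rw [uIcc_of_le (by linarith)] at hs
    rw [← hc s hs, Finset.mul_sum, ← Finset.sum_sub_distrib]
    exact Finset.sum_congr rfl fun a _ => by ring
  have e5 : ‖c‖ / 6 = ‖∫ s in b..(b + 1), ∑ a, f s a * (φ' s * w s a + 2 * φ s * w' s a)‖ := by
    calc ‖c‖ / 6 = ‖-(c / 6)‖ := by rw [norm_neg, norm_div, Complex.norm_ofNat]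
      _ = _ := by rw [e3, neg_neg]
  have hsum : ∑ a, ∫ s in b..(b + 1), ‖f s a‖ = ∫ s in b..(b + 1), ∑ a, ‖f s a‖ :=
    (intervalIntegral.integral_finsetSum fun a _ =>
      (hfc a).norm.intervalIntegrable _ _).symm
  rw [e5, hsum, ← intervalIntegral.integral_const_mul]
  refine intervalIntegral.norm_integral_le_of_norm_le (by linarith)
    (Eventually.of_forall fun s hs => ?_) (Continuous.intervalIntegrable
      (continuous_const.mul (continuous_finsetSum _ fun a _ => (hfc a).norm)) _ _)
  rw [Finset.mul_sum]
  refine (norm_sum_le _ _).trans (Finset.sum_le_sum fun a _ => ?_)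
  rw [norm_mul, mul_comm]
  refine mul_le_mul_of_nonneg_right ?_ (norm_nonneg _)
  have hB0 : 0 ≤ B := (norm_nonneg _).trans (hB 0 a)
  have n1 : ‖φ' s‖ ≤ 1 := by
    rw [hφ']; simp only [← Complex.ofReal_sub, Complex.norm_real, Real.norm_eq_abs]
    rw [abs_le]; constructor <;> linarith [hs.1, hs.2]
  have n2 : ‖φ s‖ ≤ 1 / 4 := by
    rw [hφ]; simp only [← Complex.ofReal_mul, Complex.norm_real, Real.norm_eq_abs]
    rw [abs_of_nonneg (mul_nonneg (by linarith [hs.1]) (by linarith [hs.2]))]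
    nlinarith [sq_nonneg (s - b - 1 / 2)]
  calc ‖φ' s * w s a + 2 * φ s * w' s a‖ ≤ ‖φ' s‖ * ‖w s a‖ + 2 * ‖φ s‖ * ‖w' s a‖ := by
        refine (norm_add_le _ _).trans ?_
        rw [norm_mul, norm_mul, norm_mul, Complex.norm_ofNat]
    _ ≤ 1 * B + 2 * (1 / 4) * B := by
        have := hB s a; have := hB' s a
        gcongr
    _ ≤ 2 * B := by linarith

/-! ### Bloch solutions with a multiplier of modulus one -/

section Bloch

variable {μ τ : ℂ} {u u' : ℝ → Fin N → ℂ}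

theorem bloch_bounded (hτ : ‖τ‖ = 1) {v : ℝ → Fin N → ℂ} (hc : ∀ a, Continuous fun s => v s a)
    (hb : ∀ t, v (t + 1) = τ • v t) : ∃ B : ℝ, ∀ t a, ‖v t a‖ ≤ B := by
  have hvc : Continuous v := continuous_pi hc
  have hp : Function.Periodic (fun t => ‖v t‖) 1 := fun t => by
    simp only [hb t, norm_smul, hτ, one_mul]
  obtain ⟨B, hB⟩ := isCompact_Icc.bddAbove_image (hvc.norm.continuousOn (s := Icc (0 : ℝ) 1))
  refine ⟨B, fun t a => (norm_le_pi_norm _ a).trans ?_⟩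
  obtain ⟨y, hy, e⟩ := hp.exists_mem_Ico₀ one_pos t
  rw [e]
  exact hB ⟨y, Ico_subset_Icc_self hy, rfl⟩

theorem bloch_mass_pos (hu : IsEigen V μ u u') (hτ : ‖τ‖ = 1) (h0 : u 0 ≠ 0 ∨ u' 0 ≠ 0)
    (hb : ∀ t, u (t + 1) = τ • u t) :
    0 < ∫ s in (0 : ℝ)..1, ∑ a, ‖u s a‖ ^ 2 := by
  have hcont : Continuous fun s => ∑ a, ‖u s a‖ ^ 2 :=
    continuous_finsetSum _ fun a _ => (hu.continuous a).norm.pow 2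
  have hnn : ∀ s, 0 ≤ ∑ a, ‖u s a‖ ^ 2 := fun s => Finset.sum_nonneg fun a _ => by positivity
  refine intervalIntegral.integral_pos one_pos hcont.continuousOn (fun s _ => hnn s) ?_
  by_contra hall
  push Not at hall
  have hzero : ∀ t ∈ Icc (0 : ℝ) 1, u t = 0 := fun t ht => by
    have h1 := le_antisymm (hall t ht) (hnn t)
    rw [Finset.sum_eq_zero_iff_of_nonneg fun a _ => by positivity] at h1
    ext a
    simpa using h1 a (Finset.mem_univ a)
  have hp : Function.Periodic (fun t => ‖u t‖) 1 := fun t => by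
    simp only [hb t, norm_smul, hτ, one_mul]
  have hz : ∀ t, u t = 0 := fun t => by
    obtain ⟨y, hy, e⟩ := hp.exists_mem_Ico₀ one_pos t
    simp only [hzero y (Ico_subset_Icc_self hy), norm_zero] at e
    exact norm_eq_zero.1 e
  refine h0.elim (fun h => h (hz 0)) fun h => h ?_
  ext a
  have h1 := hu.deriv a 0
  rw [show (fun s => u s a) = fun _ => (0 : ℂ) from funext fun s => by rw [hz s]; rfl] at h1
  exact h1.unique (hasDerivAt_const _ _)

/-- In Lagrange's identity for u and conj u over one period the boundary terms agree because τ conj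
τ = 1; what is left is (conj μ - μ) ∫ |u|² = 0. -/
theorem bloch_real (hV : IsPotential V) (hu : IsEigen V μ u u') (hτ : ‖τ‖ = 1)
    (h0 : u 0 ≠ 0 ∨ u' 0 ≠ 0) (hb : ∀ t, u (t + 1) = τ • u t ∧ u' (t + 1) = τ • u' t) :
    starRingEnd ℂ μ = μ := by
  have hm := bloch_mass_pos hu hτ h0 fun t => (hb t).1
  have hL := hu.lagrange hV hu.conj hu.rhs hu.conj.rhs 0 1
  have hb0 := hb 0
  rw [zero_add] at hb0
  have hττ : τ * starRingEnd ℂ τ = 1 := by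
    rw [Complex.mul_conj, Complex.normSq_eq_norm_sq, hτ]; simp
  have e1 : ∑ a, (u' 1 a * starRingEnd ℂ (u 1 a) - u 1 a * starRingEnd ℂ (u' 1 a))
      = ∑ a, (u' 0 a * starRingEnd ℂ (u 0 a) - u 0 a * starRingEnd ℂ (u' 0 a)) := by
    refine Finset.sum_congr rfl fun a _ => ?_
    rw [hb0.1, hb0.2]
    simp only [Pi.smul_apply, smul_eq_mul, map_mul]
    linear_combination (u' 0 a * starRingEnd ℂ (u 0 a) - u 0 a * starRingEnd ℂ (u' 0 a)) * hττ
  rw [e1, sub_self] at hL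
  have e2 : ∫ s in (0 : ℝ)..1, ∑ a, (u s a * (starRingEnd ℂ μ • fun a => starRingEnd ℂ (u s a)) a -
      (μ • u s) a * starRingEnd ℂ (u s a))
      = (starRingEnd ℂ μ - μ) * ((∫ s in (0 : ℝ)..1, ∑ a, ‖u s a‖ ^ 2 : ℝ) : ℂ) := by
    rw [← intervalIntegral.integral_ofReal, ← intervalIntegral.integral_const_mul]
    refine intervalIntegral.integral_congr fun s _ => ?_
    simp only [Pi.smul_apply, smul_eq_mul]
    push_cast
    rw [Finset.mul_sum]
    refine Finset.sum_congr rfl fun a _ => ?_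
    have : u s a * starRingEnd ℂ (u s a) = (‖u s a‖ : ℂ) ^ 2 := Complex.mul_conj' _
    linear_combination (starRingEnd ℂ μ - μ) * this
  rw [e2] at hL
  rcases mul_eq_zero.1 hL.symm with h | h
  · exact sub_eq_zero.1 h
  · exact absurd (Complex.ofReal_eq_zero.1 h) hm.ne'

theorem OperatorGraph.exists_isSolution (hV : IsPotential V) {f h : ℝ → Fin N → ℂ}
    (hf : OperatorGraph V f h) (hh : ∀ a c d, IntervalIntegrable (fun s => h s a) volume c d) :
    ∃ f', IsSolution V h f f' := by
  obtain ⟨-, -, f', hd, hi⟩ := hf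
  have hd' : ∀ a t, HasDerivAt (fun s => f s a) (f' t a) t := fun a t =>
    hasDerivAt_pi.1 (hd t) a
  have hc : ∀ a, Continuous fun s => f s a := fun a =>
    continuous_iff_continuousAt.2 fun t => (hd' a t).continuousAt
  have e : ∀ s a, (((V s).map (fun x : ℝ => (x : ℂ))).mulVec (f s) - h s) a
      = (∑ c, (V s a c : ℂ) * f s c) - h s a := fun s a => by
    simp [Matrix.mulVec, dotProduct]
  refine ⟨f', hd', fun a t => ?_⟩
  have hint : IntervalIntegrable (fun s => ((V s).map (fun x : ℝ => (x : ℂ))).mulVec (f s) - h s)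
      volume 0 t := by
    refine intervalIntegrable_pi fun b => ?_
    simp only [e]
    refine IntervalIntegrable.sub ?_ (hh b 0 t)
    have := IntervalIntegrable.sum Finset.univ fun c _ =>
      (hV.intervalIntegrable b c 0 t).mul_continuousOn (hc c).continuousOn
    rwa [show (fun s => ∑ c, (V s b c : ℂ) * f s c) = ∑ c, fun s => (V s b c : ℂ) * f s c from by
      ext s; simp]
  have := congrFun (hi t) a
  rw [Pi.add_apply, intervalIntegral_apply hint] at this
  simpa only [e] using this

/-- The square of a point with a multiplier of modulus one lies in the spectrum. -/
theorem bloch_mem_spectrum (hV : IsPotential V) (hu : IsEigen V μ u u') (hτ : ‖τ‖ = 1)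
    (h0 : u 0 ≠ 0 ∨ u' 0 ≠ 0) (hb : ∀ t, u (t + 1) = τ • u t ∧ u' (t + 1) = τ • u' t) :
    μ ∈ operatorSpectrum V := by
  intro hall
  have hμ := bloch_real hV hu hτ h0 hb
  have hm := bloch_mass_pos hu hτ h0 fun t => (hb t).1
  have huc : Continuous u := continuous_pi hu.continuous
  obtain ⟨B₁, hB₁⟩ := bloch_bounded hτ hu.continuous fun t => (hb t).1
  obtain ⟨B₂, hB₂⟩ := bloch_bounded hτ (hu.continuous' hV hu.rhs) fun t => (hb t).2
  -- The right-hand side is u cut off to one period. If (L - μ) f = g with f in L², the Wronskian of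
  -- f and conj u is constant on (-∞, 0] and on [1, ∞) and drops by ∫ |u|² > 0 in between. Since u
  -- and u' are bounded and f is in L², both constants must be zero, a contradiction.
  set g : ℝ → Fin N → ℂ := (Ioc (0 : ℝ) 1).indicator u with hg
  have hgL : MemLp g 2 volume := by
    rw [hg, memLp_indicator_iff_restrict measurableSet_Ioc]
    refine MemLp.of_bound huc.aestronglyMeasurable (max B₁ 0)
      (Eventually.of_forall fun s => ?_)
    exact (pi_norm_le_iff_of_nonneg (le_max_right _ _)).2 fun a =>
      (hB₁ s a).trans (le_max_left _ _)
  obtain ⟨f, hf, -⟩ := hall g hgL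
  have hfc : Continuous f := by
    obtain ⟨-, -, f', hd, -⟩ := hf
    exact continuous_iff_continuousAt.2 fun t => (hd t).continuousAt
  have hga : ∀ a, (fun s => g s a) = (Ioc (0 : ℝ) 1).indicator fun s => u s a := fun a => by
    ext s; simp only [hg, indicator]; split_ifs <;> rfl
  have hgi : ∀ a c d, IntervalIntegrable (fun s => g s a) volume c d := fun a c d => by
    rw [hga]
    have h := (hu.continuous a).intervalIntegrable (μ := volume) c d
    exact ⟨h.1.indicator measurableSet_Ioc, h.2.indicator measurableSet_Ioc⟩
  have hhi : ∀ a c d, IntervalIntegrable (fun s => (g + μ • f) s a) volume c d := fun a c d => by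
    refine (hgi a c d).add ?_
    exact ((continuous_const.mul ((continuous_apply a).comp hfc)).intervalIntegrable _ _)
  obtain ⟨f', hs⟩ := hf.exists_isSolution hV hhi
  set W : ℝ → ℂ := fun t => ∑ a, (f' t a * starRingEnd ℂ (u t a) -
    f t a * starRingEnd ℂ (u' t a)) with hW
  have hWd : ∀ c d, W d - W c = -∫ s in c..d, ∑ a, g s a * starRingEnd ℂ (u s a) := fun c d => by
    have h1 := hs.lagrange hV hu.conj hhi hu.conj.rhs c d
    rw [hW]
    simp only
    rw [h1, ← intervalIntegral.integral_neg]
    refine intervalIntegral.integral_congr fun s _ => ?_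
    simp only [Pi.smul_apply, Pi.add_apply, smul_eq_mul, hμ]
    rw [← Finset.sum_neg_distrib]
    exact Finset.sum_congr rfl fun a _ => by ring
  have hright : ∀ t, 1 ≤ t → W t = W 1 := fun t ht => by
    rw [← sub_eq_zero, hWd, neg_eq_zero]
    refine intervalIntegral.integral_zero_ae (Eventually.of_forall fun s hs => ?_)
    rw [uIoc_of_le ht] at hs
    refine Finset.sum_eq_zero fun a _ => ?_
    have : g s = 0 := indicator_of_notMem (fun h => absurd h.2 (not_le.2 hs.1)) _
    simp [this]
  have hleft : ∀ t, t ≤ 0 → W t = W 0 := fun t ht => by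
    rw [← sub_eq_zero, hWd, neg_eq_zero]
    refine intervalIntegral.integral_zero_ae (Eventually.of_forall fun s hs => ?_)
    rw [uIoc_of_ge ht] at hs
    refine Finset.sum_eq_zero fun a _ => ?_
    have : g s = 0 := indicator_of_notMem (fun h => absurd h.1 (not_lt.2 hs.2)) _
    simp [this]
  have hmid : W 1 - W 0 = -((∫ s in (0 : ℝ)..1, ∑ a, ‖u s a‖ ^ 2 : ℝ) : ℂ) := by
    rw [hWd, ← intervalIntegral.integral_ofReal]
    congr 1
    refine intervalIntegral.integral_congr_ae (Eventually.of_forall fun s hs => ?_)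
    rw [uIoc_of_le zero_le_one] at hs
    push_cast
    refine Finset.sum_congr rfl fun a _ => ?_
    rw [show g s = u s from indicator_of_mem hs _]
    exact Complex.mul_conj' _
  have hfL : ∀ a, Integrable fun s => ‖f s a‖ ^ 2 := fun a => by
    have h1 : MemLp (fun s => f s a) 2 volume := hf.1.eval a
    exact (memLp_two_iff_integrable_sq_norm h1.aestronglyMeasurable).1 h1
  set B := max B₁ B₂
  have hconst : ∀ (b : ℝ) (c : ℂ), (∀ t ∈ Icc b (b + 1), W t = c) →
      ‖c‖ / 6 ≤ 2 * B * ∑ a, ∫ s in b..(b + 1), ‖f s a‖ := fun b c hc =>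
    norm_wronskian_le hs.deriv (hs.continuous' hV hhi) hu.conj.deriv
      (hu.conj.continuous' hV hu.conj.rhs)
      (fun t a => by rw [RCLike.norm_conj]; exact (hB₁ t a).trans (le_max_left _ _))
      (fun t a => by rw [RCLike.norm_conj]; exact (hB₂ t a).trans (le_max_right _ _)) hc
  have lim : ∀ (b : ℕ → ℝ), (∀ a, Tendsto (fun n => ∫ s in b n..(b n + 1), ‖f s a‖ ^ 2) atTop
      (𝓝 0)) → ∀ c : ℂ, (∀ n, 1 ≤ n → ∀ t ∈ Icc (b n) (b n + 1), W t = c) → c = 0 := by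
    intro b hb c hc
    have h1 : Tendsto (fun n => 2 * B * ∑ a, ∫ s in b n..(b n + 1), ‖f s a‖) atTop
        (𝓝 (2 * B * ∑ _a : Fin N, 0)) :=
      (tendsto_finsetSum _ fun a _ => tendsto_integral_norm_of_sq (hs.continuous a)
        (hb a)).const_mul _
    rw [Finset.sum_const_zero, mul_zero] at h1
    have h2 := ge_of_tendsto h1 (eventually_atTop.2 ⟨1, fun n hn => hconst (b n) c (hc n hn)⟩)
    have h3 : ‖c‖ ≤ 0 := by linarith
    exact norm_le_zero_iff.1 h3
  have hW1 : W 1 = 0 := lim (fun n => n) (fun a => tendsto_integral_unit_right (hfL a)) _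
    fun n hn t ht => hright t (le_trans (by exact_mod_cast hn) ht.1)
  have hW0 : W 0 = 0 := lim (fun n => -(n + 1 : ℝ)) (fun a => tendsto_integral_unit_left (hfL a)) _
    fun n hn t ht => hleft t (ht.2.trans (by simp))
  rw [hW1, hW0, sub_self, eq_comm, neg_eq_zero, Complex.ofReal_eq_zero] at hmid
  exact hm.ne' hmid

end Bloch

/-- Here the normalization of the spectrum enters: z² is real and at least 0, whereas a nonreal z
with real square has z² < 0. -/
theorem im_eq_zero_of_norm_eq_one (hV : IsPotential V)
    (hbottom : IsLeast {μ : ℝ | (μ : ℂ) ∈ operatorSpectrum V} 0) {z τ : ℂ}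
    (hd : charDet V τ z = 0) (hτ : ‖τ‖ = 1) : z.im = 0 := by
  obtain ⟨u, u', hu, h0, hb⟩ := exists_bloch hV hd
  have hr := bloch_real hV hu hτ h0 hb
  have hs := bloch_mem_spectrum hV hu hτ h0 hb
  have e : (((z ^ 2).re : ℝ) : ℂ) = z ^ 2 := Complex.conj_eq_iff_re.1 hr
  have h1 : 0 ≤ (z ^ 2).re := hbottom.2 (by rw [mem_ofPred_eq, e]; exact hs)
  have h2 : (z ^ 2).im = 0 := by rw [← e]; simp
  rw [sq, Complex.mul_re] at h1
  rw [sq, Complex.mul_im] at h2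
  by_contra hne
  have h3 : z.re = 0 := by
    have : z.re * z.im = 0 := by linarith
    exact (mul_eq_zero.1 this).resolve_right hne
  rw [h3] at h1
  have := mul_self_pos.2 hne
  linarith

/-- The Lyapunov function avoids `[-1, 1]` off the real line. -/
theorem not_inBand (hV : IsPotential V)
    (hbottom : IsLeast {μ : ℝ | (μ : ℂ) ∈ operatorSpectrum V} 0) {z ν : ℂ}
    (hν : ν ∈ lyapunovValues V z) (hz : z.im ≠ 0) : ¬ InBand ν := by
  obtain ⟨τ, hτ, hd, rfl⟩ := hν
  intro hband
  have h1 := log_norm_eta_joukowski hτ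
  rw [(norm_eta_eq_one_iff _).2 hband, Real.log_one, eq_comm, abs_eq_zero] at h1
  refine hz (im_eq_zero_of_norm_eq_one hV hbottom hd ?_)
  rw [← Real.exp_log (norm_pos_iff.2 hτ), h1, Real.exp_zero]

end

section

/-! ### Simple parametrization of the eigenvalues of an entire matrix function -/

section TracePowers

variable {ι : Type*} [Fintype ι] [DecidableEq ι]

open Module.End in
-- On a generalized eigenspace f - μ is nilpotent and commutes with the powers of f, so that each
-- factor f contributes a factor μ to the trace.
theorem trace_pow_restrict {W : Type*} [AddCommGroup W] [Module ℂ W] [FiniteDimensional ℂ W]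
    (f : Module.End ℂ W) (μ : ℂ) (k : ℕ) (h : MapsTo (f ^ k) (f.maxGenEigenspace μ)
      (f.maxGenEigenspace μ)) :
    LinearMap.trace ℂ _ ((f ^ k).restrict h) =
      (Module.finrank ℂ (f.maxGenEigenspace μ) : ℂ) * μ ^ k := by
  induction k with
  | zero =>
    have e : (f ^ 0).restrict h = 1 := LinearMap.ext fun _ => rfl
    rw [e, LinearMap.trace_one, pow_zero, mul_one]
  | succ k ih =>
    have hc : Commute f (f ^ k) := Commute.self_pow f k
    have hf' := f.mapsTo_maxGenEigenspace_of_comm (Commute.refl f) μ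
    have hg' := f.mapsTo_maxGenEigenspace_of_comm hc μ
    have hcomm : Commute ((f ^ k).restrict hg') (f.restrict hf') :=
      LinearMap.restrict_commute hc.symm _ _
    have hn := f.isNilpotent_restrict_maxGenEigenspace_sub_algebraMap μ
    have e : (f ^ (k + 1)).restrict h = (f ^ k).restrict hg' ∘ₗ f.restrict hf' := by
      refine LinearMap.ext fun x => Subtype.ext ?_
      change (f ^ (k + 1)) (x : W) = (f ^ k) (f x)
      rw [pow_succ, Module.End.mul_apply]
    rw [e, LinearMap.trace_comp_eq_mul_of_commute_of_isNilpotent μ hcomm hn, ih hg']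
    ring

theorem maxGenEigenspace_ne_bot_iff (A : Matrix ι ι ℂ) (μ : ℂ) :
    Module.End.maxGenEigenspace (Matrix.toLin' A) μ ≠ ⊥ ↔ (A - μ • (1 : Matrix ι ι ℂ)).det = 0 := by
  have h1 : Module.End.maxGenEigenspace (Matrix.toLin' A) μ ≠ ⊥ ↔
      Module.End.HasEigenvalue (Matrix.toLin' A) μ :=
    Module.End.hasUnifEigenvalue_iff_hasUnifEigenvalue_one (k := ⊤) (by simp)
  rw [h1, Module.End.hasEigenvalue_iff_mem_spectrum, Matrix.spectrum_toLin', spectrum.mem_iff,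
    Matrix.isUnit_iff_isUnit_det, isUnit_iff_ne_zero, not_ne_iff, Algebra.algebraMap_eq_smul_one,
    ← neg_sub, Matrix.det_neg]
  simp

/-- The weights are the algebraic multiplicities; the Hankel argument needs only that they are
nonzero. -/
theorem exists_trace_pow (A : Matrix ι ι ℂ) :
    ∃ (s : Finset ℂ) (m : ℂ → ℂ), (∀ ν, ν ∈ s ↔ (A - ν • (1 : Matrix ι ι ℂ)).det = 0) ∧
      (∀ ν ∈ s, m ν ≠ 0) ∧ ∀ k, (A ^ k).trace = ∑ ν ∈ s, m ν * ν ^ k := by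
  classical
  set f : Module.End ℂ (ι → ℂ) := Matrix.toLin' A with hf
  have hds := DirectSum.isInternal_submodule_of_iSupIndep_of_iSup_eq_top
    f.independent_maxGenEigenspace (Module.End.iSup_maxGenEigenspace_eq_top f)
  have hfin : {μ | f.maxGenEigenspace μ ≠ ⊥}.Finite :=
    WellFoundedGT.finite_ne_bot_of_iSupIndep f.independent_maxGenEigenspace
  refine ⟨hfin.toFinset, fun μ => Module.finrank ℂ (f.maxGenEigenspace μ), fun ν => ?_,
    fun ν hν => ?_, fun k => ?_⟩
  · rw [hfin.mem_toFinset, mem_ofPred_eq, hf, maxGenEigenspace_ne_bot_iff]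
  · rw [hfin.mem_toFinset] at hν
    rw [Nat.cast_ne_zero]
    exact fun h => hν (Submodule.finrank_eq_zero.1 h)
  · rw [← Matrix.trace_toLin'_eq, Matrix.toLin'_pow,
      LinearMap.trace_eq_sum_trace_restrict' hds hfin fun μ =>
        f.mapsTo_maxGenEigenspace_of_comm (Commute.self_pow f k) μ]
    exact Finset.sum_congr rfl fun μ _ => trace_pow_restrict f μ k _

/-- The Hankel matrix of the power sums `Σ m ν^k`. -/
def hankel (p : ℕ) (s : Finset ℂ) (m : ℂ → ℂ) : Matrix (Fin p) (Fin p) ℂ :=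
  Matrix.of fun i j => ∑ ν ∈ s, m ν * ν ^ (i + j : ℕ)

/-- The Hankel matrix factors through the space of functions on s, which bounds its rank. Together
with `det_hankel_ne_zero`, a p × p determinant with p the largest possible number of nodes detects
exactly the sets with p nodes. -/
theorem le_card_of_det_hankel_ne_zero {p : ℕ} {s : Finset ℂ} {m : ℂ → ℂ}
    (h : (hankel p s m).det ≠ 0) : p ≤ s.card := by
  have e : hankel p s m = (Matrix.of fun (i : Fin p) (ν : s) => m ν * (ν : ℂ) ^ (i : ℕ)) *
      Matrix.of fun (ν : s) (j : Fin p) => (ν : ℂ) ^ (j : ℕ) := by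
    ext i j
    simp only [hankel, Matrix.of_apply, Matrix.mul_apply, pow_add, mul_assoc]
    exact (Finset.sum_coe_sort s fun ν => m ν * (ν ^ (i : ℕ) * ν ^ (j : ℕ))).symm
  have h1 : (hankel p s m).rank = p := by
    rw [Matrix.rank_of_isUnit _ ((Matrix.isUnit_iff_isUnit_det _).2 h.isUnit), Fintype.card_fin]
  calc p = (hankel p s m).rank := h1.symm
    _ ≤ _ := by rw [e]; exact Matrix.rank_mul_le_left _ _
    _ ≤ Fintype.card s := Matrix.rank_le_card_width _
    _ = s.card := Fintype.card_coe s

theorem det_hankel_ne_zero {s : Finset ℂ} {m : ℂ → ℂ} (hm : ∀ ν ∈ s, m ν ≠ 0) :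
    (hankel s.card s m).det ≠ 0 := by
  set v : Fin s.card → ℂ := fun l => (s.equivFin.symm l : ℂ) with hv
  have hvi : Function.Injective v := Subtype.val_injective.comp s.equivFin.symm.injective
  have e : hankel s.card s m =
      (Matrix.vandermonde v).transpose * Matrix.diagonal (fun l => m (v l)) *
        Matrix.vandermonde v := by
    ext i j
    rw [Matrix.mul_apply]
    simp only [Matrix.mul_diagonal, Matrix.transpose_apply, Matrix.vandermonde_apply, hankel,
      Matrix.of_apply]
    rw [← Finset.sum_coe_sort, ← s.equivFin.symm.sum_comp]
    exact Finset.sum_congr rfl fun l _ => by rw [pow_add]; ring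
  rw [e, Matrix.det_mul, Matrix.det_mul, Matrix.det_transpose, Matrix.det_diagonal]
  refine mul_ne_zero (mul_ne_zero ?_ ?_) ?_
  · exact Matrix.det_vandermonde_ne_zero_iff.2 hvi
  · exact Finset.prod_ne_zero_iff.2 fun l _ => hm _ (s.equivFin.symm l).2
  · exact Matrix.det_vandermonde_ne_zero_iff.2 hvi

open Polynomial in
-- Each node is a root of the nodal polynomial; weighting these equations with m ν · νⁱ and summing
-- gives a linear system for the lower coefficients in terms of power sums. By Cramer's rule the
-- determinant times each coefficient is then a polynomial in the power sums.
theorem hankel_mulVec_coeff (s : Finset ℂ) (m : ℂ → ℂ) :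
    (hankel s.card s m).mulVec (fun j => (Lagrange.nodal s id).coeff j) =
      fun i : Fin s.card => -∑ ν ∈ s, m ν * ν ^ ((i : ℕ) + s.card) := by
  ext i
  have h0 : ∀ ν ∈ s, ∑ j : Fin s.card, (Lagrange.nodal s id).coeff j * ν ^ (j : ℕ) =
      -ν ^ s.card := fun ν hν => by
    have h1 := Lagrange.eval_nodal_at_node (v := id) hν
    rw [eval_eq_sum_range, Lagrange.natDegree_nodal, Finset.sum_range_succ,
      ← Lagrange.natDegree_nodal (s := s) (v := (id : ℂ → ℂ)),
      (Lagrange.nodal_monic (s := s) (v := (id : ℂ → ℂ))).coeff_natDegree, one_mul,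
      Lagrange.natDegree_nodal] at h1
    rw [Fin.sum_univ_eq_sum_range fun j => (Lagrange.nodal s id).coeff j * ν ^ j]
    exact eq_neg_of_add_eq_zero_left h1
  simp only [Matrix.mulVec, dotProduct, hankel, Matrix.of_apply, Finset.sum_mul]
  rw [Finset.sum_comm, ← Finset.sum_neg_distrib]
  refine Finset.sum_congr rfl fun ν hν => ?_
  calc _ = m ν * ν ^ (i : ℕ) *
        ∑ j : Fin s.card, (Lagrange.nodal s id).coeff j * ν ^ (j : ℕ) := by
        rw [Finset.mul_sum]
        exact Finset.sum_congr rfl fun j _ => by rw [pow_add]; ring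
    _ = _ := by rw [h0 ν hν, pow_add]; ring

theorem differentiable_det {A : ℂ → Matrix ι ι ℂ}
    (hA : ∀ i j, Differentiable ℂ fun z => A z i j) : Differentiable ℂ fun z => (A z).det := by
  simp only [Matrix.det_apply]
  exact Differentiable.fun_sum fun σ _ => (Differentiable.fun_finsetProd fun i _ => hA _ _).const_smul _

theorem differentiable_adjugate {A : ℂ → Matrix ι ι ℂ}
    (hA : ∀ i j, Differentiable ℂ fun z => A z i j) (i j : ι) :
    Differentiable ℂ fun z => (A z).adjugate i j := by
  simp only [Matrix.adjugate_apply]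
  refine differentiable_det fun a b => ?_
  simp only [Matrix.updateRow_apply]
  split_ifs
  exacts [differentiable_const _, hA a b]

theorem differentiable_trace_pow {A : ℂ → Matrix ι ι ℂ}
    (hA : ∀ i j, Differentiable ℂ fun z => A z i j) (k : ℕ) :
    Differentiable ℂ fun z => (A z ^ k).trace := by
  have h : ∀ i j, Differentiable ℂ fun z => (A z ^ k) i j := by
    induction k with
    | zero => intro i j; simp only [pow_zero]; exact differentiable_const _
    | succ k ih =>
      intro i j
      simp only [pow_succ, Matrix.mul_apply]
      exact Differentiable.fun_sum fun l _ => (ih i l).mul (hA l j)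
  simp only [Matrix.trace, Matrix.diag_apply]
  exact Differentiable.fun_sum fun i _ => h i i

/-- The zeros of the entire function `δ` contain all the points near which the eigenvalues of the
entire matrix function `A` are not given by disjoint graphs of analytic functions. -/
structure IsRegularizer (A : ℂ → Matrix ι ι ℂ) (δ : ℂ → ℂ) : Prop where
  differentiable : Differentiable ℂ δ
  exists_ne_zero : ∃ z, δ z ≠ 0
  exists_root : ∀ z₀, δ z₀ ≠ 0 → ∀ ν₀, (A z₀ - ν₀ • (1 : Matrix ι ι ℂ)).det = 0 →
    ∃ g : ℂ → ℂ, AnalyticAt ℂ g z₀ ∧ g z₀ = ν₀ ∧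
      ∀ᶠ q : ℂ × ℂ in 𝓝 (z₀, ν₀), (A q.1 - q.2 • (1 : Matrix ι ι ℂ)).det = 0 ↔ g q.1 = q.2

open scoped ContDiff in
theorem exists_analyticAt_of_deriv_ne_zero {R : ℂ × ℂ → ℂ} {z₀ ν₀ d : ℂ}
    (hR : ContDiffAt ℂ ω R (z₀, ν₀)) (h0 : R (z₀, ν₀) = 0)
    (hd : HasDerivAt (fun ν => R (z₀, ν)) d ν₀) (hne : d ≠ 0) :
    ∃ g : ℂ → ℂ, AnalyticAt ℂ g z₀ ∧ g z₀ = ν₀ ∧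
      ∀ᶠ q : ℂ × ℂ in 𝓝 (z₀, ν₀), R q = 0 ↔ g q.1 = q.2 := by
  have hd' : fderiv ℂ R (z₀, ν₀) (0, 1) = d := by
    have h1 := (hR.differentiableAt (by simp)).hasFDerivAt
    have h2 : HasDerivAt (fun ν : ℂ => (z₀, ν)) ((0 : ℂ), (1 : ℂ)) ν₀ :=
      (hasDerivAt_const ν₀ z₀).prodMk (hasDerivAt_id ν₀)
    exact (h1.comp_hasDerivAt ν₀ h2).unique hd
  have hinv : (fderiv ℂ R (z₀, ν₀) ∘L .inr ℂ ℂ ℂ).IsInvertible := by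
    refine ⟨ContinuousLinearEquiv.unitsEquivAut ℂ (Units.mk0 d hne), ?_⟩
    ext
    simp [← hd']
  refine ⟨hR.implicitFunction (by simp) hinv, ?_, hR.implicitFunction_apply_self (by simp) hinv, ?_⟩
  · exact (hR.contDiffAt_implicitFunction (by simp) hinv).analyticAt
  · have := hR.eventually_apply_eq_iff_implicitFunction (by simp) hinv
    rwa [h0] at this

open Polynomial in
-- Let p be the largest number of distinct eigenvalues at any point, and δ the p × p Hankel
-- determinant of the traces of powers. Where δ ≠ 0 there are exactly p distinct eigenvalues. They
-- are the simple roots of R = δ · ∏ (ν - ν_l), whose coefficients are entire by Cramer's rule, so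
-- the implicit function theorem applies. The discriminant of the characteristic polynomial would
-- not do: it may vanish identically, and in L both τ and τ⁻¹ give the same eigenvalue.
theorem exists_isRegularizer {A : ℂ → Matrix ι ι ℂ}
    (hA : ∀ i j, Differentiable ℂ fun z => A z i j) : ∃ δ, IsRegularizer A δ := by
  choose s m hs hm htr using fun z => exists_trace_pow (A z)
  have hcard : ∀ z, (s z).card ≤ Fintype.card ι := fun z => by
    have hsub : s z ⊆ (A z).charpoly.roots.toFinset := fun ν hν => by
      rw [Multiset.mem_toFinset, mem_roots (A z).charpoly_monic.ne_zero, IsRoot,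
        Matrix.eval_charpoly, ← neg_sub, Matrix.det_neg, Matrix.scalar_apply,
        ← Matrix.smul_one_eq_diagonal, (hs z ν).1 hν, mul_zero]
    calc (s z).card ≤ _ := Finset.card_le_card hsub
      _ ≤ Multiset.card (A z).charpoly.roots := Multiset.toFinset_card_le _
      _ ≤ (A z).charpoly.natDegree := card_roots' _
      _ = _ := (A z).charpoly_natDegree_eq_dim
  obtain ⟨z₁, hz₁⟩ : ∃ z₁, ∀ z, (s z).card ≤ (s z₁).card := by
    have hfin : (range fun z => (s z).card).Finite :=
      (finite_Iic (Fintype.card ι)).subset (range_subset_iff.2 hcard)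
    obtain ⟨_, ⟨z₁, rfl⟩, h⟩ := hfin.exists_maximal (range_nonempty _)
    exact ⟨z₁, fun z => (le_total (s z).card (s z₁).card).elim id fun h' => h ⟨z, rfl⟩ h'⟩
  set p := (s z₁).card with hp
  set H : ℂ → Matrix (Fin p) (Fin p) ℂ :=
    fun z => Matrix.of fun i j => (A z ^ (i + j : ℕ)).trace with hH
  have hHs : ∀ z, H z = hankel p (s z) (m z) := fun z => by
    ext i j
    simp only [hH, hankel, Matrix.of_apply, htr]
  have hHd : ∀ i j, Differentiable ℂ fun z => H z i j := fun i j => differentiable_trace_pow hA _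
  set b : Fin p → ℂ → ℂ := fun i z =>
    ∑ j, (H z).adjugate i j * -(A z ^ ((j : ℕ) + p)).trace with hb
  have hbd : ∀ i, Differentiable ℂ (b i) := fun i => Differentiable.fun_sum fun j _ =>
    (differentiable_adjugate hHd i j).mul (differentiable_trace_pow hA _).neg
  have hδ : Differentiable ℂ fun z => (H z).det := differentiable_det hHd
  set R : ℂ × ℂ → ℂ := fun q => (H q.1).det * q.2 ^ p + ∑ i, b i q.1 * q.2 ^ (i : ℕ) with hR
  have hRs : ∀ z, (H z).det ≠ 0 → ∀ ν, R (z, ν) =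
      (H z).det * (Lagrange.nodal (s z) id).eval ν := fun z hz ν => by
    have hc : (s z).card = p := le_antisymm (hz₁ z) (le_card_of_det_hankel_ne_zero (hHs z ▸ hz))
    have h1 : ∀ i : Fin p, b i z = (H z).det * (Lagrange.nodal (s z) id).coeff i := by
      have h2 := hankel_mulVec_coeff (s z) (m z)
      rw [hc, ← hHs] at h2
      have h3 := congrArg (H z).adjugate.mulVec h2
      rw [Matrix.mulVec_mulVec, Matrix.adjugate_mul, Matrix.smul_mulVec, Matrix.one_mulVec] at h3
      intro i
      have h4 := congrFun h3 i
      rw [Pi.smul_apply, smul_eq_mul] at h4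
      rw [h4]
      simp only [hb, Matrix.mulVec, dotProduct, htr]
    have h5 : (Lagrange.nodal (s z) (id : ℂ → ℂ)).natDegree = p := by
      rw [Lagrange.natDegree_nodal, hc]
    have h6 := (Lagrange.nodal_monic (s := s z) (v := (id : ℂ → ℂ))).coeff_natDegree
    rw [h5] at h6
    rw [eval_eq_sum_range, h5, Finset.sum_range_succ, h6, one_mul, mul_add, Finset.mul_sum,
      ← Fin.sum_univ_eq_sum_range fun j =>
        (H z).det * ((Lagrange.nodal (s z) id).coeff j * ν ^ j), add_comm]
    simp only [hR, h1, mul_assoc]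
  refine ⟨fun z => (H z).det, hδ, ⟨z₁, ?_⟩, fun z₀ hz₀ ν₀ hν₀ => ?_⟩
  · rw [hHs]
    exact det_hankel_ne_zero (hm z₁)
  have hroot : ∀ z, (H z).det ≠ 0 → ∀ ν,
      R (z, ν) = 0 ↔ (A z - ν • (1 : Matrix ι ι ℂ)).det = 0 := fun z hz ν => by
    rw [hRs z hz, mul_eq_zero, or_iff_right hz, ← hs, Lagrange.eval_nodal, Finset.prod_eq_zero_iff]
    simp only [id, sub_eq_zero, exists_eq_right']
  have hd : HasDerivAt (fun ν => R (z₀, ν))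
      ((H z₀).det * (derivative (Lagrange.nodal (s z₀) id)).eval ν₀) ν₀ := by
    rw [show (fun ν => R (z₀, ν)) = fun ν => (H z₀).det * (Lagrange.nodal (s z₀) id).eval ν from
      funext (hRs z₀ hz₀)]
    exact (Polynomial.hasDerivAt _ _).const_mul _
  have hne : (derivative (Lagrange.nodal (s z₀) (id : ℂ → ℂ))).eval ν₀ ≠ 0 := by
    have := Lagrange.eval_nodal_derivative_eval_node_eq (v := (id : ℂ → ℂ)) ((hs z₀ ν₀).2 hν₀)
    rw [id, Lagrange.eval_nodal] at this
    rw [this]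
    refine Finset.prod_ne_zero_iff.2 fun x hx => ?_
    exact sub_ne_zero.2 (Finset.ne_of_mem_erase hx).symm
  have hRc : ContDiff ℂ ⊤ R := by
    have h1 : ContDiff ℂ ⊤ fun q : ℂ × ℂ => (H q.1).det := hδ.contDiff.comp contDiff_fst
    have h2 : ∀ i, ContDiff ℂ ⊤ fun q : ℂ × ℂ => b i q.1 := fun i =>
      (hbd i).contDiff.comp contDiff_fst
    exact (h1.mul (contDiff_snd.pow _)).add
      (ContDiff.sum fun i _ => (h2 i).mul (contDiff_snd.pow _))
  obtain ⟨g, hg, hg0, hgR⟩ := exists_analyticAt_of_deriv_ne_zero hRc.contDiffAt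
    ((hroot z₀ hz₀ ν₀).2 hν₀) hd (mul_ne_zero hz₀ hne)
  refine ⟨g, hg, hg0, ?_⟩
  have hev : ∀ᶠ q : ℂ × ℂ in 𝓝 (z₀, ν₀), (H q.1).det ≠ 0 :=
    (hδ.continuous.comp continuous_fst).continuousAt.eventually_ne hz₀
  filter_upwards [hgR, hev] with q h1 h2
  rw [← hroot q.1 h2]
  exact h1

end TracePowers

end

section

/-! ### Branch points and the cut half planes -/

section Regular

variable {ι : Type*} [Fintype ι] [DecidableEq ι] {A : ℂ → Matrix ι ι ℂ} {δ : ℂ → ℂ}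

theorem IsRegularizer.eventually_ne (hδ : IsRegularizer A δ) (z : ℂ) :
    ∀ᶠ w in 𝓝[≠] z, δ w ≠ 0 := by
  have ha : AnalyticOnNhd ℂ δ univ := hδ.differentiable.differentiableOn.analyticOnNhd isOpen_univ
  rcases (ha z (mem_univ z)).eventually_eq_zero_or_eventually_ne_zero with h | h
  · obtain ⟨w, hw⟩ := hδ.exists_ne_zero
    exact absurd (ha.eqOn_zero_of_preconnected_of_eventuallyEq_zero isPreconnected_univ
      (mem_univ z) h (mem_univ w)) hw
  · exact h

end Regular

variable {δ : ℂ → ℂ}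

theorem IsRegularizer.exists_lyapunov_root (hV : IsPotential V)
    (hδ : IsRegularizer (lyapunovMatrix V) δ) {z₀ ν₀ : ℂ} (hz : δ z₀ ≠ 0)
    (hν : ν₀ ∈ lyapunovValues V z₀) :
    ∃ g : ℂ → ℂ, AnalyticAt ℂ g z₀ ∧ g z₀ = ν₀ ∧
      (∀ᶠ q : ℂ × ℂ in 𝓝 (z₀, ν₀), q.2 ∈ lyapunovValues V q.1 ↔ g q.1 = q.2) ∧
      ∀ᶠ z in 𝓝 z₀, g z ∈ lyapunovValues V z := by
  obtain ⟨g, hg, hg0, h⟩ := hδ.exists_root z₀ hz ν₀ ((mem_lyapunovValues_iff hV z₀ ν₀).1 hν)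
  have h' : ∀ᶠ q : ℂ × ℂ in 𝓝 (z₀, ν₀), q.2 ∈ lyapunovValues V q.1 ↔ g q.1 = q.2 := by
    filter_upwards [h] with q hq
    rw [mem_lyapunovValues_iff hV, hq]
  refine ⟨g, hg, hg0, h', ?_⟩
  have ht : Tendsto (fun z => (z, g z)) (𝓝 z₀) (𝓝 (z₀, ν₀)) := by
    have := (continuousAt_id (x := z₀)).prodMk hg.continuousAt
    rw [ContinuousAt, hg0] at this
    exact this
  filter_upwards [ht.eventually h'] with z hz
  exact hz.2 rfl

/-- Where δ ≠ 0 a single graph g carries all values near the given one. An element of order n would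
then take the same value g(z + tⁿ) at t and at wt for a primitive n-th root of unity w, against its
injectivity. -/
theorem IsRegularizer.ne_zero_of_mem_branchPoints (hV : IsPotential V)
    (hδ : IsRegularizer (lyapunovMatrix V) δ) {z : ℂ} (hz : z ∈ branchPoints V) : δ z = 0 := by
  by_contra hne
  obtain ⟨e, rfl, he⟩ := hz
  have h0 : (0 : ℂ) ∈ Metric.ball (0 : ℂ) e.radius := Metric.mem_ball_self e.radius_pos
  have hmem := e.mem_values 0 h0
  rw [zero_pow e.order_pos.ne', add_zero] at hmem
  obtain ⟨g, -, -, h, -⟩ := hδ.exists_lyapunov_root hV hne hmem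
  have ht : Tendsto (fun t : ℂ => (e.center + t ^ e.order, e.fn t)) (𝓝 0)
      (𝓝 (e.center, e.fn 0)) := by
    have h1 : ContinuousAt (fun t : ℂ => (e.center + t ^ e.order, e.fn t)) 0 :=
      (by fun_prop : ContinuousAt (fun t : ℂ => e.center + t ^ e.order) 0).prodMk
        (e.analytic 0 h0).continuousAt
    rw [ContinuousAt, zero_pow e.order_pos.ne', add_zero] at h1
    exact h1
  obtain ⟨r, hr, hball⟩ := Metric.eventually_nhds_iff_ball.1
    ((ht.eventually h).and (Metric.ball_mem_nhds (0 : ℂ) e.radius_pos))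
  have hprim := Complex.isPrimitiveRoot_exp e.order e.order_pos.ne'
  set w := Complex.exp (2 * Real.pi * Complex.I / e.order) with hw
  have hw1 : ‖w‖ = 1 := hprim.norm'_eq_one e.order_pos.ne'
  have hr2 : ‖((r / 2 : ℝ) : ℂ)‖ = r / 2 := by
    rw [Complex.norm_real, Real.norm_of_nonneg (by positivity)]
  have m1 : ((r / 2 : ℝ) : ℂ) ∈ Metric.ball (0 : ℂ) r := by
    rw [mem_ball_zero_iff, hr2]; linarith
  have m2 : w * ((r / 2 : ℝ) : ℂ) ∈ Metric.ball (0 : ℂ) r := by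
    rw [mem_ball_zero_iff, norm_mul, hr2, hw1]; linarith
  have hp : (w * ((r / 2 : ℝ) : ℂ)) ^ e.order = ((r / 2 : ℝ) : ℂ) ^ e.order := by
    rw [mul_pow, hprim.pow_eq_one, one_mul]
  have e1 := (hball _ m1).1.1 (e.mem_values _ (hball _ m1).2)
  have e2 := (hball _ m2).1.1 (e.mem_values _ (hball _ m2).2)
  rw [hp] at e2
  have := e.injOn (hball _ m1).2 (hball _ m2).2 (Prod.ext (by simp only [hp]) (e1.symm.trans e2))
  have hwne : w = 1 := by
    have hr0 : ((r / 2 : ℝ) : ℂ) ≠ 0 := by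
      rw [Complex.ofReal_ne_zero]; positivity
    exact mul_right_cancel₀ hr0 (by rw [one_mul]; exact this.symm)
  exact hprim.ne_one (by omega) hwne

theorem eventually_branchPoints_eq (hV : IsPotential V) (z : ℂ) :
    ∀ᶠ w in 𝓝 z, w ∈ branchPoints V → w = z := by
  obtain ⟨δ, hδ⟩ := exists_isRegularizer (lyapunovMatrix_differentiable hV)
  have := hδ.eventually_ne z
  rw [eventually_nhdsWithin_iff] at this
  filter_upwards [this] with w hw hb
  by_contra hne
  exact hw hne (hδ.ne_zero_of_mem_branchPoints hV hb)

/-- Branch points are isolated, so the nonreal ones keep a positive distance from a compact set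
containing none of them. For a vertical segment this yields openness of the cut half plane, for a
real segment its connectedness. -/
theorem exists_branchPoints_im_eq_zero (hV : IsPotential V) {K : Set ℂ} (hK : IsCompact K)
    (hB : ∀ z ∈ K, z ∈ branchPoints V → z.im = 0) :
    ∃ ε > 0, ∀ b ∈ branchPoints V, ∀ z ∈ K, dist b z < ε → b.im = 0 := by
  have hsub : K ⊆ interior {w | w ∈ branchPoints V → w.im = 0} := fun z hz => by
    rw [mem_interior_iff_mem_nhds]
    filter_upwards [eventually_branchPoints_eq hV z] with w hw hb
    rw [hw hb]
    exact hB z hz (hw hb ▸ hb)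
  obtain ⟨ε, hε, h⟩ := hK.exists_thickening_subset_open isOpen_interior hsub
  refine ⟨ε, hε, fun b hb z hz hd => ?_⟩
  exact interior_subset (h (Metric.mem_thickening_iff.2 ⟨z, hz, hd⟩)) hb

theorem eventually_mem_cutUpper (hV : IsPotential V) {z : ℂ} (hz : 0 ≤ z.im)
    (hB : ∀ b ∈ branchPoints V, 0 < b.im → b.re = z.re → z.im < b.im) :
    ∀ᶠ w in 𝓝 z, 0 < w.im → w ∈ cutUpper V := by
  have hK : IsCompact ((fun t : ℝ => (⟨z.re, t⟩ : ℂ)) '' Icc 0 z.im) :=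
    isCompact_Icc.image (Complex.equivRealProdCLM.symm.continuous.comp
      (continuous_const.prodMk continuous_id))
  obtain ⟨ε, hε, h⟩ := exists_branchPoints_im_eq_zero hV hK (by
    rintro _ ⟨t, ⟨ht0, ht1⟩, rfl⟩ hb
    rcases ht0.eq_or_lt with h0 | h0
    · exact h0.symm
    · exact absurd (hB _ hb h0 rfl) (not_lt.2 ht1))
  filter_upwards [Metric.ball_mem_nhds z (half_pos hε)] with w hw him
  refine ⟨him, ?_⟩
  rintro ⟨b, hb, hb0, hre, hle⟩
  have hwz : ‖w - z‖ < ε / 2 := by rwa [← dist_eq_norm]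
  have h1 : |w.re - z.re| < ε / 2 := (Complex.abs_re_le_norm (w - z)).trans_lt hwz
  have h2 : |w.im - z.im| < ε / 2 := (Complex.abs_im_le_norm (w - z)).trans_lt hwz
  -- The point of the vertical segment below z at height min(Im b, Im z) is closer than ε to b.
  refine hb0.ne' (h b hb ⟨z.re, min b.im z.im⟩ ⟨min b.im z.im, ⟨le_min hb0.le hz,
    min_le_right _ _⟩, rfl⟩ ?_)
  rw [dist_eq_norm]
  refine (Complex.norm_le_abs_re_add_abs_im _).trans_lt ?_
  simp only [Complex.sub_re, Complex.sub_im]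
  rw [← hre]
  have h3 : |b.im - min b.im z.im| < ε / 2 := by
    rw [abs_lt] at h2 ⊢
    rcases le_total b.im z.im with h | h
    · rw [min_eq_left h]; constructor <;> linarith
    · rw [min_eq_right h]; constructor <;> linarith
  linarith

theorem isOpen_cutUpper (hV : IsPotential V) : IsOpen (cutUpper V) := by
  refine isOpen_iff_mem_nhds.2 fun z hz => ?_
  have h0 : 0 < z.im := hz.1
  filter_upwards [eventually_mem_cutUpper hV h0.le fun b hb hb0 hre => not_le.1 fun hle =>
    hz.2 ⟨b, hb, hb0, hre.symm, hle⟩, Complex.continuous_im.continuousAt.eventually (lt_mem_nhds h0)]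
    with w h1 h2
  exact h1 h2

theorem eventually_mem_cutUpper_ofReal (hV : IsPotential V) (x : ℝ) :
    ∀ᶠ w in 𝓝 (x : ℂ), 0 < w.im → w ∈ cutUpper V :=
  eventually_mem_cutUpper hV (by simp) fun b _ hb0 _ => by simpa using hb0

theorem mem_cutUpper_of_im_le {z w : ℂ} (hz : z ∈ cutUpper V) (hre : w.re = z.re)
    (h0 : 0 < w.im) (him : w.im ≤ z.im) : w ∈ cutUpper V :=
  ⟨h0, fun ⟨b, hb, hb0, h1, h2⟩ => hz.2 ⟨b, hb, hb0, hre.symm.trans h1, h2.trans him⟩⟩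

theorem isPreconnected_cutUpper (hV : IsPotential V) : IsPreconnected (cutUpper V) := by
  refine isPreconnected_of_forall_pair fun z hz w hw => ?_
  have hz0 : 0 < z.im := hz.1
  have hw0 : 0 < w.im := hw.1
  have hc : ∀ x : ℝ, Continuous fun t : ℝ => (⟨x, t⟩ : ℂ) := fun x =>
    Complex.equivRealProdCLM.symm.continuous.comp (continuous_const.prodMk continuous_id)
  have hc' : ∀ y : ℝ, Continuous fun t : ℝ => (⟨t, y⟩ : ℂ) := fun y =>
    Complex.equivRealProdCLM.symm.continuous.comp (continuous_id.prodMk continuous_const)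
  obtain ⟨ε, hε, h⟩ := exists_branchPoints_im_eq_zero hV
    ((isCompact_uIcc (a := z.re) (b := w.re)).image (hc' 0)) (by rintro _ ⟨t, -, rfl⟩ -; rfl)
  -- At this height the horizontal segment between the two abscissae passes below every cut. The
  -- connecting path descends from z, crosses at height y and ascends to w.
  set y := min (ε / 2) (min z.im w.im) with hy
  have hy0 : 0 < y := lt_min (half_pos hε) (lt_min hz0 hw0)
  have hyz : y ≤ z.im := (min_le_right _ _).trans (min_le_left _ _)
  have hyw : y ≤ w.im := (min_le_right _ _).trans (min_le_right _ _)
  have hyε : y < ε := (min_le_left _ _).trans_lt (half_lt_self hε)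
  refine ⟨((fun t : ℝ => (⟨z.re, t⟩ : ℂ)) '' Icc y z.im ∪
    (fun t : ℝ => (⟨t, y⟩ : ℂ)) '' uIcc z.re w.re) ∪ (fun t : ℝ => (⟨w.re, t⟩ : ℂ)) '' Icc y w.im,
    ?_, Or.inl (Or.inl ⟨z.im, ⟨hyz, le_rfl⟩, rfl⟩), Or.inr ⟨w.im, ⟨hyw, le_rfl⟩, rfl⟩, ?_⟩
  · rintro _ ((⟨t, ht, rfl⟩ | ⟨t, ht, rfl⟩) | ⟨t, ht, rfl⟩)
    · exact mem_cutUpper_of_im_le hz rfl (hy0.trans_le ht.1) ht.2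
    · refine ⟨hy0, fun ⟨b, hb, hb0, h1, h2⟩ => hb0.ne' (h b hb ⟨t, 0⟩ ⟨t, ht, rfl⟩ ?_)⟩
      have h1' : t = b.re := h1
      have h2' : b.im ≤ y := h2
      rw [dist_eq_norm]
      refine (Complex.norm_le_abs_re_add_abs_im _).trans_lt ?_
      simp only [Complex.sub_re, Complex.sub_im, h1', sub_self, abs_zero, zero_add, sub_zero]
      rw [abs_of_pos hb0]
      exact h2'.trans_lt hyε
    · exact mem_cutUpper_of_im_le hw rfl (hy0.trans_le ht.1) ht.2
  · refine IsPreconnected.union (⟨w.re, y⟩ : ℂ) (Or.inr ⟨w.re, right_mem_uIcc, rfl⟩)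
      ⟨y, ⟨le_rfl, hyw⟩, rfl⟩ (IsPreconnected.union (⟨z.re, y⟩ : ℂ) ⟨y, ⟨le_rfl, hyz⟩, rfl⟩
        ⟨z.re, left_mem_uIcc, rfl⟩ ?_ ?_) ?_
    · exact isPreconnected_Icc.image _ (hc _).continuousOn
    · exact isPreconnected_uIcc.image _ (hc' _).continuousOn
    · exact isPreconnected_Icc.image _ (hc _).continuousOn

end

section

/-! ### Germs on the Riemann surface -/

theorem LyapunovElement.continuous_pt (e : LyapunovElement V) : Continuous e.pt :=
  (continuous_quot_mk (r := SamePoint V)).comp continuous_sigmaMk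

theorem LyapunovElement.pt_mem_connectedComponent (e : LyapunovElement V)
    {ζ : LyapunovSurface V} {t s : Metric.ball (0 : ℂ) e.radius}
    (h : e.pt t ∈ connectedComponent ζ) : e.pt s ∈ connectedComponent ζ := by
  have : PreconnectedSpace (Metric.ball (0 : ℂ) e.radius) :=
    isPreconnected_iff_preconnectedSpace.1 (convex_ball _ _).isPreconnected
  rw [connectedComponent_eq h]
  exact (isPreconnected_range e.continuous_pt).subset_connectedComponent (mem_range_self t)
    (mem_range_self s)

/-- `F` is near `z` an analytic branch of the Lyapunov function. -/
def IsLyapunovGerm (V : ℝ → Matrix (Fin N) (Fin N) ℝ) (F : ℂ → ℂ) (z : ℂ) : Prop :=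
  AnalyticAt ℂ F z ∧ ∀ᶠ w in 𝓝 z, F w ∈ lyapunovValues V w

variable {F G : ℂ → ℂ} {z : ℂ}

theorem IsLyapunovGerm.congr (h : IsLyapunovGerm V F z) (hFG : F =ᶠ[𝓝 z] G) :
    IsLyapunovGerm V G z := by
  refine ⟨h.1.congr hFG, ?_⟩
  filter_upwards [h.2, hFG] with w h1 h2
  exact h2 ▸ h1

theorem IsLyapunovGerm.eventually (h : IsLyapunovGerm V F z) :
    ∀ᶠ w in 𝓝 z, IsLyapunovGerm V F w := by
  filter_upwards [h.1.eventually_analyticAt, h.2.eventually_nhds] with w h1 h2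
  exact ⟨h1, h2⟩

theorem IsLyapunovGerm.exists_radius (h : IsLyapunovGerm V F z) : ∃ r > 0,
    AnalyticOnNhd ℂ (fun t => F (z + t)) (Metric.ball 0 r) ∧
      ∀ t ∈ Metric.ball (0 : ℂ) r, F (z + t) ∈ lyapunovValues V (z + t ^ 1) := by
  obtain ⟨r, hr, hb⟩ := Metric.eventually_nhds_iff_ball.1 h.eventually
  have hmem : ∀ t ∈ Metric.ball (0 : ℂ) r, z + t ∈ Metric.ball z r := fun t ht => by
    simpa [mem_ball_iff_norm] using ht
  refine ⟨r, hr, fun t ht => ?_, fun t ht => ?_⟩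
  · exact (hb _ (hmem t ht)).1.comp_of_eq (by fun_prop) rfl
  · rw [pow_one]
    exact (hb _ (hmem t ht)).2.self_of_nhds

/-- The unramified function element of a germ. -/
def IsLyapunovGerm.element (h : IsLyapunovGerm V F z) : LyapunovElement V where
  center := z
  order := 1
  radius := h.exists_radius.choose
  fn := fun t => F (z + t)
  order_pos := one_pos
  radius_pos := h.exists_radius.choose_spec.1
  analytic := h.exists_radius.choose_spec.2.1
  mem_values := h.exists_radius.choose_spec.2.2
  injOn := fun t _ s _ hts => by simpa using (Prod.ext_iff.1 hts).1

/-- The center of the parameter disc of an element. -/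
def LyapunovElement.base (e : LyapunovElement V) : LyapunovSurface V :=
  e.pt ⟨0, Metric.mem_ball_self e.radius_pos⟩

/-- The point of the surface given by a germ. -/
def IsLyapunovGerm.point (h : IsLyapunovGerm V F z) : LyapunovSurface V :=
  h.element.base

/-- Away from a ramification point s ↦ sⁿ - tⁿ is a biholomorphic change of parameter at t, which
turns the element into an ordinary germ in z. -/
theorem LyapunovElement.pt_eq_point (e : LyapunovElement V) (t : Metric.ball (0 : ℂ) e.radius)
    (ht : (t : ℂ) ≠ 0 ∨ e.order = 1) (h : IsLyapunovGerm V F (e.center + (t : ℂ) ^ e.order))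
    (hF : ∀ᶠ s in 𝓝 (t : ℂ), e.fn s = F (e.center + s ^ e.order)) : e.pt t = h.point := by
  refine Quot.sound ⟨fun s => s ^ e.order - (t : ℂ) ^ e.order, ?_, ?_, ?_, ?_⟩
  · fun_prop
  · have h1 : HasDerivAt (fun s : ℂ => s ^ e.order - (t : ℂ) ^ e.order)
        (e.order * (t : ℂ) ^ (e.order - 1)) t := (hasDerivAt_pow e.order (t : ℂ)).sub_const _
    rw [h1.deriv]
    refine mul_ne_zero (Nat.cast_ne_zero.2 e.order_pos.ne') ?_
    rcases ht with ht | ht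
    · exact pow_ne_zero _ ht
    · simp [ht]
  · exact sub_self _
  · filter_upwards [hF] with s hs
    refine ⟨?_, ?_⟩
    · change _ = e.center + (t : ℂ) ^ e.order + (s ^ e.order - (t : ℂ) ^ e.order) ^ 1
      ring
    · change _ = F (e.center + (t : ℂ) ^ e.order + (s ^ e.order - (t : ℂ) ^ e.order))
      rw [hs]
      ring_nf

theorem IsLyapunovGerm.point_congr (h : IsLyapunovGerm V F z) (h' : IsLyapunovGerm V G z)
    (hFG : F =ᶠ[𝓝 z] G) : h.point = h'.point := by
  have ht : Tendsto (fun s : ℂ => z + s) (𝓝 0) (𝓝 z) := by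
    simpa using (continuous_const_add z).tendsto (0 : ℂ)
  refine Quot.sound ⟨id, analyticAt_id, by simp, rfl, ?_⟩
  filter_upwards [ht.eventually hFG] with s hs
  exact ⟨rfl, hs⟩

theorem IsLyapunovGerm.point_eq_pt (h : IsLyapunovGerm V F z)
    (t : Metric.ball (0 : ℂ) h.element.radius) (h' : IsLyapunovGerm V F (z + t)) :
    h'.point = h.element.pt t := by
  have h2 : IsLyapunovGerm V F (h.element.center + (t : ℂ) ^ h.element.order) := by
    change IsLyapunovGerm V F (z + (t : ℂ) ^ 1)
    rwa [pow_one]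
  rw [h.element.pt_eq_point t (Or.inr rfl) h2 (Eventually.of_forall fun s => ?_)]
  · congr 1
    change z + (t : ℂ) = z + (t : ℂ) ^ 1
    rw [pow_one]
  · change F (z + s) = F (z + s ^ 1)
    rw [pow_one]

open Classical in
theorem continuous_point {U : Set ℂ} (h : ∀ z ∈ U, IsLyapunovGerm V F z) :
    Continuous fun z : U => (h z z.2).point := by
  refine continuous_iff_continuousAt.2 fun z => ?_
  set e := (h z z.2).element with he
  have hc : ContinuousOn (fun t : ℂ => if ht : t ∈ Metric.ball (0 : ℂ) e.radius then
      e.pt ⟨t, ht⟩ else e.base) (Metric.ball 0 e.radius) := by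
    rw [continuousOn_iff_continuous_domRestrict]
    convert e.continuous_pt using 1
    ext t
    simp only [Set.domRestrict_apply, dif_pos t.2]
  have h0 : ContinuousAt (fun w : U => (w : ℂ) - z) z := by fun_prop
  have h1 := (hc.continuousAt (Metric.ball_mem_nhds 0 e.radius_pos)).comp_of_eq h0 (sub_self (z : ℂ))
  refine h1.congr ?_
  have hev : ∀ᶠ w : U in 𝓝 z, (w : ℂ) - z ∈ Metric.ball (0 : ℂ) e.radius :=
    h0.eventually (by
      beta_reduce
      rw [sub_self]
      exact Metric.ball_mem_nhds 0 e.radius_pos)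
  filter_upwards [hev] with w hw
  have h2 : IsLyapunovGerm V F ((z : ℂ) + ((w : ℂ) - z)) := by
    rw [add_sub_cancel]; exact h w w.2
  rw [Function.comp_apply, dif_pos hw, ← (h z z.2).point_eq_pt ⟨_, hw⟩ h2]
  congr 1
  exact add_sub_cancel _ _

/-- The germ of `F` at `z` is a point of `S`. -/
def GermIn (S : Set (LyapunovSurface V)) (F : ℂ → ℂ) (z : ℂ) : Prop :=
  ∃ h : IsLyapunovGerm V F z, h.point ∈ S

theorem GermIn.congr {S : Set (LyapunovSurface V)} (h : GermIn S F z) (hFG : F =ᶠ[𝓝 z] G) :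
    GermIn S G z := by
  obtain ⟨h1, h2⟩ := h
  exact ⟨h1.congr hFG, h1.point_congr (h1.congr hFG) hFG ▸ h2⟩

/-- The map sending z to the germ of F at z is continuous into the surface, so a component is closed
under analytic continuation within a connected set. -/
theorem GermIn.of_isPreconnected {ζ : LyapunovSurface V} {U : Set ℂ} (hU : IsPreconnected U)
    (h : ∀ z ∈ U, IsLyapunovGerm V F z) {w : ℂ} (hz : z ∈ U) (hw : w ∈ U)
    (hm : GermIn (connectedComponent ζ) F z) : GermIn (connectedComponent ζ) F w := by
  obtain ⟨h1, h2⟩ := hm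
  have : PreconnectedSpace U := isPreconnected_iff_preconnectedSpace.1 hU
  refine ⟨h w hw, ?_⟩
  rw [connectedComponent_eq h2]
  exact (isPreconnected_range (continuous_point h)).subset_connectedComponent
    ⟨⟨z, hz⟩, rfl⟩ ⟨⟨w, hw⟩, rfl⟩

theorem GermIn.eventually {ζ : LyapunovSurface V} (h : GermIn (connectedComponent ζ) F z) :
    ∀ᶠ w in 𝓝 z, GermIn (connectedComponent ζ) F w := by
  obtain ⟨r, hr, hb⟩ := Metric.eventually_nhds_iff_ball.1 h.1.eventually
  filter_upwards [Metric.ball_mem_nhds z hr] with w hw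
  exact h.of_isPreconnected (convex_ball z r).isPreconnected hb (Metric.mem_ball_self hr) hw

theorem isBranchOn_iff {ζ : LyapunovSurface V} :
    IsBranchOn (connectedComponent ζ) F ↔
      ∀ z ∈ cutUpper V, GermIn (connectedComponent ζ) F z := by
  refine forall₂_congr fun z _ => ⟨?_, ?_⟩
  · rintro ⟨e, heS, hc, ho, hF⟩
    have ht : Tendsto (fun w : ℂ => w - e.center) (𝓝 z) (𝓝 0) := by
      simpa [hc] using (continuous_sub_right e.center).tendsto z
    have hm := Metric.ball_mem_nhds (0 : ℂ) e.radius_pos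
    have hg : IsLyapunovGerm V (fun w => e.fn (w - e.center)) z := by
      refine ⟨?_, ?_⟩
      · exact (e.analytic 0 (mem_of_mem_nhds hm)).comp_of_eq (by fun_prop) (by simp [hc])
      · filter_upwards [ht.eventually hm] with w hw
        have := e.mem_values _ hw
        rwa [ho, pow_one, add_sub_cancel] at this
    have hFG : (fun w => e.fn (w - e.center)) =ᶠ[𝓝 z] F := by
      filter_upwards [ht.eventually hF] with w hw
      rw [hw, ← hc, add_sub_cancel]
    have hz : e.center + ((0 : ℂ)) ^ e.order = z := by simp [ho, hc]
    refine GermIn.congr ⟨hg, ?_⟩ hFG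
    have hg' : IsLyapunovGerm V (fun w => e.fn (w - e.center)) (e.center + (0 : ℂ) ^ e.order) :=
      hz.symm ▸ hg
    have h1 := e.pt_eq_point ⟨0, mem_of_mem_nhds hm⟩ (Or.inr ho) hg'
      (Eventually.of_forall fun s => by simp [ho])
    have h2 : hg.point = hg'.point := by congr 1; exact hz.symm
    rw [h2, ← h1]
    exact heS _
  · rintro ⟨h, hm⟩
    exact ⟨h.element, fun t => h.element.pt_mem_connectedComponent hm, rfl, rfl,
      Eventually.of_forall fun t => rfl⟩

/-- The zeros of δ are isolated, so a small nonzero parameter in any disc of the component avoids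
them. -/
theorem exists_germIn {δ : ℂ → ℂ} (hV : IsPotential V)
    (hδ : IsRegularizer (lyapunovMatrix V) δ) (ζ : LyapunovSurface V) :
    ∃ F z, δ z ≠ 0 ∧ GermIn (connectedComponent ζ) F z := by
  obtain ⟨⟨e, t₀⟩, rfl⟩ := Quot.exists_rep ζ
  have h0 : e.pt t₀ ∈ connectedComponent (e.pt t₀) := mem_connectedComponent
  have hb := Metric.ball_mem_nhds (0 : ℂ) e.radius_pos
  have hne : ∀ᶠ t in 𝓝[≠] (0 : ℂ), δ (e.center + t ^ e.order) ≠ 0 := by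
    have ht : Tendsto (fun t : ℂ => e.center + t ^ e.order) (𝓝[≠] 0) (𝓝[≠] e.center) := by
      refine tendsto_nhdsWithin_iff.2 ⟨?_, ?_⟩
      · have : ContinuousAt (fun t : ℂ => e.center + t ^ e.order) 0 := by fun_prop
        rw [ContinuousAt, zero_pow e.order_pos.ne', add_zero] at this
        exact this.mono_left nhdsWithin_le_nhds
      · filter_upwards [self_mem_nhdsWithin] with t ht
        simpa using pow_ne_zero _ ht
    exact ht.eventually (hδ.eventually_ne e.center)
  obtain ⟨t, ⟨ht1, ht2⟩, ht3⟩ :=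
    ((hne.and (mem_nhdsWithin_of_mem_nhds hb)).and self_mem_nhdsWithin).exists
  obtain ⟨g, hg, hg0, hgu, hgv⟩ := hδ.exists_lyapunov_root hV ht1 (e.mem_values t ht2)
  refine ⟨g, _, ht1, ⟨hg, hgv⟩, ?_⟩
  rw [← e.pt_eq_point ⟨t, ht2⟩ (Or.inl ht3) ⟨hg, hgv⟩]
  · exact e.pt_mem_connectedComponent h0
  · have hc : ContinuousAt (fun s : ℂ => (e.center + s ^ e.order, e.fn s)) t :=
      (by fun_prop : ContinuousAt (fun s : ℂ => e.center + s ^ e.order) t).prodMk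
        (e.analytic t ht2).continuousAt
    filter_upwards [hc.eventually hgu, Metric.isOpen_ball.mem_nhds ht2] with s h1 h2
    exact (h1.1 (e.mem_values s h2)).symm

/-! ### Complex conjugation on the surface -/

theorem analyticAt_conj_conj {f : ℂ → ℂ} {z : ℂ} (hf : AnalyticAt ℂ f z) :
    AnalyticAt ℂ (fun w => starRingEnd ℂ (f (starRingEnd ℂ w))) (starRingEnd ℂ z) := by
  rw [Complex.analyticAt_iff_eventually_differentiableAt]
  have ht : Tendsto (starRingEnd ℂ) (𝓝 (starRingEnd ℂ z)) (𝓝 z) := by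
    simpa using Complex.continuous_conj.tendsto (starRingEnd ℂ z)
  filter_upwards [ht.eventually hf.eventually_analyticAt] with w hw
  have := hw.differentiableAt.conj_conj
  rwa [Complex.conj_conj] at this

/-- The complex conjugate of a function element. -/
def LyapunovElement.conj (hV : IsPotential V) (e : LyapunovElement V) : LyapunovElement V where
  center := starRingEnd ℂ e.center
  order := e.order
  radius := e.radius
  fn := fun t => starRingEnd ℂ (e.fn (starRingEnd ℂ t))
  order_pos := e.order_pos
  radius_pos := e.radius_pos
  analytic := fun t ht => by
    have := analyticAt_conj_conj (e.analytic (starRingEnd ℂ t) (by simpa using ht))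
    rwa [Complex.conj_conj] at this
  mem_values := fun t ht => by
    have := conj_mem_lyapunovValues hV (e.mem_values (starRingEnd ℂ t) (by simpa using ht))
    rwa [map_add, map_pow, Complex.conj_conj] at this
  injOn := fun t ht s hs hts => by
    have h := Prod.ext_iff.1 hts
    have h2 : e.fn (starRingEnd ℂ t) = e.fn (starRingEnd ℂ s) :=
      (starRingEnd ℂ).injective h.2
    have h1 : (starRingEnd ℂ t) ^ e.order = (starRingEnd ℂ s) ^ e.order := by
      rw [← map_pow, ← map_pow]
      exact congrArg _ (add_left_cancel h.1)
    refine (starRingEnd ℂ).injective (e.injOn (by simpa using ht) (by simpa using hs)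
      (Prod.ext ?_ h2))
    simp only [h1]

theorem conj_mem_branchPoints (hV : IsPotential V) {z : ℂ} (hz : z ∈ branchPoints V) :
    starRingEnd ℂ z ∈ branchPoints V := by
  obtain ⟨e, rfl, he⟩ := hz
  exact ⟨e.conj hV, rfl, he⟩

theorem mem_cutLower_iff (hV : IsPotential V) {z : ℂ} :
    z ∈ cutLower V ↔ starRingEnd ℂ z ∈ cutUpper V := by
  simp only [cutLower, cutUpper, Set.mem_sdiff, mem_ofPred_eq, Complex.conj_im, Complex.conj_re,
    neg_pos]
  refine and_congr_right fun _ => not_congr ⟨?_, ?_⟩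
  · rintro ⟨b, hb, h1, h2, h3⟩
    exact ⟨_, conj_mem_branchPoints hV hb, by simpa using h1, by simpa using h2, by simpa using h3⟩
  · rintro ⟨b, hb, h1, h2, h3⟩
    exact ⟨_, conj_mem_branchPoints hV hb, by simpa using h1, by simpa using h2, by
      simpa using le_neg_of_le_neg h3⟩

/-- Complex conjugation on the disjoint union of the parameter discs. -/
def conjDiscs (hV : IsPotential V) (x : LyapunovDiscs V) : LyapunovDiscs V :=
  ⟨x.1.conj hV, ⟨starRingEnd ℂ x.2.1, by
    have := x.2.2
    rw [mem_ball_zero_iff] at this ⊢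
    rwa [RCLike.norm_conj]⟩⟩

theorem SamePoint.conjDiscs (hV : IsPotential V) {x y : LyapunovDiscs V} (h : SamePoint V x y) :
    SamePoint V (conjDiscs hV x) (conjDiscs hV y) := by
  obtain ⟨f, hf, hd, h0, he⟩ := h
  have ht : Tendsto (starRingEnd ℂ) (𝓝 (starRingEnd ℂ x.2.1)) (𝓝 x.2.1) := by
    simpa using Complex.continuous_conj.tendsto (starRingEnd ℂ x.2.1)
  refine ⟨fun t => starRingEnd ℂ (f (starRingEnd ℂ t)), analyticAt_conj_conj hf, ?_, ?_, ?_⟩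
  · have := hf.differentiableAt.hasDerivAt.conj_conj
    change deriv _ (starRingEnd ℂ x.2.1) ≠ 0
    rw [show (fun t => starRingEnd ℂ (f (starRingEnd ℂ t))) =
      (starRingEnd ℂ ∘ f ∘ starRingEnd ℂ) from rfl, this.deriv]
    simpa using hd
  · change starRingEnd ℂ (f (starRingEnd ℂ (starRingEnd ℂ x.2.1))) = starRingEnd ℂ y.2.1
    rw [Complex.conj_conj, h0]
  · filter_upwards [ht.eventually he] with t h
    refine ⟨?_, ?_⟩
    · have := congrArg (starRingEnd ℂ) h.1
      simp only [map_add, map_pow, Complex.conj_conj] at this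
      simpa [PeriodicMatrixSchrodinger.conjDiscs, LyapunovElement.conj] using this
    · change starRingEnd ℂ (x.1.fn (starRingEnd ℂ t)) =
        starRingEnd ℂ (y.1.fn (starRingEnd ℂ (starRingEnd ℂ (f (starRingEnd ℂ t)))))
      rw [Complex.conj_conj, h.2]

/-- Complex conjugation on the Riemann surface of the Lyapunov function. -/
def conjSurface (hV : IsPotential V) : LyapunovSurface V → LyapunovSurface V :=
  Quot.map (conjDiscs hV) fun _ _ h => h.conjDiscs hV

theorem continuous_conjSurface (hV : IsPotential V) : Continuous (conjSurface hV) := by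
  refine continuous_quot_lift _ ?_
  refine continuous_sigma fun e => ?_
  have hmem : ∀ t : Metric.ball (0 : ℂ) e.radius, starRingEnd ℂ (t : ℂ) ∈
      Metric.ball (0 : ℂ) (e.conj hV).radius := fun t => (conjDiscs hV ⟨e, t⟩).2.2
  have hc : Continuous fun t : Metric.ball (0 : ℂ) e.radius =>
      (⟨starRingEnd ℂ (t : ℂ), hmem t⟩ : Metric.ball (0 : ℂ) (e.conj hV).radius) :=
    (Complex.continuous_conj.comp continuous_subtype_val).subtype_mk hmem
  exact (e.conj hV).continuous_pt.comp hc

theorem IsLyapunovGerm.conj (hV : IsPotential V) (h : IsLyapunovGerm V F z) :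
    IsLyapunovGerm V (fun w => starRingEnd ℂ (F (starRingEnd ℂ w))) (starRingEnd ℂ z) := by
  have ht : Tendsto (starRingEnd ℂ) (𝓝 (starRingEnd ℂ z)) (𝓝 z) := by
    simpa using Complex.continuous_conj.tendsto (starRingEnd ℂ z)
  refine ⟨analyticAt_conj_conj h.1, ?_⟩
  filter_upwards [ht.eventually h.2] with w hw
  simpa using conj_mem_lyapunovValues hV hw

theorem IsLyapunovGerm.conjSurface_point (hV : IsPotential V) (h : IsLyapunovGerm V F z) :
    conjSurface hV h.point = (h.conj hV).point := by
  refine Quot.sound ⟨id, analyticAt_id, by simp, ?_, Eventually.of_forall fun t => ⟨rfl, ?_⟩⟩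
  · exact map_zero (starRingEnd ℂ)
  · change starRingEnd ℂ (F (z + starRingEnd ℂ t)) =
      starRingEnd ℂ (F (starRingEnd ℂ (starRingEnd ℂ z + t)))
    rw [map_add, Complex.conj_conj]

/-- Conjugation is a continuous self-map of the surface and so maps components into components. One
germ F whose conjugate stays in the component settles the matter for all germs G. -/
theorem GermIn.conj (hV : IsPotential V) {ζ : LyapunovSurface V}
    (hF : GermIn (connectedComponent ζ) F z)
    (hF' : GermIn (connectedComponent ζ) (fun w => starRingEnd ℂ (F (starRingEnd ℂ w)))
      (starRingEnd ℂ z)) {w : ℂ} (hG : GermIn (connectedComponent ζ) G w) :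
    GermIn (connectedComponent ζ) (fun w => starRingEnd ℂ (G (starRingEnd ℂ w)))
      (starRingEnd ℂ w) := by
  obtain ⟨h1, h2⟩ := hF
  obtain ⟨h1', h2'⟩ := hF'
  obtain ⟨h3, h4⟩ := hG
  refine ⟨h3.conj hV, ?_⟩
  rw [connectedComponent_eq h2] at h4
  have h5 := (continuous_conjSurface hV).mapsTo_connectedComponent h1.point h4
  rw [h1.conjSurface_point hV, h3.conjSurface_point hV] at h5
  rwa [← connectedComponent_eq h2'] at h5

end

section

/-! ### Every component meets the bands -/

open InnerProductSpace in
-- The mean of ψ over a circle of radius s about z is ψ(z), but the inequality would make it at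
-- least ψ(z) + κ s².
theorem not_eventually_add_le_of_harmonicAt {ψ : ℂ → ℝ} {z : ℂ} (hψ : HarmonicAt ψ z) {κ : ℝ}
    (hκ : 0 < κ) : ¬ ∀ᶠ w in 𝓝 z, ψ z + κ * ‖w - z‖ ^ 2 ≤ ψ w := by
  intro h
  obtain ⟨r, hr, hb⟩ := Metric.eventually_nhds_iff_ball.1 (hψ.eventually.and h)
  have hr2 : |r / 2| = r / 2 := abs_of_pos (half_pos hr)
  have hsub : Metric.closedBall z |r / 2| ⊆ Metric.ball z r := by
    rw [hr2]; exact Metric.closedBall_subset_ball (half_lt_self hr)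
  have hh : HarmonicOnNhd ψ (Metric.closedBall z |r / 2|) := fun w hw => (hb w (hsub hw)).1
  have hi : CircleIntegrable ψ z (r / 2) :=
    (hh.continuousOn.mono Metric.sphere_subset_closedBall).circleIntegrable'
  have h1 := hh.circleAverage_eq
  have h2 : Real.circleAverage (fun _ => ψ z + κ * (r / 2) ^ 2) z (r / 2) ≤
      Real.circleAverage ψ z (r / 2) := by
    refine Real.circleAverage_mono (circleIntegrable_const _ _ _) hi fun w hw => ?_
    have h3 := (hb w (hsub (Metric.sphere_subset_closedBall hw))).2
    rwa [← dist_eq_norm, Metric.mem_sphere.1 hw, hr2] at h3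
  rw [Real.circleAverage_const, h1] at h2
  have : 0 < κ * (r / 2) ^ 2 := by positivity
  linarith

/-- The pairs `(z, ν)` with `δ z ≠ 0` given by unramified points of `S`. -/
def regularPairs (S : Set (LyapunovSurface V)) (δ : ℂ → ℂ) : Set (ℂ × ℂ) :=
  {q | δ q.1 ≠ 0 ∧ ∃ F, GermIn S F q.1 ∧ F q.1 = q.2}

theorem isClosed_lyapunovValues (hV : IsPotential V) :
    IsClosed {q : ℂ × ℂ | q.2 ∈ lyapunovValues V q.1} := by
  simp only [mem_lyapunovValues_iff hV]
  refine isClosed_eq (Continuous.matrix_det ?_) continuous_const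
  refine continuous_matrix fun i j => ?_
  simp only [Matrix.sub_apply, Matrix.smul_apply]
  exact ((lyapunovMatrix_differentiable hV i j).continuous.comp continuous_fst).sub
    (continuous_snd.smul continuous_const)

variable {δ : ℂ → ℂ}

/-- Near the limit pair all values lie on one graph g. Regular pairs close to it are therefore germs
of g, and continuation along g stays in the component. -/
theorem mem_regularPairs_of_mem_closure (hV : IsPotential V)
    (hδ : IsRegularizer (lyapunovMatrix V) δ) {ζ : LyapunovSurface V} {q : ℂ × ℂ}
    (hq : q ∈ closure (regularPairs (connectedComponent ζ) δ)) (hne : δ q.1 ≠ 0) :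
    q ∈ regularPairs (connectedComponent ζ) δ := by
  have hval : q.2 ∈ lyapunovValues V q.1 := by
    refine closure_minimal ?_ (isClosed_lyapunovValues hV) hq
    rintro q' ⟨-, F, hF, hFq⟩
    rw [mem_ofPred_eq, ← hFq]
    exact hF.1.2.self_of_nhds
  obtain ⟨g, hg, hg0, hgu, hgv⟩ := hδ.exists_lyapunov_root hV hne hval
  have hgerm : IsLyapunovGerm V g q.1 := ⟨hg, hgv⟩
  obtain ⟨r, hr, hb⟩ := Metric.eventually_nhds_iff_ball.1 hgerm.eventually
  have hev : ∀ᶠ q' : ℂ × ℂ in 𝓝 q, (∀ᶠ p : ℂ × ℂ in 𝓝 q',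
      p.2 ∈ lyapunovValues V p.1 ↔ g p.1 = p.2) ∧ q'.1 ∈ Metric.ball q.1 r :=
    (Filter.Eventually.eventually_nhds hgu).and
      (continuous_fst.continuousAt.eventually (Metric.ball_mem_nhds q.1 hr))
  obtain ⟨q', ⟨-, F, hF, hFq⟩, hq1, hq2⟩ :=
    ((mem_closure_iff_frequently.1 hq).and_eventually hev).exists
  refine ⟨hne, g, ?_, hg0⟩
  have ht : Tendsto (fun w => (w, F w)) (𝓝 q'.1) (𝓝 q') := by
    have := (continuousAt_id (x := q'.1)).prodMk hF.1.1.continuousAt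
    rw [ContinuousAt, hFq] at this
    exact this
  have hFg : F =ᶠ[𝓝 q'.1] g := by
    filter_upwards [ht.eventually hq1, hF.1.2] with w h1 h2
    exact (h1.1 h2).symm
  exact (hF.congr hFg).of_isPreconnected (convex_ball q.1 r).isPreconnected hb hq2
    (Metric.mem_ball_self hr)

/-- The strictly subharmonic comparison function `(R/4) + (5 y²/8 - x²/2) / R`. -/
def comparison (R : ℝ) (z : ℂ) : ℝ := R / 4 + (5 / 8 * z.im ^ 2 - 1 / 2 * z.re ^ 2) / R

/-- About every centre z the function is harmonic plus |w - z|²/(16R), in agreement with its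
constant Laplacian 1/(4R). This is the strict subharmonicity that excludes interior minima. -/
theorem comparison_eq {R : ℝ} (hR : 0 < R) (z w : ℂ) :
    comparison R w = (((R / 4 : ℝ) : ℂ) + (-(9 / 16) * w ^ 2 +
      (2 * starRingEnd ℂ z * (w - z) + (‖z‖ ^ 2 : ℝ)) / 16) / R).re +
      1 / (16 * R) * ‖w - z‖ ^ 2 := by
  rw [← Complex.normSq_eq_norm_sq, ← Complex.normSq_eq_norm_sq, Complex.normSq_apply,
    Complex.normSq_apply, comparison]
  have h2 : ∀ a : ℂ, (a / 16).re = a.re / 16 := fun a => by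
    rw [show (16 : ℂ) = ((16 : ℝ) : ℂ) by norm_num, Complex.div_ofReal_re]
  have h3 : ∀ a : ℂ, (-(9 / 16) * a).re = -(9 / 16) * a.re := fun a => by
    rw [show (-(9 / 16) : ℂ) = ((-(9 / 16) : ℝ) : ℂ) by push_cast; ring, Complex.re_ofReal_mul]
  simp only [Complex.add_re, Complex.div_ofReal_re, Complex.ofReal_re, h2, h3, mul_assoc, pow_two]
  simp only [Complex.mul_re, Complex.re_ofNat, Complex.im_ofNat, Complex.conj_re, Complex.conj_im,
    Complex.sub_re, Complex.sub_im]
  field_simp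
  ring

/-- The coefficients 5/8 and 1/2 serve this purpose: on |z| = R the comparison function equals -R/4
+ 9y²/(8R), which stays R/8 below |y|, with equality at |y| = R. -/
theorem abs_im_sub_comparison_ge {R : ℝ} (hR : 0 < R) {z : ℂ} (hz : ‖z‖ = R) :
    R / 8 ≤ |z.im| - comparison R z := by
  have h1 : z.re ^ 2 = R ^ 2 - z.im ^ 2 := by
    rw [← hz, ← Complex.normSq_eq_norm_sq, Complex.normSq_apply]; ring
  have h2 : |z.im| ≤ R := hz ▸ Complex.abs_im_le_norm z
  have h3 : comparison R z = -R / 4 + 9 / 8 * |z.im| ^ 2 / R := by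
    rw [comparison, h1, sq_abs]
    field_simp
    ring
  have h4 : 9 / 8 * |z.im| ^ 2 / R ≤ |z.im| + R / 8 := by
    rw [div_le_iff₀ hR]
    nlinarith [abs_nonneg z.im]
  rw [h3]
  linarith

theorem neg_comparison_le {R : ℝ} (hR : 1 ≤ R) (z : ℂ) :
    -comparison R z ≤ ‖z‖ ^ 2 - R / 4 := by
  have h1 : (1 / 2 * z.re ^ 2 - 5 / 8 * z.im ^ 2) / R ≤ ‖z‖ ^ 2 := by
    rw [div_le_iff₀ (by linarith), ← Complex.normSq_eq_norm_sq, Complex.normSq_apply]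
    nlinarith [sq_nonneg z.re, sq_nonneg z.im]
  have h2 : comparison R z = R / 4 - (1 / 2 * z.re ^ 2 - 5 / 8 * z.im ^ 2) / R := by
    rw [comparison]; ring
  rw [h2]
  linarith

theorem comparison_le {R : ℝ} (hR : 0 < R) {z : ℂ} (hz : ‖z‖ ≤ R) : comparison R z ≤ R := by
  have h1 : (5 / 8 * z.im ^ 2 - 1 / 2 * z.re ^ 2) / R ≤ 3 / 4 * R := by
    have : ‖z‖ ^ 2 ≤ R ^ 2 := by gcongr
    rw [← Complex.normSq_eq_norm_sq, Complex.normSq_apply] at this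
    rw [div_le_iff₀ hR]
    nlinarith [sq_nonneg z.re, sq_nonneg z.im]
  rw [comparison]
  linarith

theorem norm_le_exp_log_norm_eta (ν : ℂ) : ‖ν‖ ≤ Real.exp (Real.log ‖eta ν‖) := by
  have h1 := one_le_norm_eta ν
  rw [Real.exp_log (by linarith)]
  have h2 : ‖2 * ν‖ ≤ ‖eta ν‖ + ‖eta ν‖⁻¹ := by
    rw [← eta_add_inv, ← norm_inv]; exact norm_add_le _ _
  rw [norm_mul, Complex.norm_ofNat] at h2
  have h3 : ‖eta ν‖⁻¹ ≤ 1 := inv_le_one_of_one_le₀ h1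
  linarith

theorem continuous_comparison (R : ℝ) : Continuous (comparison R) := by
  unfold comparison
  fun_prop

/-- The function minimized over the regular points of a component. -/
def barrier (δ : ℂ → ℂ) (R ε : ℝ) (q : ℂ × ℂ) : ℝ :=
  Real.log ‖eta q.2‖ - comparison R q.1 - ε * Real.log ‖δ q.1‖

theorem exists_isMinOn_barrier (hV : IsPotential V) (hδ : IsRegularizer (lyapunovMatrix V) δ)
    {ζ : LyapunovSurface V} {R ε : ℝ} (hR : 0 < R) (hε : 0 < ε)
    {q : ℂ × ℂ} (hq : q ∈ regularPairs (connectedComponent ζ) δ) (hqR : ‖q.1‖ ≤ R) :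
    ∃ q₀ ∈ regularPairs (connectedComponent ζ) δ, ‖q₀.1‖ ≤ R ∧
      ∀ p ∈ regularPairs (connectedComponent ζ) δ, ‖p.1‖ ≤ R →
        barrier δ R ε q₀ ≤ barrier δ R ε p := by
  set T := regularPairs (connectedComponent ζ) δ with hT
  have hδc := hδ.differentiable.continuous
  obtain ⟨M, hM⟩ := (isCompact_closedBall (0 : ℂ) R).exists_bound_of_continuousOn hδc.continuousOn
  set v := barrier δ R ε q with hv
  set c := Real.exp (-(v + R) / ε) with hc
  set B := Real.exp (v + R + ε * Real.log M) with hB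
  -- K contains every regular pair over the disc with barrier at most v: the penalty -ε log|δ|
  -- forces |δ| ≥ c, and the growth of log|η| forces |ν| ≤ B. Away from the zeros of δ the regular
  -- pairs are relatively closed, so K is compact.
  set K := {p : ℂ × ℂ | p ∈ closure T ∧ ‖p.1‖ ≤ R ∧ c ≤ ‖δ p.1‖ ∧ ‖p.2‖ ≤ B} with hK
  have hKT : ∀ p ∈ K, p ∈ T := fun p hp => mem_regularPairs_of_mem_closure hV hδ hp.1
    (norm_pos_iff.1 ((Real.exp_pos _).trans_le hp.2.2.1))
  have hmem : ∀ p ∈ T, ‖p.1‖ ≤ R → barrier δ R ε p ≤ v → p ∈ K := fun p hp hpR hpv => by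
    have hδp : 0 < ‖δ p.1‖ := norm_pos_iff.2 hp.1
    have h1 := comparison_le hR hpR
    have h2 := log_norm_eta_nonneg p.2
    have h3 : Real.log ‖δ p.1‖ ≤ Real.log M :=
      Real.log_le_log hδp (hM p.1 (mem_closedBall_zero_iff.2 hpR))
    have h4 : ε * Real.log ‖δ p.1‖ ≤ ε * Real.log M := by gcongr
    rw [barrier] at hpv
    refine ⟨subset_closure hp, hpR, ?_, ?_⟩
    · rw [hc, ← Real.le_log_iff_exp_le hδp, div_le_iff₀ hε]
      linarith
    · refine (norm_le_exp_log_norm_eta p.2).trans (Real.exp_le_exp.2 ?_)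
      linarith
  have hcl : IsClosed K := by
    have e : K = closure T ∩ {p | ‖p.1‖ ≤ R} ∩ ({p | c ≤ ‖δ p.1‖} ∩ {p | ‖p.2‖ ≤ B}) := by
      ext p
      simp only [hK, mem_ofPred_eq, mem_inter_iff, and_assoc]
    rw [e]
    refine (isClosed_closure.inter (isClosed_le continuous_fst.norm continuous_const)).inter
      ((isClosed_le continuous_const (hδc.comp continuous_fst).norm).inter
        (isClosed_le continuous_snd.norm continuous_const))
  have hcomp : IsCompact K := by
    refine ((isCompact_closedBall (0 : ℂ) R).prod (isCompact_closedBall (0 : ℂ) B)).of_isClosed_subset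
      hcl fun p hp => ?_
    exact ⟨mem_closedBall_zero_iff.2 hp.2.1, mem_closedBall_zero_iff.2 hp.2.2.2⟩
  have hcont : ContinuousOn (barrier δ R ε) K := by
    refine ContinuousOn.sub (ContinuousOn.sub ?_ ?_) (continuousOn_const.mul ?_)
    · exact (continuous_log_norm_eta.comp continuous_snd).continuousOn
    · exact ((continuous_comparison R).comp continuous_fst).continuousOn
    · exact ((hδc.comp continuous_fst).norm).continuousOn.log fun p hp =>
        norm_ne_zero_iff.2 (hKT p hp).1
  have hqK : q ∈ K := hmem q hq hqR le_rfl
  obtain ⟨q₀, hq₀, hmin⟩ := hcomp.exists_isMinOn ⟨q, hqK⟩ hcont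
  refine ⟨q₀, hKT q₀ hq₀, hq₀.2.1, fun p hp hpR => ?_⟩
  rcases le_total (barrier δ R ε p) v with h | h
  · exact hmin (hmem p hp hpR h)
  · exact (hmin hqK).trans h

/-- Off the band log|η(F)| is harmonic, as is log|δ| off its zeros, while the subtracted comparison
function is strictly subharmonic. A local minimum would contradict the mean value property. -/
theorem exists_barrier_lt (hδ : IsRegularizer (lyapunovMatrix V) δ)
    {S : Set (LyapunovSurface V)} {R ε : ℝ} (hR : 0 < R)
    {q : ℂ × ℂ} (hq : q ∈ regularPairs S δ) (hband : ¬ InBand q.2)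
    (hS : ∀ F z, GermIn S F z → ∀ᶠ w in 𝓝 z, GermIn S F w) :
    ∃ᶠ w in 𝓝 q.1, ∃ ν, (w, ν) ∈ regularPairs S δ ∧ barrier δ R ε (w, ν) < barrier δ R ε q := by
  obtain ⟨hδq, F, hF, hFq⟩ := hq
  intro hcon
  set P : ℂ → ℂ := fun w => ((R / 4 : ℝ) : ℂ) + (-(9 / 16) * w ^ 2 +
      (2 * starRingEnd ℂ q.1 * (w - q.1) + (‖q.1‖ ^ 2 : ℝ)) / 16) / R with hP
  have hPd : Differentiable ℂ P := by fun_prop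
  have h1 : InnerProductSpace.HarmonicAt (fun w => Real.log ‖eta (F w)‖) q.1 := by
    have ha : AnalyticAt ℂ (fun w => eta (F w)) q.1 :=
      (eta_analyticAt hband).comp_of_eq hF.1.1 hFq
    exact ha.harmonicAt_log_norm (eta_ne_zero _)
  have h2 : InnerProductSpace.HarmonicAt (fun w => Real.log ‖δ w‖) q.1 :=
    (hδ.differentiable.analyticAt q.1).harmonicAt_log_norm hδq
  have h3 : InnerProductSpace.HarmonicAt (fun w => (P w).re) q.1 :=
    (hPd.analyticAt q.1).harmonicAt_re
  refine not_eventually_add_le_of_harmonicAt ((h1.sub h3).sub (h2.const_smul (c := ε)))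
    (κ := 1 / (16 * R)) (by positivity) ?_
  filter_upwards [hcon, hS F _ hF,
    hδ.differentiable.continuous.continuousAt.eventually_ne hδq] with w hw hFw hδw
  have h4 : barrier δ R ε q ≤ barrier δ R ε (w, F w) := by
    by_contra hlt
    exact hw ⟨F w, ⟨hδw, F, hFw, rfl⟩, not_le.1 hlt⟩
  have h5 : comparison R q.1 = (P q.1).re := by
    rw [comparison_eq hR q.1, sub_self, norm_zero]
    simp [hP]
  have h6 : comparison R w = (P w).re + 1 / (16 * R) * ‖w - q.1‖ ^ 2 := comparison_eq hR q.1 w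
  simp only [barrier, h5, h6] at h4
  simp only [Pi.sub_apply, Pi.smul_apply, smul_eq_mul, hFq]
  linarith

/-- If the component avoids the band, the minimum of the barrier over |z| ≤ R must lie on |z| = R.
There the barrier is at least R/8 - C - ε log M, by the asymptotics of log|η|. At the starting point
it is at most u + |z|² - R/4 - ε log|δ z|, which is smaller for R large. -/
theorem exists_germIn_inBand (hV : IsPotential V) (hδ : IsRegularizer (lyapunovMatrix V) δ)
    (ζ : LyapunovSurface V) :
    ∃ F z, GermIn (connectedComponent ζ) F z ∧ InBand (F z) := by
  by_contra! hcon
  obtain ⟨F, z, hz, hF⟩ := exists_germIn hV hδ ζ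
  set T := regularPairs (connectedComponent ζ) δ with hT
  have hq : (z, F z) ∈ T := ⟨hz, F, hF, rfl⟩
  obtain ⟨C, ρ, hC, hρ, hbound⟩ := exists_lyapunovQ_bound hV
  set u := Real.log ‖eta (F z)‖ with hu
  have hu0 : 0 ≤ u := log_norm_eta_nonneg _
  set R := ρ + ‖z‖ + 8 * (u + C + ‖z‖ ^ 2 + 1) with hR
  have hzR : ‖z‖ ≤ R := by have := norm_nonneg z; nlinarith [sq_nonneg ‖z‖]
  have hρR : ρ ≤ R := by have := norm_nonneg z; nlinarith [sq_nonneg ‖z‖]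
  have hR1 : 1 ≤ R := hρ.trans hρR
  have hR0 : 0 < R := by linarith
  have hR8 : 8 * (u + C + ‖z‖ ^ 2 + 1) ≤ R := by have := norm_nonneg z; linarith
  obtain ⟨M, hM⟩ := (isCompact_closedBall (0 : ℂ) R).exists_bound_of_continuousOn
    hδ.differentiable.continuous.continuousOn
  have hlogM : ∀ w, δ w ≠ 0 → ‖w‖ ≤ R → Real.log ‖δ w‖ ≤ Real.log M := fun w hw hwR =>
    Real.log_le_log (norm_pos_iff.2 hw) (hM w (mem_closedBall_zero_iff.2 hwR))
  set D := Real.log M - Real.log ‖δ z‖ with hD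
  have hD0 : 0 ≤ D := sub_nonneg.2 (hlogM z hz hzR)
  -- So small that replacing log|δ z| by its bound log M changes the penalty by less than 1.
  set ε := 1 / (D + 1) with hε
  have hε0 : 0 < ε := by positivity
  have hεD : ε * D < 1 := by
    rw [hε, one_div, inv_mul_lt_iff₀ (by positivity)]; linarith
  obtain ⟨q₀, hq₀, hq₀R, hmin⟩ := exists_isMinOn_barrier hV hδ hR0 hε0 hq hzR
  rcases hq₀R.eq_or_lt with heq | hlt
  · have h1 := hmin _ hq hzR
    obtain ⟨hδ0, G, hG, hGq⟩ := hq₀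
    have h2 := hbound q₀.1 q₀.2 (heq ▸ hρR) (hGq ▸ hG.1.2.self_of_nhds)
    rw [heq] at h2
    have h3 := abs_im_sub_comparison_ge hR0 heq
    have h4 := neg_comparison_le hR1 z
    have h5 := mul_le_mul_of_nonneg_left (hlogM q₀.1 hδ0 hq₀R) hε0.le
    have h6 : C / R ≤ C := div_le_self hC hR1
    have h7 := (abs_le.1 h2).1
    rw [hD, mul_sub] at hεD
    simp only [barrier] at h1
    linarith
  · obtain ⟨hδ0, G, hG, hGq⟩ := hq₀
    have hnb : ¬ InBand q₀.2 := hGq ▸ hcon G _ hG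
    have hex := exists_barrier_lt (ε := ε) hδ hR0 ⟨hδ0, G, hG, hGq⟩ hnb
      fun F z (h : GermIn (connectedComponent ζ) F z) => h.eventually
    obtain ⟨w, ⟨ν, hw, hwlt⟩, hwR⟩ := (hex.and_eventually
      (continuous_norm.continuousAt.eventually (gt_mem_nhds hlt))).exists
    exact absurd (hmin _ hw hwR.le) (not_le.2 hwlt)

theorem frequently_inBand {ν : ℂ} (h : InBand ν) : ∃ᶠ w in 𝓝[≠] ν, InBand w := by
  have hc : Tendsto (fun x : ℝ => (x : ℂ)) (𝓝[≠] ν.re) (𝓝[≠] ν) := by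
    refine tendsto_nhdsWithin_iff.2 ⟨?_, ?_⟩
    · have : ((ν.re : ℝ) : ℂ) = ν := Complex.ext rfl (by simp [h.1])
      exact (this ▸ Complex.continuous_ofReal.tendsto ν.re).mono_left nhdsWithin_le_nhds
    · filter_upwards [self_mem_nhdsWithin] with x hx hxν
      exact hx (by rw [mem_singleton_iff, ← hxν, Complex.ofReal_re])
  refine hc.frequently ?_
  have hac : AccPt ν.re (𝓟 (Icc (-1 : ℝ) 1)) :=
    (convex_Icc (-1 : ℝ) 1).isPreconnected.preperfect_of_nontrivial
      ⟨-1, by simp, 1, by simp, by norm_num⟩ _ h.2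
  exact (accPt_iff_frequently_nhdsNE.1 hac).mono fun x hx => ⟨Complex.ofReal_im x, by simpa using hx⟩

/-- A germ with value in the band sits at a real z, and nearby it takes band values at real points
only. As F is open, such points accumulate at z; there F and its reflection have the same real
value, and the identity theorem applies. -/
theorem exists_germIn_conj_eq (hV : IsPotential V)
    (hbottom : IsLeast {μ : ℝ | (μ : ℂ) ∈ operatorSpectrum V} 0) (ζ : LyapunovSurface V) :
    ∃ F z, GermIn (connectedComponent ζ) F z ∧ starRingEnd ℂ z = z ∧
      F =ᶠ[𝓝 z] fun w => starRingEnd ℂ (F (starRingEnd ℂ w)) := by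
  obtain ⟨δ, hδ⟩ := exists_isRegularizer (lyapunovMatrix_differentiable hV)
  obtain ⟨F, z, hF, hband⟩ := exists_germIn_inBand hV hδ ζ
  have hreal : ∀ᶠ w in 𝓝 z, InBand (F w) → w.im = 0 := by
    filter_upwards [hF.1.2] with w hw hb
    by_contra him
    exact not_inBand hV hbottom hw him hb
  have hz : starRingEnd ℂ z = z := Complex.conj_eq_iff_im.2 (hreal.self_of_nhds hband)
  refine ⟨F, z, hF, hz, ?_⟩
  have hopen : 𝓝 (F z) ≤ map F (𝓝 z) := by
    -- Were F constant near z, nonreal points would carry a band value.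
    refine hF.1.1.eventually_constant_or_nhds_le_map_nhds.resolve_left fun hconst => ?_
    have ht : Tendsto (fun t : ℝ => z + t * Complex.I) (𝓝[≠] 0) (𝓝 z) := by
      have : ContinuousAt (fun t : ℝ => z + t * Complex.I) 0 := by fun_prop
      rw [ContinuousAt, Complex.ofReal_zero, zero_mul, add_zero] at this
      exact this.mono_left nhdsWithin_le_nhds
    obtain ⟨t, ⟨ht1, ht2⟩, ht0⟩ := ((ht.eventually (hconst.and hreal)).and
      self_mem_nhdsWithin).exists
    have := ht2 (ht1 ▸ hband)
    rw [Complex.conj_eq_iff_im] at hz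
    exact ht0 (by simpa [hz] using this)
  have hfreq : ∃ᶠ w in 𝓝[≠] z, F w = starRingEnd ℂ (F (starRingEnd ℂ w)) := by
    have h1 : ∃ᶠ b in 𝓝 (F z), InBand b ∧ b ≠ F z :=
      frequently_nhdsWithin_iff.1 (frequently_inBand hband)
    have h2 : ∃ᶠ w in 𝓝 z, InBand (F w) ∧ F w ≠ F z := frequently_map.1 (h1.filter_mono hopen)
    rw [frequently_nhdsWithin_iff]
    refine (h2.and_eventually hreal).mono fun w hw => ⟨?_, fun hwz => hw.1.2 (hwz ▸ rfl)⟩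
    rw [Complex.conj_eq_iff_im.2 (hw.2 hw.1.1), Complex.conj_eq_iff_im.2 hw.1.1.1]
  refine (AnalyticAt.frequently_eq_iff_eventually_eq hF.1.1 ?_).1 hfreq
  have := analyticAt_conj_conj hF.1.1
  rwa [hz] at this

/-- Each component is its own mirror image; this is what puts the reflected branch of case ii) into
the same component. -/
theorem GermIn.conj_of_isLeast (hV : IsPotential V)
    (hbottom : IsLeast {μ : ℝ | (μ : ℂ) ∈ operatorSpectrum V} 0) {ζ : LyapunovSurface V}
    {G : ℂ → ℂ} {w : ℂ} (hG : GermIn (connectedComponent ζ) G w) :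
    GermIn (connectedComponent ζ) (fun w => starRingEnd ℂ (G (starRingEnd ℂ w)))
      (starRingEnd ℂ w) := by
  obtain ⟨F, z, hF, hz, hFe⟩ := exists_germIn_conj_eq hV hbottom ζ
  refine hF.conj hV ?_ hG
  rw [hz]
  exact hF.congr hFe

end

section

/-! ### Reflection of the quasimomentum -/

theorem exists_int_of_exp_eq_one {H : Set ℂ} (hH : IsPreconnected H) {d : ℂ → ℂ}
    (hd : ContinuousOn d H) (h : ∀ w ∈ H, Complex.exp (-Complex.I * d w) = 1) :
    ∃ n : ℤ, ∀ w ∈ H, d w = 2 * Real.pi * n := by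
  rcases H.eq_empty_or_nonempty with rfl | ⟨w₀, hw₀⟩
  · exact ⟨0, by simp⟩
  have h1 : ∀ w ∈ H, ∃ n : ℤ, d w = 2 * Real.pi * n := fun w hw => by
    obtain ⟨n, hn⟩ := Complex.exp_eq_one_iff.1 (h w hw)
    refine ⟨-n, ?_⟩
    push_cast
    linear_combination Complex.I * hn + (d w + 2 * Real.pi * n) * Complex.I_sq
  obtain ⟨n, hn⟩ := h1 w₀ hw₀
  refine ⟨n, fun w hw => ?_⟩
  have hm : MapsTo (fun w => (d w).re) H (AddSubgroup.zmultiples (2 * Real.pi) : Set ℝ) :=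
    fun w hw => by
      obtain ⟨m, hm⟩ := h1 w hw
      exact ⟨m, by simp [hm, mul_comm]⟩
  have h2 := hH.constant_of_mapsTo ⟨inferInstanceAs (DiscreteTopology (AddSubgroup.zmultiples (2 * Real.pi)))⟩
    (Complex.continuous_re.comp_continuousOn hd) hm hw hw₀
  obtain ⟨m, hm⟩ := h1 w hw
  rw [← hn]
  refine Complex.ext h2 ?_
  simp [hm, hn]

theorem isPreconnected_ball_inter_im (x : ℂ) (r : ℝ) :
    IsPreconnected (Metric.ball x r ∩ {w | 0 < w.im}) :=
  ((convex_ball x r).inter (convex_halfSpace_im_gt 0)).isPreconnected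

theorem nhdsWithin_im_neBot {x : ℂ} (hx : x.im = 0) : (𝓝[{w : ℂ | 0 < w.im}] x).NeBot := by
  have ht : Tendsto (fun t : ℝ => x + t * Complex.I) (𝓝[>] 0) (𝓝[{w : ℂ | 0 < w.im}] x) := by
    refine tendsto_nhdsWithin_iff.2 ⟨?_, ?_⟩
    · have : ContinuousAt (fun t : ℝ => x + t * Complex.I) 0 := by fun_prop
      rw [ContinuousAt, Complex.ofReal_zero, zero_mul, add_zero] at this
      exact this.mono_left nhdsWithin_le_nhds
    · filter_upwards [self_mem_nhdsWithin] with t ht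
      simpa [hx] using ht
  exact ht.neBot

theorem nhdsWithin_im_le_nhdsNE {x : ℂ} (hx : x.im = 0) :
    𝓝[{w : ℂ | 0 < w.im}] x ≤ 𝓝[≠] x :=
  nhdsWithin_mono x fun w hw hwx => by
    rw [mem_singleton_iff.1 hwx] at hw
    exact hw.ne' hx

theorem eventually_eq_of_upper {φ ψ : ℂ → ℂ} {x : ℂ} (hx : x.im = 0) (hφ : AnalyticAt ℂ φ x)
    (hψ : AnalyticAt ℂ ψ x) (h : ∀ᶠ w in 𝓝 x, 0 < w.im → φ w = ψ w) : φ =ᶠ[𝓝 x] ψ := by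
  have := nhdsWithin_im_neBot hx
  have h' : ∀ᶠ w in 𝓝[{w : ℂ | 0 < w.im}] x, φ w = ψ w := eventually_nhdsWithin_iff.2 h
  exact (hφ.frequently_eq_iff_eventually_eq hψ).1
    (h'.frequently.filter_mono (nhdsWithin_im_le_nhdsNE hx))

theorem eventually_eq_of_real {φ ψ : ℂ → ℂ} {x : ℂ} (hx : x.im = 0) (hφ : AnalyticAt ℂ φ x)
    (hψ : AnalyticAt ℂ ψ x) (h : ∀ᶠ w in 𝓝 x, w.im = 0 → φ w = ψ w) : φ =ᶠ[𝓝 x] ψ := by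
  have ht : Tendsto (fun t : ℝ => x + t) (𝓝[≠] 0) (𝓝[≠] x) := by
    refine tendsto_nhdsWithin_iff.2 ⟨?_, ?_⟩
    · have : ContinuousAt (fun t : ℝ => x + t) 0 := by fun_prop
      rw [ContinuousAt, Complex.ofReal_zero, add_zero] at this
      exact this.mono_left nhdsWithin_le_nhds
    · filter_upwards [self_mem_nhdsWithin] with t ht
      simpa using ht
  refine (hφ.frequently_eq_iff_eventually_eq hψ).1 (ht.frequently ?_)
  refine Eventually.frequently ?_
  filter_upwards [(ht.mono_right nhdsWithin_le_nhds).eventually h] with t ht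
  exact ht (by simp [hx])

theorem tendsto_conj_nhds {x : ℂ} (hx : x.im = 0) : Tendsto (starRingEnd ℂ) (𝓝 x) (𝓝 x) := by
  have := Complex.continuous_conj.tendsto x
  rwa [Complex.conj_eq_iff_im.2 hx] at this

theorem analyticAt_conj_of_im_eq_zero {f : ℂ → ℂ} {x : ℂ} (hx : x.im = 0)
    (hf : AnalyticAt ℂ f x) :
    AnalyticAt ℂ (fun w => starRingEnd ℂ (f (starRingEnd ℂ w))) x := by
  have := analyticAt_conj_conj hf
  rwa [Complex.conj_eq_iff_im.2 hx] at this

/-- A logarithm of an analytic function on the upper side of a real point extends analytically. -/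
theorem exists_analyticAt_exp_eq {θ k : ℂ → ℂ} {x : ℂ} (hθ : AnalyticAt ℂ θ x) (hθx : θ x ≠ 0)
    (hk : ∀ᶠ w in 𝓝 x, 0 < w.im → ContinuousAt k w ∧ Complex.exp (-Complex.I * k w) = θ w) :
    ∃ φ : ℂ → ℂ, AnalyticAt ℂ φ x ∧ (∀ᶠ w in 𝓝 x, Complex.exp (-Complex.I * φ w) = θ w) ∧
      ∀ᶠ w in 𝓝 x, 0 < w.im → φ w = k w := by
  -- Dividing by θ(x) places the principal logarithm near 1, away from its cut. Any other logarithm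
  -- on the half disc differs from φ by a constant in 2πℤ.
  set φ : ℂ → ℂ := fun w => Complex.I * (Complex.log (θ w / θ x) + Complex.log (θ x)) with hφ
  have hφa : AnalyticAt ℂ φ x := by
    have : AnalyticAt ℂ (fun w => Complex.log (θ w / θ x)) x := by
      refine (hθ.div analyticAt_const hθx).clog ?_
      rw [Pi.div_apply, div_self hθx]
      exact Complex.one_mem_slitPlane
    exact analyticAt_const.mul (this.add analyticAt_const)
  have hexp : ∀ᶠ w in 𝓝 x, Complex.exp (-Complex.I * φ w) = θ w := by
    filter_upwards [hθ.continuousAt.eventually_ne hθx] with w hw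
    rw [hφ, ← mul_assoc, neg_mul, Complex.I_mul_I, neg_neg, one_mul, Complex.exp_add,
      Complex.exp_log (div_ne_zero hw hθx), Complex.exp_log hθx, div_mul_cancel₀ _ hθx]
  obtain ⟨r, hr, hb⟩ := Metric.eventually_nhds_iff_ball.1
    ((hk.and hexp).and hφa.eventually_analyticAt)
  obtain ⟨n, hn⟩ := exists_int_of_exp_eq_one (d := fun w => k w - φ w)
    (isPreconnected_ball_inter_im x r)
    (fun w hw => (((hb w hw.1).1.1 hw.2).1.sub
      (hb w hw.1).2.continuousAt).continuousWithinAt) fun w hw => by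
      have h1 := ((hb w hw.1).1.1 hw.2).2
      have h2 := (hb w hw.1).1.2
      rw [mul_sub, Complex.exp_sub, h1, h2, div_self]
      rw [← h1]
      exact Complex.exp_ne_zero _
  refine ⟨fun w => φ w + 2 * Real.pi * n, hφa.add analyticAt_const, ?_, ?_⟩
  · filter_upwards [hexp] with w hw
    rw [← hw]
    refine Complex.exp_eq_exp_iff_exists_int.2 ⟨-n, ?_⟩
    push_cast
    ring
  · filter_upwards [Metric.ball_mem_nhds x hr] with w hw him
    rw [← hn w ⟨hw, him⟩]
    ring

/-- The extension of `k₁` from the upper half plane with `2πn - conj k₂(conj z)` on the lower half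
plane. -/
def reflectGlue (k₁ k₂ : ℂ → ℂ) (n : ℤ) (z : ℂ) : ℂ :=
  if 0 < z.im then k₁ z else
    if z.im < 0 then 2 * Real.pi * n - starRingEnd ℂ (k₂ (starRingEnd ℂ z)) else
      limUnder (𝓝[{w : ℂ | 0 < w.im}] z) k₁

/-- `k₁` and `k₂` extend analytically to a neighbourhood of `x`, with the reflection relation
`k₁(z) + conj k₂(conj z) = 2πn`. -/
def IsReflectedAt (θ₁ θ₂ k₁ k₂ : ℂ → ℂ) (x : ℂ) (n : ℤ) : Prop :=
  ∃ φ₁ φ₂ : ℂ → ℂ, AnalyticAt ℂ φ₁ x ∧ AnalyticAt ℂ φ₂ x ∧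
    (∀ᶠ w in 𝓝 x, 0 < w.im → φ₁ w = k₁ w) ∧ (∀ᶠ w in 𝓝 x, 0 < w.im → φ₂ w = k₂ w) ∧
    (∀ᶠ w in 𝓝 x, Complex.exp (-Complex.I * φ₁ w) = θ₁ w) ∧
    (∀ᶠ w in 𝓝 x, Complex.exp (-Complex.I * φ₂ w) = θ₂ w) ∧
    ∀ᶠ w in 𝓝 x, φ₁ w + starRingEnd ℂ (φ₂ (starRingEnd ℂ w)) = 2 * Real.pi * n

/-! ### Gluing quasimomenta along the real axis -/

section Reflection

variable {θ₁ θ₂ k₁ k₂ : ℂ → ℂ} {x : ℂ} {n m : ℤ}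

theorem IsReflectedAt.symm (hx : x.im = 0) (h : IsReflectedAt θ₁ θ₂ k₁ k₂ x n) :
    IsReflectedAt θ₂ θ₁ k₂ k₁ x n := by
  obtain ⟨φ₁, φ₂, h1, h2, h3, h4, h5, h6, h7⟩ := h
  refine ⟨φ₂, φ₁, h2, h1, h4, h3, h6, h5, ?_⟩
  filter_upwards [(tendsto_conj_nhds hx).eventually h7] with w hw
  have := congrArg (starRingEnd ℂ) hw
  simp only [map_add, map_mul, Complex.conj_conj, Complex.conj_ofReal, map_ofNat, map_intCast]
    at this
  rw [← this, add_comm]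

theorem IsReflectedAt.eventually (h : IsReflectedAt θ₁ θ₂ k₁ k₂ x n) :
    ∀ᶠ y in 𝓝 x, IsReflectedAt θ₁ θ₂ k₁ k₂ y n := by
  obtain ⟨φ₁, φ₂, h1, h2, h3, h4, h5, h6, h7⟩ := h
  filter_upwards [h1.eventually_analyticAt, h2.eventually_analyticAt, h3.eventually_nhds,
    h4.eventually_nhds, h5.eventually_nhds, h6.eventually_nhds, h7.eventually_nhds]
    with y e1 e2 e3 e4 e5 e6 e7
  exact ⟨φ₁, φ₂, e1, e2, e3, e4, e5, e6, e7⟩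

theorem limUnder_eq_of_upper {φ k : ℂ → ℂ} (hx : x.im = 0) (hφ : ContinuousAt φ x)
    (h : ∀ᶠ w in 𝓝 x, 0 < w.im → φ w = k w) :
    limUnder (𝓝[{w : ℂ | 0 < w.im}] x) k = φ x := by
  have := nhdsWithin_im_neBot hx
  refine Tendsto.limUnder_eq ((hφ.mono_left nhdsWithin_le_nhds).congr' ?_)
  exact eventually_nhdsWithin_iff.2 h

/-- Any extensions take at x the one-sided limits of k₁ and k₂, which determines the sum and hence
n. This makes n locally constant along an interval. -/
theorem IsReflectedAt.unique (hx : x.im = 0) (h : IsReflectedAt θ₁ θ₂ k₁ k₂ x n)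
    (h' : IsReflectedAt θ₁ θ₂ k₁ k₂ x m) : n = m := by
  obtain ⟨φ₁, φ₂, h1, h2, h3, h4, -, -, h7⟩ := h
  obtain ⟨φ₁', φ₂', h1', h2', h3', h4', -, -, h7'⟩ := h'
  have e1 := (limUnder_eq_of_upper hx h1.continuousAt h3).symm.trans
    (limUnder_eq_of_upper hx h1'.continuousAt h3')
  have e2 := (limUnder_eq_of_upper hx h2.continuousAt h4).symm.trans
    (limUnder_eq_of_upper hx h2'.continuousAt h4')
  have e3 := h7.self_of_nhds
  rw [Complex.conj_eq_iff_im.2 hx, e1, e2] at e3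
  have e4 := h7'.self_of_nhds
  rw [Complex.conj_eq_iff_im.2 hx, e3] at e4
  have h2pi : (2 * Real.pi : ℂ) ≠ 0 := by
    simp [Real.pi_ne_zero]
  exact_mod_cast mul_left_cancel₀ h2pi e4

/-- For φ₂ with e^{-iφ₂} = θ₂, the exponential of -i conj φ₂(conj w) is the inverse of conj θ₂(conj
w) = θ₁(w). So φ₁ + conj φ₂(conj w) takes values in 2πℤ and is constant on a disc. -/
theorem exists_isReflectedAt (hx : x.im = 0) (hθ₁ : AnalyticAt ℂ θ₁ x) (hθ₂ : AnalyticAt ℂ θ₂ x)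
    (hne : θ₁ x ≠ 0)
    (hconj : ∀ᶠ w in 𝓝 x, starRingEnd ℂ (θ₂ (starRingEnd ℂ w)) = θ₁ w)
    (hk₁ : ∀ᶠ w in 𝓝 x, 0 < w.im → ContinuousAt k₁ w ∧ Complex.exp (-Complex.I * k₁ w) = θ₁ w)
    (hk₂ : ∀ᶠ w in 𝓝 x, 0 < w.im → ContinuousAt k₂ w ∧ Complex.exp (-Complex.I * k₂ w) = θ₂ w) :
    ∃ n, IsReflectedAt θ₁ θ₂ k₁ k₂ x n := by
  have hne₂ : θ₂ x ≠ 0 := fun h0 => hne (by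
    rw [← hconj.self_of_nhds, Complex.conj_eq_iff_im.2 hx, h0, map_zero])
  obtain ⟨φ₁, a1, b1, c1⟩ := exists_analyticAt_exp_eq hθ₁ hne hk₁
  obtain ⟨φ₂, a2, b2, c2⟩ := exists_analyticAt_exp_eq hθ₂ hne₂ hk₂
  have ha : AnalyticAt ℂ (fun w => φ₁ w + starRingEnd ℂ (φ₂ (starRingEnd ℂ w))) x :=
    a1.add (analyticAt_conj_of_im_eq_zero hx a2)
  obtain ⟨r, hr, hb⟩ := Metric.eventually_nhds_iff_ball.1
    (((b1.and ((tendsto_conj_nhds hx).eventually b2)).and hconj).and ha.eventually_analyticAt)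
  obtain ⟨n, hn⟩ := exists_int_of_exp_eq_one (convex_ball x r).isPreconnected
    (fun w hw => (hb w hw).2.continuousAt.continuousWithinAt) fun w hw => by
      obtain ⟨⟨⟨h1, h2⟩, h3⟩, -⟩ := hb w hw
      have h4 : Complex.exp (-Complex.I * starRingEnd ℂ (φ₂ (starRingEnd ℂ w))) =
          (starRingEnd ℂ (θ₂ (starRingEnd ℂ w)))⁻¹ := by
        rw [← h2, ← Complex.exp_conj, ← Complex.exp_neg, map_mul, map_neg, Complex.conj_I]
        ring_nf
      rw [mul_add, Complex.exp_add, h1, h4, h3, mul_inv_cancel₀]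
      rw [← h1]
      exact Complex.exp_ne_zero _
  exact ⟨n, φ₁, φ₂, a1, a2, c1, c2, b1, b2, by
    filter_upwards [Metric.ball_mem_nhds x hr] with w hw using hn w hw⟩

/-- Near x the glued function is the local extension φ₁: by agreement above the axis, by the
reflection relation below it, and as a one-sided limit on it. -/
theorem IsReflectedAt.reflectGlue (hx : x.im = 0) (h : IsReflectedAt θ₁ θ₂ k₁ k₂ x n) :
    AnalyticAt ℂ (reflectGlue k₁ k₂ n) x ∧
      Complex.exp (-Complex.I * reflectGlue k₁ k₂ n x) = θ₁ x ∧
      reflectGlue k₁ k₂ n x + starRingEnd ℂ (reflectGlue k₂ k₁ n x) = 2 * Real.pi * n := by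
  have hv : ∀ {θ₁ θ₂ k₁ k₂ φ₁ φ₂ : ℂ → ℂ}, AnalyticAt ℂ φ₁ x →
      (∀ᶠ w in 𝓝 x, 0 < w.im → φ₁ w = k₁ w) →
      (∀ᶠ w in 𝓝 x, 0 < w.im → φ₂ w = k₂ w) →
      (∀ᶠ w in 𝓝 x, φ₁ w + starRingEnd ℂ (φ₂ (starRingEnd ℂ w)) = 2 * Real.pi * n) →
      φ₁ =ᶠ[𝓝 x] PeriodicMatrixSchrodinger.reflectGlue k₁ k₂ n := by
    intro θ₁ θ₂ k₁ k₂ φ₁ φ₂ h1 h3 h4 h7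
    filter_upwards [h1.eventually_analyticAt, h3.eventually_nhds,
      (tendsto_conj_nhds hx).eventually h4, h7] with w e1 e3 e4 e7
    rw [PeriodicMatrixSchrodinger.reflectGlue]
    split_ifs with h8 h9
    · exact e3.self_of_nhds h8
    · rw [← e7, ← e4 (by simpa using h9)]
      ring
    · exact (limUnder_eq_of_upper (le_antisymm (not_lt.1 h8) (not_lt.1 h9)) e1.continuousAt e3).symm
  obtain ⟨φ₁', φ₂', h1', h2', h3', h4', -, -, h7'⟩ := h.symm hx
  obtain ⟨φ₁, φ₂, h1, h2, h3, h4, h5, -, h7⟩ := h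
  have hg := hv (θ₁ := θ₁) (θ₂ := θ₂) h1 h3 h4 h7
  have hg' := hv (θ₁ := θ₁) (θ₂ := θ₂) h1' h3' h4' h7'
  have e1 := (limUnder_eq_of_upper hx h2.continuousAt h4).symm.trans
    (limUnder_eq_of_upper hx h1'.continuousAt h3')
  refine ⟨h1.congr hg, ?_, ?_⟩
  · rw [← hg.self_of_nhds]
    exact h5.self_of_nhds
  · rw [← hg.self_of_nhds, ← hg'.self_of_nhds, ← e1, ← h7.self_of_nhds,
      Complex.conj_eq_iff_im.2 hx]

end Reflection

theorem mem_realInterval {α β : ℝ} {z : ℂ} :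
    z ∈ realInterval α β ↔ z.im = 0 ∧ z.re ∈ Ioo α β := by
  constructor
  · rintro ⟨t, ht, rfl⟩
    exact ⟨Complex.ofReal_im t, by simpa using ht⟩
  · rintro ⟨h1, h2⟩
    exact ⟨z.re, h2, Complex.ext (Complex.ofReal_re _) (by simp [h1])⟩

theorem eventually_mem_realInterval {α β : ℝ} {x : ℂ} (hx : x ∈ realInterval α β) :
    ∀ᶠ w in 𝓝 x, w.im = 0 → w ∈ realInterval α β := by
  filter_upwards [Complex.continuous_re.continuousAt.eventually
    (isOpen_Ioo.mem_nhds (mem_realInterval.1 hx).2)] with w hw h0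
  exact mem_realInterval.2 ⟨h0, hw⟩

theorem eventually_mem_cutUpper_of_im_eq_zero (hV : IsPotential V) {x : ℂ} (hx : x.im = 0) :
    ∀ᶠ w in 𝓝 x, 0 < w.im → w ∈ cutUpper V := by
  have : ((x.re : ℝ) : ℂ) = x := Complex.ext rfl (by simp [hx])
  exact this ▸ eventually_mem_cutUpper_ofReal hV x.re

/-- Schwarz reflection works off the band, where η is analytic and commutes with conjugation. The
integer produced at each real point is locally constant, so one n serves the whole interval. Case i)
takes both functions equal, case ii) takes a branch and its reflection. -/
theorem exists_reflectGlue_analytic (hV : IsPotential V) {ψ₁ ψ₂ k₁ k₂ : ℂ → ℂ} {α β : ℝ}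
    (hαβ : α < β) (hψ₁ : AnalyticOnNhd ℂ ψ₁ (cutUpper V ∪ realInterval α β))
    (hψ₂ : AnalyticOnNhd ℂ ψ₂ (cutUpper V ∪ realInterval α β))
    (hconj : ∀ z ∈ realInterval α β, starRingEnd ℂ (ψ₂ z) = ψ₁ z)
    (hband : ∀ z ∈ realInterval α β, ¬ InBand (ψ₁ z))
    (hk₁ : IsQuasimomentum V ψ₁ k₁) (hk₂ : IsQuasimomentum V ψ₂ k₂) :
    ∃ n : ℤ, AnalyticOnNhd ℂ (reflectGlue k₁ k₂ n)
        (cutUpper V ∪ cutLower V ∪ realInterval α β) ∧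
      ∀ z ∈ realInterval α β, Complex.exp (-Complex.I * reflectGlue k₁ k₂ n z) = eta (ψ₁ z) ∧
        reflectGlue k₁ k₂ n z + starRingEnd ℂ (reflectGlue k₂ k₁ n z) = 2 * Real.pi * n ∧
        AnalyticAt ℂ (reflectGlue k₂ k₁ n) z := by
  have hk : ∀ {ψ k : ℂ → ℂ}, IsQuasimomentum V ψ k → ∀ x ∈ realInterval α β,
      ∀ᶠ w in 𝓝 x, 0 < w.im → ContinuousAt k w ∧
        Complex.exp (-Complex.I * k w) = eta (ψ w) := fun {ψ k} hk x hx => by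
    filter_upwards [eventually_mem_cutUpper_of_im_eq_zero hV (mem_realInterval.1 hx).1]
      with w hw him
    exact ⟨(hk.1 w (hw him)).continuousAt, hk.2 w (hw him)⟩
  have hconj' : ∀ x ∈ realInterval α β,
      (fun w => starRingEnd ℂ (ψ₂ (starRingEnd ℂ w))) =ᶠ[𝓝 x] ψ₁ := fun x hx => by
    have h0 := (mem_realInterval.1 hx).1
    refine eventually_eq_of_real h0 (analyticAt_conj_of_im_eq_zero h0 (hψ₂ x (Or.inr hx)))
      (hψ₁ x (Or.inr hx)) ?_
    filter_upwards [eventually_mem_realInterval hx] with w hw hw0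
    rw [Complex.conj_eq_iff_im.2 hw0]
    exact hconj w (hw hw0)
  have hband₂ : ∀ {w : ℂ}, ¬ InBand (starRingEnd ℂ w) → ¬ InBand w := fun h h' => h (by
    simpa [InBand] using h')
  have hex : ∀ x ∈ realInterval α β, ∃ n,
      IsReflectedAt (fun w => eta (ψ₁ w)) (fun w => eta (ψ₂ w)) k₁ k₂ x n := fun x hx => by
    have h0 := (mem_realInterval.1 hx).1
    have hb2 : ¬ InBand (ψ₂ x) := hband₂ (hconj x hx ▸ hband x hx)
    refine exists_isReflectedAt h0
      ((eta_analyticAt (hband x hx)).comp_of_eq (hψ₁ x (Or.inr hx)) rfl)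
      ((eta_analyticAt hb2).comp_of_eq (hψ₂ x (Or.inr hx)) rfl) (eta_ne_zero _) ?_
      (hk hk₁ x hx) (hk hk₂ x hx)
    have hb2' : ∀ᶠ w in 𝓝 x, ¬ InBand (ψ₂ (starRingEnd ℂ w)) := by
      have h1 : ∀ᶠ w in 𝓝 x, ‖eta (ψ₂ w)‖ ≠ 1 :=
        (continuous_norm_eta.continuousAt.comp (hψ₂ x (Or.inr hx)).continuousAt).eventually_ne
          (one_lt_norm_eta hb2).ne'
      filter_upwards [(tendsto_conj_nhds h0).eventually h1] with w hw hb
      exact hw ((norm_eta_eq_one_iff _).2 hb)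
    filter_upwards [hb2', hconj' x hx] with w hw1 hw2
    rw [← eta_conj hw1]
    exact congrArg eta hw2
  have hmid : (((α + β) / 2 : ℝ) : ℂ) ∈ realInterval α β :=
    ⟨_, ⟨by linarith, by linarith⟩, rfl⟩
  obtain ⟨n, hn⟩ := hex _ hmid
  have hopen : ∀ n, IsOpen {t : ℝ | IsReflectedAt (fun w => eta (ψ₁ w)) (fun w => eta (ψ₂ w))
      k₁ k₂ (t : ℂ) n} := fun n => isOpen_iff_mem_nhds.2 fun t ht =>
    Complex.continuous_ofReal.continuousAt.eventually ht.eventually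
  have hall : Ioo α β ⊆ {t : ℝ | IsReflectedAt (fun w => eta (ψ₁ w)) (fun w => eta (ψ₂ w))
      k₁ k₂ (t : ℂ) n} := by
    refine isPreconnected_Ioo.subset_of_closure_inter_subset (hopen n)
      ⟨(α + β) / 2, ⟨by linarith, by linarith⟩, hn⟩ ?_
    rintro t ⟨ht, htI⟩
    obtain ⟨m, hm⟩ := hex t ⟨t, htI, rfl⟩
    obtain ⟨s, hs1, hs2⟩ := mem_closure_iff_nhds.1 ht _ ((hopen m).mem_nhds hm)
    rw [mem_ofPred_eq, hs2.unique (Complex.ofReal_im s) hs1]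
    exact hm
  have hrefl : ∀ z ∈ realInterval α β,
      IsReflectedAt (fun w => eta (ψ₁ w)) (fun w => eta (ψ₂ w)) k₁ k₂ z n := by
    rintro _ ⟨t, ht, rfl⟩
    exact hall ht
  refine ⟨n, ?_, fun z hz => ?_⟩
  · rintro z ((hz | hz) | hz)
    · refine (hk₁.1 z hz).congr ?_
      filter_upwards [Complex.continuous_im.continuousAt.eventually (lt_mem_nhds hz.1)] with w hw
      rw [reflectGlue, if_pos hw]
    · have h1 := analyticAt_conj_conj (hk₂.1 _ ((mem_cutLower_iff hV).1 hz))
      rw [Complex.conj_conj] at h1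
      have h2 : AnalyticAt ℂ (fun w => 2 * Real.pi * n - starRingEnd ℂ (k₂ (starRingEnd ℂ w))) z :=
        analyticAt_const.sub h1
      refine h2.congr ?_
      filter_upwards [Complex.continuous_im.continuousAt.eventually (gt_mem_nhds hz.1)] with w hw
      rw [reflectGlue, if_neg (not_lt.2 (le_of_lt hw)), if_pos hw]
    · exact ((hrefl z hz).reflectGlue (mem_realInterval.1 hz).1).1
  · have h0 := (mem_realInterval.1 hz).1
    obtain ⟨-, h1, h2⟩ := (hrefl z hz).reflectGlue h0
    exact ⟨h1, h2, (((hrefl z hz).symm h0).reflectGlue h0).1⟩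

end

section

/-! ### The branches on the cut half plane -/

section Branches

variable {Δ : Fin N → ℂ → ℂ}

theorem IsLyapunovBranches.mem_values (hΔ : IsLyapunovBranches V Δ) {z : ℂ} (hz : z ∈ cutUpper V)
    (m : Fin N) : Δ m z ∈ lyapunovValues V z := by
  obtain ⟨τ, hτ, h⟩ := exists_joukowski (Δ m z)
  have h1 := hΔ.factor z hz τ hτ
  rw [Finset.prod_eq_zero (Finset.mem_univ m) (by rw [h, sub_self]), div_eq_zero_iff] at h1
  exact ⟨τ, hτ, h1.resolve_right (pow_ne_zero _ (mul_ne_zero two_ne_zero hτ)), h⟩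

theorem IsLyapunovBranches.exists_eq (hΔ : IsLyapunovBranches V Δ) {z ν : ℂ} (hz : z ∈ cutUpper V)
    (hν : ν ∈ lyapunovValues V z) : ∃ m, ν = Δ m z := by
  obtain ⟨τ, hτ, hd, rfl⟩ := hν
  have h1 := hΔ.factor z hz τ hτ
  rw [hd, zero_div, eq_comm, Finset.prod_eq_zero_iff] at h1
  obtain ⟨m, -, hm⟩ := h1
  exact ⟨m, sub_eq_zero.1 hm⟩

theorem IsLyapunovBranches.isLyapunovGerm (hV : IsPotential V) (hΔ : IsLyapunovBranches V Δ)
    {z : ℂ} (hz : z ∈ cutUpper V) (m : Fin N) : IsLyapunovGerm V (Δ m) z :=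
  ⟨hΔ.analytic m z hz, by
    filter_upwards [(isOpen_cutUpper hV).mem_nhds hz] with w hw using hΔ.mem_values hw m⟩

/-- If `g` takes values of the Lyapunov function on the upper side of a real point, it agrees there
with one of the branches. -/
theorem IsLyapunovBranches.exists_eq_of_upper (hV : IsPotential V) (hΔ : IsLyapunovBranches V Δ)
    {g : ℂ → ℂ} {x : ℂ} (hx : x.im = 0) (hg : IsLyapunovGerm V g x) :
    ∃ m, ∀ᶠ w in 𝓝 x, 0 < w.im → Δ m w = g w := by
  obtain ⟨r, hr, hb⟩ := Metric.eventually_nhds_iff_ball.1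
    (hg.eventually.and (eventually_mem_cutUpper_of_im_eq_zero hV hx))
  set H := Metric.ball x r ∩ {w : ℂ | 0 < w.im} with hH
  have hHo : IsOpen H := Metric.isOpen_ball.inter (isOpen_lt continuous_const Complex.continuous_im)
  have hU : ∀ w ∈ H, w ∈ cutUpper V := fun w hw => (hb w hw.1).2 hw.2
  obtain ⟨w₀, hw₀⟩ : H.Nonempty := by
    have := nhdsWithin_im_neBot hx
    exact (inter_mem (mem_nhdsWithin_of_mem_nhds (Metric.ball_mem_nhds x hr))
      self_mem_nhdsWithin : H ∈ 𝓝[{w : ℂ | 0 < w.im}] x) |> Filter.nonempty_of_mem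
  -- Each value of g on the half disc is the value of one of finitely many branches, so some branch
  -- meets g at points accumulating at w₀.
  have hex : ∃ m, ∃ᶠ w in 𝓝[≠] w₀, Δ m w = g w := by
    by_contra! hcon
    have h1 : ∀ᶠ w in 𝓝[≠] w₀, ∀ m, ¬ Δ m w = g w :=
      eventually_all.2 hcon
    obtain ⟨w, hw1, hw2⟩ := (h1.and (mem_nhdsWithin_of_mem_nhds (hHo.mem_nhds hw₀))).exists
    obtain ⟨m, hm⟩ := hΔ.exists_eq (hU w hw2) (hb w hw2.1).1.2.self_of_nhds
    exact hw1 m hm.symm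
  obtain ⟨m, hm⟩ := hex
  have heq : EqOn (Δ m) g H := AnalyticOnNhd.eqOn_of_preconnected_of_frequently_eq
    (fun w hw => hΔ.analytic m w (hU w hw)) (fun w hw => (hb w hw.1).1.1)
    (isPreconnected_ball_inter_im x r) hw₀ hm
  refine ⟨m, ?_⟩
  filter_upwards [Metric.ball_mem_nhds x hr] with w hw him
  exact heq ⟨hw, him⟩

/-- The determinant of L(w) - f(w) is analytic near x and vanishes on the upper side, hence on a
full neighbourhood. -/
theorem isLyapunovGerm_of_upper (hV : IsPotential V) {f : ℂ → ℂ} {x : ℂ} (hx : x.im = 0)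
    (hf : AnalyticAt ℂ f x) (h : ∀ᶠ w in 𝓝 x, 0 < w.im → f w ∈ lyapunovValues V w) :
    IsLyapunovGerm V f x := by
  refine ⟨hf, ?_⟩
  have ha : AnalyticAt ℂ (fun w => (lyapunovMatrix V w - f w • 1).det) x := by
    rw [Complex.analyticAt_iff_eventually_differentiableAt]
    filter_upwards [hf.eventually_analyticAt] with w hw
    simp only [Matrix.det_apply, Matrix.sub_apply, Matrix.smul_apply, smul_eq_mul]
    refine DifferentiableAt.fun_sum fun σ _ => (DifferentiableAt.fun_finsetProd fun i _ =>
      ?_).const_smul _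
    exact (lyapunovMatrix_differentiable hV _ _ w).sub (hw.differentiableAt.mul_const _)
  have h0 : (fun w => (lyapunovMatrix V w - f w • 1).det) =ᶠ[𝓝 x] fun _ => 0 := by
    refine eventually_eq_of_upper hx ha analyticAt_const ?_
    filter_upwards [h] with w hw him
    exact (mem_lyapunovValues_iff hV w _).1 (hw him)
  filter_upwards [h0] with w hw
  exact (mem_lyapunovValues_iff hV w _).2 hw

/-- The extension of `f` from the upper half plane by `conj g(conj z)`. -/
def reflect (f g : ℂ → ℂ) (z : ℂ) : ℂ :=
  if 0 < z.im then f z else starRingEnd ℂ (g (starRingEnd ℂ z))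

theorem reflect_eventuallyEq {f g h : ℂ → ℂ} {x : ℂ}
    (hf : ∀ᶠ w in 𝓝 x, 0 < w.im → f w = h w)
    (hg : ∀ᶠ w in 𝓝 x, w.im ≤ 0 → starRingEnd ℂ (g (starRingEnd ℂ w)) = h w) :
    h =ᶠ[𝓝 x] reflect f g := by
  filter_upwards [hf, hg] with w h1 h2
  rw [reflect]
  split_ifs with h3
  · exact (h1 h3).symm
  · exact (h2 (not_lt.1 h3)).symm

theorem reflect_eventuallyEq_of_im_pos {f g : ℂ → ℂ} {z : ℂ} (hz : 0 < z.im) :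
    f =ᶠ[𝓝 z] reflect f g := by
  filter_upwards [Complex.continuous_im.continuousAt.eventually (lt_mem_nhds hz)] with w hw
  rw [reflect, if_pos hw]

variable {α β : ℝ} {j : Fin N} {f : ℂ → ℂ}

theorem IsLyapunovBranches.extension_isLyapunovGerm (hV : IsPotential V)
    (hΔ : IsLyapunovBranches V Δ)
    (hf : IsAnalyticExtension (Δ j) (cutUpper V) f (cutUpper V ∪ realInterval α β)) {x : ℂ}
    (hx : x ∈ realInterval α β) : IsLyapunovGerm V f x := by
  have h0 := (mem_realInterval.1 hx).1
  refine isLyapunovGerm_of_upper hV h0 (hf.1 x (Or.inr hx)) ?_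
  filter_upwards [eventually_mem_cutUpper_of_im_eq_zero hV h0] with w hw him
  rw [hf.2 (hw him)]
  exact hΔ.mem_values (hw him) j

/-- The reflection of an extended branch in a real interval is one of the branches. -/
theorem IsLyapunovBranches.exists_reflected (hV : IsPotential V) (hΔ : IsLyapunovBranches V Δ)
    (hαβ : α < β)
    (hf : IsAnalyticExtension (Δ j) (cutUpper V) f (cutUpper V ∪ realInterval α β)) :
    ∃ i, ∀ x ∈ realInterval α β, ∀ᶠ w in 𝓝 x, 0 < w.im →
      Δ i w = starRingEnd ℂ (f (starRingEnd ℂ w)) := by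
  set g : ℂ → ℂ := fun w => starRingEnd ℂ (f (starRingEnd ℂ w)) with hg
  have hgerm : ∀ x ∈ realInterval α β, IsLyapunovGerm V g x := fun x hx => by
    have := (hΔ.extension_isLyapunovGerm hV hf hx).conj hV
    rwa [Complex.conj_eq_iff_im.2 (mem_realInterval.1 hx).1] at this
  have hex : ∀ x ∈ realInterval α β, ∃ m, ∀ᶠ w in 𝓝 x, 0 < w.im → Δ m w = g w :=
    fun x hx => hΔ.exists_eq_of_upper hV (mem_realInterval.1 hx).1 (hgerm x hx)
  have hmid : (((α + β) / 2 : ℝ) : ℂ) ∈ realInterval α β :=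
    ⟨_, ⟨by linarith, by linarith⟩, rfl⟩
  obtain ⟨i, hi⟩ := hex _ hmid
  have hopen : ∀ m, IsOpen {t : ℝ | ∀ᶠ w in 𝓝 (t : ℂ), 0 < w.im → Δ m w = g w} := fun m =>
    isOpen_iff_mem_nhds.2 fun t ht =>
      Complex.continuous_ofReal.continuousAt.eventually (eventually_eventually_nhds.2 ht)
  -- The set of t served by the index i is open. It is relatively closed too, by the identity
  -- theorem on the upper half disc about a limit point, so it is the whole interval.
  have hall : Ioo α β ⊆ {t : ℝ | ∀ᶠ w in 𝓝 (t : ℂ), 0 < w.im → Δ i w = g w} := by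
    refine isPreconnected_Ioo.subset_of_closure_inter_subset (hopen i)
      ⟨(α + β) / 2, ⟨by linarith, by linarith⟩, hi⟩ ?_
    rintro t ⟨ht, htI⟩
    have hx : (t : ℂ) ∈ realInterval α β := ⟨t, htI, rfl⟩
    have h0 : (t : ℂ).im = 0 := Complex.ofReal_im t
    obtain ⟨r, hr, hb⟩ := Metric.eventually_nhds_iff_ball.1
      ((hgerm _ hx).eventually.and (eventually_mem_cutUpper_of_im_eq_zero hV h0))
    obtain ⟨s, hs1, hs2⟩ := mem_closure_iff_nhds.1 ht _
      (Complex.continuous_ofReal.continuousAt.preimage_mem_nhds (Metric.ball_mem_nhds (t : ℂ) hr))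
    have hne := nhdsWithin_im_neBot (Complex.ofReal_im s)
    have h1 : ∀ᶠ w in 𝓝[{w : ℂ | 0 < w.im}] (s : ℂ), ∀ᶠ w' in 𝓝 w, Δ i w' = g w' := by
      rw [eventually_nhdsWithin_iff]
      filter_upwards [eventually_eventually_nhds.2 hs2] with w hw him
      filter_upwards [hw, Complex.continuous_im.continuousAt.eventually (lt_mem_nhds him)]
        with w' h h' using h h'
    obtain ⟨w₀, ⟨hw1, hw2⟩, hw3⟩ := ((h1.and (mem_nhdsWithin_of_mem_nhds
      (Metric.isOpen_ball.mem_nhds hs1))).and self_mem_nhdsWithin).exists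
    have heq : EqOn (Δ i) g (Metric.ball (t : ℂ) r ∩ {w | 0 < w.im}) :=
      AnalyticOnNhd.eqOn_of_preconnected_of_eventuallyEq
        (fun w hw => hΔ.analytic i w ((hb w hw.1).2 hw.2)) (fun w hw => (hb w hw.1).1.1)
        (isPreconnected_ball_inter_im _ r) ⟨hw2, hw3⟩ hw1
    rw [mem_ofPred_eq]
    filter_upwards [Metric.ball_mem_nhds (t : ℂ) hr] with w hw him
    exact heq ⟨hw, him⟩
  refine ⟨i, ?_⟩
  rintro _ ⟨t, ht, rfl⟩
  exact hall ht

/-- Continue Δ_j to a point of the interval, conjugate inside the component, and move back to the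
upper side, where the germ is that of Δ_i. Connectedness of the cut half plane carries membership to
all its points. -/
theorem IsLyapunovBranches.isBranchOn_of_reflected (hV : IsPotential V)
    (hbottom : IsLeast {μ : ℝ | (μ : ℂ) ∈ operatorSpectrum V} 0) (hΔ : IsLyapunovBranches V Δ)
    {ζ : LyapunovSurface V} (hj : IsBranchOn (connectedComponent ζ) (Δ j))
    (hf : IsAnalyticExtension (Δ j) (cutUpper V) f (cutUpper V ∪ realInterval α β)) {x : ℂ}
    (hx : x ∈ realInterval α β) {i : Fin N} (hi : ∀ᶠ w in 𝓝 x, 0 < w.im →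
      Δ i w = starRingEnd ℂ (f (starRingEnd ℂ w))) :
    IsBranchOn (connectedComponent ζ) (Δ i) := by
  have h0 := (mem_realInterval.1 hx).1
  have hne := nhdsWithin_im_neBot h0
  rw [isBranchOn_iff] at hj ⊢
  have hgermx := hΔ.extension_isLyapunovGerm hV hf hx
  have hxS : GermIn (connectedComponent ζ) f x := by
    obtain ⟨r, hr, hb⟩ := Metric.eventually_nhds_iff_ball.1 hgermx.eventually
    have h1 : ∀ᶠ w in 𝓝[{w : ℂ | 0 < w.im}] x, w ∈ cutUpper V :=
      eventually_nhdsWithin_iff.2 (eventually_mem_cutUpper_of_im_eq_zero hV h0)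
    obtain ⟨w, hw1, hw2⟩ := (h1.and (mem_nhdsWithin_of_mem_nhds (Metric.ball_mem_nhds x hr))).exists
    have hw : GermIn (connectedComponent ζ) f w := (hj w hw1).congr <| by
      filter_upwards [(isOpen_cutUpper hV).mem_nhds hw1] with w' hw' using (hf.2 hw').symm
    exact hw.of_isPreconnected (convex_ball x r).isPreconnected hb hw2 (Metric.mem_ball_self hr)
  have hconj := hxS.conj_of_isLeast hV hbottom
  rw [Complex.conj_eq_iff_im.2 h0] at hconj
  have h2 : ∀ᶠ w in 𝓝[{w : ℂ | 0 < w.im}] x, w ∈ cutUpper V ∧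
      GermIn (connectedComponent ζ) (Δ i) w := by
    rw [eventually_nhdsWithin_iff]
    filter_upwards [eventually_mem_cutUpper_of_im_eq_zero hV h0, hconj.eventually,
      eventually_eventually_nhds.2 hi] with w h3 h4 h5 him
    refine ⟨h3 him, h4.congr ?_⟩
    filter_upwards [h5, Complex.continuous_im.continuousAt.eventually (lt_mem_nhds him)]
      with w' h6 h7 using (h6 h7).symm
  obtain ⟨w, hw1, hw2⟩ := h2.exists
  exact fun z hz => hw2.of_isPreconnected (isPreconnected_cutUpper hV)
    (fun w hw => hΔ.isLyapunovGerm hV hw i) hw1 hz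

theorem im_pos_of_exp_eq_eta {k w : ℂ} (h : Complex.exp (-Complex.I * k) = eta w)
    (hw : ¬ InBand w) : 0 < k.im := by
  have h1 := one_lt_norm_eta hw
  rw [← h, Complex.norm_exp] at h1
  simpa using h1

theorem reflectGlue_of_mem_cutUpper {k₁ k₂ : ℂ → ℂ} {n : ℤ} {z : ℂ} (hz : z ∈ cutUpper V) :
    reflectGlue k₁ k₂ n z = k₁ z :=
  if_pos hz.1

theorem reflectGlue_of_mem_cutLower {k₁ k₂ : ℂ → ℂ} {n : ℤ} {z : ℂ} (hz : z ∈ cutLower V) :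
    reflectGlue k₁ k₂ n z = 2 * Real.pi * n - starRingEnd ℂ (k₂ (starRingEnd ℂ z)) := by
  have h : z.im < 0 := hz.1
  rw [reflectGlue, if_neg (not_lt.2 h.le), if_pos h]

theorem IsLyapunovBranches.im_quasimomentum_pos (hV : IsPotential V)
    (hbottom : IsLeast {μ : ℝ | (μ : ℂ) ∈ operatorSpectrum V} 0) (hΔ : IsLyapunovBranches V Δ)
    {m : Fin N} {k : ℂ → ℂ} (hk : IsQuasimomentum V (Δ m) k) {z : ℂ} (hz : z ∈ cutUpper V) :
    0 < (k z).im :=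
  im_pos_of_exp_eq_eta (hk.2 z hz) (not_inBand hV hbottom (hΔ.mem_values hz m) hz.1.ne')

/-- Symmetry and positivity of the imaginary part of a function that is reflected in a real
interval. -/
theorem im_conj_eq_and_pos (hV : IsPotential V) {K k : ℂ → ℂ} {c : ℝ}
    (hU : ∀ z ∈ cutUpper V, K z = k z)
    (hL : ∀ z ∈ cutLower V, K z = c - starRingEnd ℂ (k (starRingEnd ℂ z)))
    (hpos : ∀ z ∈ cutUpper V, 0 < (k z).im) (hY : ∀ z ∈ realInterval α β, 0 < (K z).im) {z : ℂ}
    (hz : z ∈ cutUpper V ∪ cutLower V ∪ realInterval α β) :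
    (K z).im = (K (starRingEnd ℂ z)).im ∧ 0 < (K z).im := by
  rcases hz with (hz | hz) | hz
  · have hz' : starRingEnd ℂ z ∈ cutLower V := by
      rwa [mem_cutLower_iff hV, Complex.conj_conj]
    rw [hU z hz, hL _ hz', Complex.conj_conj]
    exact ⟨by simp, hpos z hz⟩
  · have hz' := (mem_cutLower_iff hV).1 hz
    rw [hL z hz, hU _ hz']
    have := hpos _ hz'
    exact ⟨by simp, by simpa using this⟩
  · rw [Complex.conj_eq_iff_im.2 (mem_realInterval.1 hz).1]
    exact ⟨rfl, hY z hz⟩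

/-- A real-valued f is its own reflection, so the reflection relation with k₁ = k₂ reads 2 Re k =
2πn on the interval. -/
theorem IsLyapunovBranches.exists_quasimomentum_extension_of_real (hV : IsPotential V)
    (hbottom : IsLeast {μ : ℝ | (μ : ℂ) ∈ operatorSpectrum V} 0) (hΔ : IsLyapunovBranches V Δ)
    {k : ℂ → ℂ} (hk : IsQuasimomentum V (Δ j) k) (hαβ : α < β)
    (hf : IsAnalyticExtension (Δ j) (cutUpper V) f (cutUpper V ∪ realInterval α β))
    (hreal : ∀ z ∈ realInterval α β, (f z).im = 0 ∧ (f z).re ∉ Icc (-1 : ℝ) 1) :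
    ∃ kj : ℂ → ℂ,
      IsAnalyticExtension k (cutUpper V) kj (cutUpper V ∪ cutLower V ∪ realInterval α β) ∧
      (∃ n : ℤ, ∀ z ∈ realInterval α β, (kj z).re = Real.pi * n) ∧
      ∀ z ∈ cutUpper V ∪ cutLower V ∪ realInterval α β,
        (kj z).im = (kj (starRingEnd ℂ z)).im ∧ 0 < (kj z).im := by
  have hkf : IsQuasimomentum V f k := ⟨hk.1, fun z hz => by rw [hk.2 z hz, hf.2 hz]⟩
  have hband : ∀ z ∈ realInterval α β, ¬ InBand (f z) := fun z hz h => (hreal z hz).2 h.2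
  obtain ⟨n, ha, hY⟩ := exists_reflectGlue_analytic hV hαβ hf.1 hf.1
    (fun z hz => Complex.conj_eq_iff_im.2 (hreal z hz).1) hband hkf hkf
  refine ⟨reflectGlue k k n, ⟨ha, fun z hz => reflectGlue_of_mem_cutUpper hz⟩,
    ⟨n, fun z hz => ?_⟩, fun z hz => ?_⟩
  · have := congrArg Complex.re (hY z hz).2.1
    simp only [Complex.add_re, Complex.conj_re, Complex.mul_re, Complex.re_ofNat, Complex.ofReal_re,
      Complex.im_ofNat, Complex.ofReal_im, Complex.intCast_re, Complex.intCast_im] at this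
    linarith
  · exact im_conj_eq_and_pos hV (c := 2 * Real.pi * n)
      (fun z hz => reflectGlue_of_mem_cutUpper hz)
      (fun z hz => by rw [reflectGlue_of_mem_cutLower hz]; push_cast; rfl)
      (fun z hz => hΔ.im_quasimomentum_pos hV hbottom hk hz)
      (fun z hz => im_pos_of_exp_eq_eta (hY z hz).1 (hband z hz)) hz

/-- Below the axis k_j continues as 2πn - conj k_i(conj z) and k_i as 2πn - conj k_j(conj z), with
the same n. Reflection exchanges the two imaginary parts, and the sum is symmetric. -/
theorem IsLyapunovBranches.exists_reflection_of_nonreal (hV : IsPotential V)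
    (hbottom : IsLeast {μ : ℝ | (μ : ℂ) ∈ operatorSpectrum V} 0) (hΔ : IsLyapunovBranches V Δ)
    {k : Fin N → ℂ → ℂ} (hk : ∀ m, IsQuasimomentum V (Δ m) (k m)) (hαβ : α < β)
    {ζ : LyapunovSurface V} (hj : IsBranchOn (connectedComponent ζ) (Δ j))
    (hf : IsAnalyticExtension (Δ j) (cutUpper V) f (cutUpper V ∪ realInterval α β))
    (hnonreal : ∀ z ∈ realInterval α β, (f z).im ≠ 0) :
    ∃ i : Fin N, IsBranchOn (connectedComponent ζ) (Δ i) ∧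
      (∃ Δi : ℂ → ℂ,
        IsAnalyticExtension (Δ i) (cutUpper V) Δi (cutUpper V ∪ realInterval α β) ∧
        ∀ z ∈ realInterval α β, starRingEnd ℂ (Δi z) = f z) ∧
      (∃ E : ℂ → ℂ,
        IsAnalyticExtension (Δ j) (cutUpper V) E (cutUpper V ∪ cutLower V ∪ realInterval α β) ∧
        ∀ z ∈ cutLower V, E z = starRingEnd ℂ (Δ i (starRingEnd ℂ z))) ∧
      ∃ ki kj K : ℂ → ℂ,
        IsAnalyticExtension (k i) (cutUpper V) ki (cutUpper V ∪ realInterval α β) ∧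
        IsAnalyticExtension (k j) (cutUpper V) kj (cutUpper V ∪ realInterval α β) ∧
        IsAnalyticExtension (fun z => k i z + k j z) (cutUpper V) K
          (cutUpper V ∪ cutLower V ∪ realInterval α β) ∧
        (∃ n : ℤ, ∀ z ∈ realInterval α β, (kj z).re + (ki z).re = 2 * Real.pi * n) ∧
        (∀ z ∈ realInterval α β, (kj z).im = (ki z).im) ∧
        (∀ z ∈ realInterval α β, K z = ki z + kj z) ∧
        ∀ z ∈ cutUpper V ∪ cutLower V ∪ realInterval α β,
          (K z).im = (K (starRingEnd ℂ z)).im ∧ 0 < (K z).im := by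
  obtain ⟨i, hi⟩ := hΔ.exists_reflected hV hαβ hf
  have hmid : (((α + β) / 2 : ℝ) : ℂ) ∈ realInterval α β :=
    ⟨_, ⟨by linarith, by linarith⟩, rfl⟩
  have hband : ∀ z ∈ realInterval α β, ¬ InBand (f z) := fun z hz h => hnonreal z hz h.1
  have hUpos : ∀ z ∈ cutUpper V, 0 < z.im := fun z hz => hz.1
  have hΔi : ∀ x ∈ realInterval α β,
      (fun w => starRingEnd ℂ (f (starRingEnd ℂ w))) =ᶠ[𝓝 x] reflect (Δ i) f := fun x hx =>
    reflect_eventuallyEq (hi x hx) (Eventually.of_forall fun w _ => rfl)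
  have hΔiY : ∀ x ∈ realInterval α β, reflect (Δ i) f x = starRingEnd ℂ (f x) := fun x hx => by
    rw [← (hΔi x hx).self_of_nhds]
    exact congrArg (fun w => starRingEnd ℂ (f w))
      (Complex.conj_eq_iff_im.2 (mem_realInterval.1 hx).1)
  have hexti : IsAnalyticExtension (Δ i) (cutUpper V) (reflect (Δ i) f)
      (cutUpper V ∪ realInterval α β) := by
    refine ⟨?_, fun z hz => by rw [reflect, if_pos (hUpos z hz)]⟩
    rintro z (hz | hz)
    · exact (hΔ.analytic i z hz).congr (reflect_eventuallyEq_of_im_pos hz.1)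
    · exact (analyticAt_conj_of_im_eq_zero (mem_realInterval.1 hz).1
        (hf.1 z (Or.inr hz))).congr (hΔi z hz)
  have hkj : IsQuasimomentum V f (k j) :=
    ⟨(hk j).1, fun z hz => by rw [(hk j).2 z hz, hf.2 hz]⟩
  have hki : IsQuasimomentum V (reflect (Δ i) f) (k i) :=
    ⟨(hk i).1, fun z hz => by rw [(hk i).2 z hz, hexti.2 hz]⟩
  obtain ⟨n, haj, hY⟩ := exists_reflectGlue_analytic hV hαβ hf.1 hexti.1
    (fun z hz => by rw [hΔiY z hz, Complex.conj_conj]) hband hkj hki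
  set kj := reflectGlue (k j) (k i) n with hkjdef
  set ki := reflectGlue (k i) (k j) n with hkidef
  have hai : AnalyticOnNhd ℂ ki (cutUpper V ∪ cutLower V ∪ realInterval α β) := by
    rintro z ((hz | hz) | hz)
    · refine ((hk i).1 z hz).congr ?_
      filter_upwards [(isOpen_cutUpper hV).mem_nhds hz] with w hw
      exact (reflectGlue_of_mem_cutUpper hw).symm
    · have h1 := analyticAt_conj_conj ((hk j).1 _ ((mem_cutLower_iff hV).1 hz))
      rw [Complex.conj_conj] at h1
      have h2 : AnalyticAt ℂ
          (fun w => 2 * Real.pi * n - starRingEnd ℂ (k j (starRingEnd ℂ w))) z :=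
        analyticAt_const.sub h1
      refine h2.congr ?_
      filter_upwards [Complex.continuous_im.continuousAt.eventually (gt_mem_nhds hz.1)] with w hw
      rw [hkidef, reflectGlue, if_neg (not_lt.2 (le_of_lt hw)), if_pos hw]
    · exact (hY z hz).2.2
  have hsub : cutUpper V ∪ realInterval α β ⊆ cutUpper V ∪ cutLower V ∪ realInterval α β :=
    union_subset_union_left _ subset_union_left
  have hre : ∀ z ∈ realInterval α β, (kj z).re + (ki z).re = 2 * Real.pi * n := fun z hz => by
    simpa using congrArg Complex.re (hY z hz).2.1
  have him : ∀ z ∈ realInterval α β, (kj z).im = (ki z).im := fun z hz => by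
    have := congrArg Complex.im (hY z hz).2.1
    simp only [Complex.add_im, Complex.conj_im, Complex.mul_im, Complex.mul_re, Complex.re_ofNat,
      Complex.ofReal_re, Complex.im_ofNat, Complex.ofReal_im, Complex.intCast_re,
      Complex.intCast_im] at this
    linarith
  refine ⟨i, hΔ.isBranchOn_of_reflected hV hbottom hj hf hmid (hi _ hmid),
    ⟨reflect (Δ i) f, hexti, fun z hz => by rw [hΔiY z hz, Complex.conj_conj]⟩,
    -- The inner reflection extends Δ_i to the interval, so that the outer one also has the right
    -- value on the real axis, namely f.
    ⟨reflect (Δ j) (reflect (Δ i) f), ⟨?_, fun z hz => by rw [reflect, if_pos (hUpos z hz)]⟩,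
      fun z hz => ?_⟩,
    ki, kj, fun z => ki z + kj z, ⟨hai.mono hsub, fun z hz => reflectGlue_of_mem_cutUpper hz⟩,
    ⟨haj.mono hsub, fun z hz => reflectGlue_of_mem_cutUpper hz⟩, ⟨hai.add haj, fun z hz => ?_⟩,
    ⟨n, hre⟩, him, fun z _ => rfl, fun z hz => ?_⟩
  · rintro z ((hz | hz) | hz)
    · exact (hΔ.analytic j z hz).congr (reflect_eventuallyEq_of_im_pos hz.1)
    · have h1 := analyticAt_conj_conj (hΔ.analytic i _ ((mem_cutLower_iff hV).1 hz))
      rw [Complex.conj_conj] at h1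
      refine h1.congr ?_
      filter_upwards [Complex.continuous_im.continuousAt.eventually (gt_mem_nhds hz.1)] with w hw
      rw [reflect, if_neg (not_lt.2 (le_of_lt hw)), reflect, if_pos (by simpa using hw)]
    · have h0 := (mem_realInterval.1 hz).1
      refine (hf.1 z (Or.inr hz)).congr (reflect_eventuallyEq ?_ ?_)
      · filter_upwards [eventually_mem_cutUpper_of_im_eq_zero hV h0] with w hw hw0
        exact (hf.2 (hw hw0)).symm
      · filter_upwards [(tendsto_conj_nhds h0).eventually (hΔi z hz)] with w hw _
        rw [← hw, Complex.conj_conj, Complex.conj_conj]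
  · have hz' : 0 < (starRingEnd ℂ z).im := hUpos _ ((mem_cutLower_iff hV).1 hz)
    have hz0 : z.im < 0 := hz.1
    rw [reflect, if_neg (not_lt.2 hz0.le), reflect, if_pos hz']
  · simp only [hkidef, hkjdef, reflectGlue_of_mem_cutUpper hz]
  · refine im_conj_eq_and_pos hV (K := fun z => ki z + kj z) (k := fun z => k i z + k j z)
      -- Each of the two quasimomenta contributes 2πn.
      (c := 4 * Real.pi * n) (fun z hz => ?_) (fun z hz => ?_) (fun z hz => ?_) (fun z hz => ?_) hz
    · simp only [hkidef, hkjdef, reflectGlue_of_mem_cutUpper hz]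
    · simp only [hkidef, hkjdef, reflectGlue_of_mem_cutLower hz, map_add]
      push_cast
      ring
    · exact add_pos (hΔ.im_quasimomentum_pos hV hbottom (hk i) hz)
        (hΔ.im_quasimomentum_pos hV hbottom (hk j) hz)
    · have h1 := im_pos_of_exp_eq_eta (hY z hz).1 (hband z hz)
      have h2 := him z hz
      rw [Complex.add_im]
      linarith

end Branches

end

end PeriodicMatrixSchrodinger

end

/-! ### The theorem -/

open PeriodicMatrixSchrodinger in
theorem theorem4p1 {N : ℕ} (hN : 2 ≤ N) (V : ℝ → Matrix (Fin N) (Fin N) ℝ) (hV : IsPotential V)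
    (hbottom : IsLeast {μ : ℝ | (μ : ℂ) ∈ operatorSpectrum V} 0)
    (S : Set (LyapunovSurface V)) (hS : ∃ ζ₀ : LyapunovSurface V, S = connectedComponent ζ₀) :
    SubharmonicOnSurface (lyapunovQ (V := V)) S ∧
    (∀ r : ℝ, 0 < r → ∃ C ρ : ℝ, 0 < ρ ∧ ∀ ζ ∈ S, ρ ≤ ‖proj ζ‖ →
      r * abs (proj ζ).re < (proj ζ).im → abs (lyapunovQ ζ - (proj ζ).im) ≤ C / ‖proj ζ‖) ∧
    (∃ C ρ : ℝ, 0 < ρ ∧ ∀ ζ ∈ S, ρ ≤ ‖proj ζ‖ →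
      abs (lyapunovQ ζ - abs (proj ζ).im) ≤ C * ‖proj ζ‖ ^ (-(1 / 2) : ℝ)) ∧
    ∀ Δ k : Fin N → ℂ → ℂ, IsLyapunovBranches V Δ → (∀ m, IsQuasimomentum V (Δ m) (k m)) →
    ∀ j : Fin N, IsBranchOn S (Δ j) →
    ∀ α β : ℝ, α < β →
    ∀ Δj : ℂ → ℂ,
      IsAnalyticExtension (Δ j) (cutUpper V) Δj (cutUpper V ∪ realInterval α β) →
      ((∀ z ∈ realInterval α β, (Δj z).im = 0 ∧ (Δj z).re ∉ Set.Icc (-1 : ℝ) 1) →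
        ∃ kj : ℂ → ℂ,
          IsAnalyticExtension (k j) (cutUpper V) kj
            (cutUpper V ∪ cutLower V ∪ realInterval α β) ∧
          (∃ n : ℤ, ∀ z ∈ realInterval α β, (kj z).re = Real.pi * n) ∧
          ∀ z ∈ cutUpper V ∪ cutLower V ∪ realInterval α β,
            (kj z).im = (kj (starRingEnd ℂ z)).im ∧ 0 < (kj z).im) ∧
      ((∀ z ∈ realInterval α β, (Δj z).im ≠ 0) →
        ∃ i : Fin N, IsBranchOn S (Δ i) ∧
          (∃ Δi : ℂ → ℂ,
            IsAnalyticExtension (Δ i) (cutUpper V) Δi (cutUpper V ∪ realInterval α β) ∧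
            ∀ z ∈ realInterval α β, starRingEnd ℂ (Δi z) = Δj z) ∧
          (∃ E : ℂ → ℂ,
            IsAnalyticExtension (Δ j) (cutUpper V) E
              (cutUpper V ∪ cutLower V ∪ realInterval α β) ∧
            ∀ z ∈ cutLower V, E z = starRingEnd ℂ (Δ i (starRingEnd ℂ z))) ∧
          ∃ ki kj K : ℂ → ℂ,
            IsAnalyticExtension (k i) (cutUpper V) ki (cutUpper V ∪ realInterval α β) ∧
            IsAnalyticExtension (k j) (cutUpper V) kj (cutUpper V ∪ realInterval α β) ∧
            IsAnalyticExtension (fun z => k i z + k j z) (cutUpper V) K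
              (cutUpper V ∪ cutLower V ∪ realInterval α β) ∧
            (∃ n : ℤ, ∀ z ∈ realInterval α β, (kj z).re + (ki z).re = 2 * Real.pi * n) ∧
            (∀ z ∈ realInterval α β, (kj z).im = (ki z).im) ∧
            (∀ z ∈ realInterval α β, K z = ki z + kj z) ∧
            ∀ z ∈ cutUpper V ∪ cutLower V ∪ realInterval α β,
              (K z).im = (K (starRingEnd ℂ z)).im ∧ 0 < (K z).im) := by
  obtain ⟨ζ, rfl⟩ := hS
  obtain ⟨C, ρ, hC, hρ, hbound⟩ := exists_lyapunovQ_bound hV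
  have hQ : ∀ ζ : LyapunovSurface V, ρ ≤ ‖proj ζ‖ →
      abs (lyapunovQ ζ - abs (proj ζ).im) ≤ C / ‖proj ζ‖ := fun ζ hζ =>
    hbound _ _ hζ (lyapunov_mem_values ζ)
  refine ⟨subharmonicOnSurface_lyapunovQ _, fun r hr => ⟨C, ρ, by linarith, fun ζ _ hζ him => ?_⟩,
    ⟨C, ρ, by linarith, fun ζ _ hζ => (hQ ζ hζ).trans ?_⟩, ?_⟩
  · have h0 : 0 < (proj ζ).im := (mul_nonneg hr.le (abs_nonneg _)).trans_lt him
    have h1 := hQ ζ hζ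
    rwa [abs_of_pos h0] at h1
  -- For |z| ≥ 1 the uniform bound C/|z| is stronger than the required C|z|^{-1/2}.
  · have h1 : 1 ≤ ‖proj ζ‖ := hρ.trans hζ
    rw [div_eq_mul_inv, ← Real.rpow_neg_one]
    exact mul_le_mul_of_nonneg_left (Real.rpow_le_rpow_of_exponent_le h1 (by norm_num)) hC
  · intro Δ k hΔ hk j hj α β hαβ Δj hΔj
    exact ⟨hΔ.exists_quasimomentum_extension_of_real hV hbottom (hk j) hαβ hΔj,
      hΔ.exists_reflection_of_nonreal hV hbottom hk hαβ hj hΔj⟩
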